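/- Let $n\ge 1$, let $\Gamma_+=\{\lambda\in\mathbb R^n:\lambda_i>0\}$, and let $F\in C^2(\Gamma_+)$ be symmetric, positive, homogeneous of degree $1$, with $\partial F/\partial\lambda_i>0$ for all $i$, $F(1,\dots,1)=1$, and such that the dual function $F_*(\kappa)=1/F(1/\kappa_1,\dots,1/\kappa_n)$ is concave on $\Gamma_+$ and tends to $0$ at every point of $\partial\Gamma_+$. For a symmetric matrix $A=[a_{ij}]$ with eigenvalues $\lambda\in\Gamma_+$ write $F(A)=F(\lambda)$. Let $k\ge 1$ be an integer such that $F^k$ is divergence-free: with $D$ the Levi-Civita connection of the round sphere $\mathbb S^n$ and $(F^k)^{ij}=\partial F^k/\partial a_{ij}$ evaluated at $A=D^2u+uI$, one has $\sum_i D_i (F^k)^{ij}=0$ on $\mathbb S^n$ for every smooth $u:\mathbb S^n\to\mathbb R$ with $D^2u+uI>0$. For a nonempty compact convex set $M\subset\mathbb R^{n+1}$ let $u_M(x)=\max_{y\in M}\langle x,y\rangle$ be its support function. If $u_M$ is of class $C^2$ on $\mathbb S^n$ and $D^2u_M+u_MI>0$, let $\lambda_{\partial M}(x)$ be the eigenvalues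 of $D^2u_M+u_MI$ at $x$ (the principal radii of curvature of $\partial M$ at the point with outer normal $x$), and define the modified quermassintegral $$W_F(M)=\frac1{k+1}\int_{\mathbb S^n}u_M\,F^k(\lambda_{\partial M})\,dx ;$$ for all other nonempty compact convex sets $M$, $W_F(M)$ is defined by continuous extension with respect to the Hausdorff metric. Let $\varphi_1,\varphi_2:[0,\infty)\to[0,\infty)$ be convex and strictly increasing with $\varphi_j(0)=0$, $\varphi_j(1)=1$. For compact convex sets $K,L$ containing the origin and $\varepsilon\ge 0$ let $K+_{\varphi,\varepsilon}L$ be the compact convex set with support function $$u_{K+_{\varphi,\varepsilon}L}(x)=\inf\Big\{\lambda>0:\varphi_1\Big(\frac{u_K(x)}{\lambda}\Big)+\varepsilon\,\varphi_2\Big(\frac{u_L(x)}{\lambda}\Big)\le 1\Big\}.$$ Let $K$ be a compact convex set containing the origin in its interior that is smooth and strictly convex (that is, $u_K$ is smooth on $\mathbb S^n$ and $D^2u_K+u_KI>0$), and let $L$ be a compact convex set containing the origin. Then the Orlicz-mixed modified quermassintegral $$W_{\varphi,F}(K,L)=\lim_{\varepsilon\to0^+}\frac{W_F(K+_{\varphi,\varepsilon}L)-W_F(K)}{\varepsilon}$$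 exists, and $$W_{\varphi,F}(K,L)=\int_{\mathbb S^n}\frac{u_K(x)}{(\varphi_1)'_l(1)}\,\varphi_2\Big(\frac{u_L(x)}{u_K(x)}\Big)F^k(\lambda_{\partial K}(x))\,dx,$$ where $(\varphi_1)'_l$ denotes the left derivative of $\varphi_1$ and $dx$ the surface measure of $\mathbb S^n$. -/

import Mathlib

open MeasureTheory Filter Topology Set
open scoped RealInnerProductSpace ContDiff

namespace OrliczQuermass

noncomputable section

/-- The ambient Euclidean space `ℝ^{n+1}`. -/
abbrev E (n : ℕ) : Type := EuclideanSpace ℝ (Fin (n + 1))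

/-! ### Functions on the unit sphere

A function on `𝕊ⁿ` is represented by a function on `ℝ^{n+1}` of which only the values on the unit
sphere are used. -/

/-- The extension of `u|_{𝕊ⁿ}` that is constant along rays. -/
def radialExt {n : ℕ} (u : E n → ℝ) (y : E n) : ℝ := u (‖y‖⁻¹ • y)

/-- `u|_{𝕊ⁿ}` is of class `C^r`. -/
def SphereContDiff {n : ℕ} (r : WithTop ℕ∞) (u : E n → ℝ) : Prop :=
  ContDiffOn ℝ r (radialExt u) {0}ᶜ

/-- The covariant Hessian `D²u` of `u|_{𝕊ⁿ}` at the unit vector `x`, evaluated at `v, w ⟂ x`.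
As the radial derivative of `radialExt u` vanishes, the covariant Hessian is the restriction
of the Euclidean Hessian of `radialExt u` to the tangent space `x^⊥`. -/
def sphereHess {n : ℕ} (u : E n → ℝ) (x v w : E n) : ℝ :=
  fderiv ℝ (fderiv ℝ (radialExt u)) x v w

/-- The bilinear form `D²u + u I` on the tangent space `x^⊥`. -/
def radiiForm {n : ℕ} (u : E n → ℝ) (x v w : E n) : ℝ :=
  sphereHess u x v w + u x * ⟪v, w⟫

/-- `D²u + u I` is positive definite at every point of the sphere. -/
def RadiiPos {n : ℕ} (u : E n → ℝ) : Prop :=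
  ∀ x : E n, ‖x‖ = 1 → ∀ v : E n, ⟪x, v⟫ = 0 → v ≠ 0 → 0 < radiiForm u x v v

/-- An orthonormal basis of the tangent space `x^⊥` (for `x ≠ 0`). -/
def frame {n : ℕ} (x : E n) : Fin n → E n :=
  haveI : Fact (Module.finrank ℝ (E n) = n + 1) := ⟨by simp⟩
  if h : x ≠ 0 then
    fun i => ((OrthonormalBasis.fromOrthogonalSpanSingleton (𝕜 := ℝ) n h i : (ℝ ∙ x)ᗮ) : E n)
  else 0

/-- The matrix `[a_{ij}]` of a form `B` on `x^⊥` in an orthonormal frame. -/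
def frameMatrix {n : ℕ} (x : E n) (B : E n → E n → ℝ) : Matrix (Fin n) (Fin n) ℝ :=
  Matrix.of fun i j => B (frame x i) (frame x j)

open Classical in
/-- The eigenvalues of a symmetric bilinear form `B` on `x^⊥`. -/
def tangentEigenvalues {n : ℕ} (x : E n) (B : E n → E n → ℝ) : Fin n → ℝ :=
  if h : (frameMatrix x B).IsHermitian then h.eigenvalues else 0

/-! ### Curvature functions -/

/-- The positive cone `Γ₊`. -/
def posCone (n : ℕ) : Set (Fin n → ℝ) := {l | ∀ i, 0 < l i}

/-- The dual function `F_*(κ) = 1 / F(1/κ₁, …, 1/κₙ)`. -/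
def dualFun {n : ℕ} (F : (Fin n → ℝ) → ℝ) (κ : Fin n → ℝ) : ℝ := (F fun i => (κ i)⁻¹)⁻¹

/-- The standing assumptions on the curvature function `F`, a `C²` symmetric function on `Γ₊`. -/
structure IsCurvatureFunction {n : ℕ} (F : (Fin n → ℝ) → ℝ) : Prop where
  contDiffOn : ContDiffOn ℝ 2 F (posCone n)
  symm : ∀ (σ : Equiv.Perm (Fin n)), ∀ l ∈ posCone n, F (l ∘ σ) = F l
  pos : ∀ l ∈ posCone n, 0 < F l
  homogeneous : ∀ t : ℝ, 0 < t → ∀ l ∈ posCone n, F (t • l) = t * F l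
  strictMono : ∀ l ∈ posCone n, ∀ i, 0 < fderiv ℝ F l (Pi.single i 1)
  inverseConcave : ConcaveOn ℝ (posCone n) (dualFun F)
  dual_boundary : ∀ κ ∈ frontier (posCone n), Tendsto (dualFun F) (𝓝[posCone n] κ) (𝓝 0)
  normalized : F (fun _ => 1) = 1

/-- The symmetrized product `(v ⊗ w + w ⊗ v) / 2`. -/
def symProd {n : ℕ} (v w a b : E n) : ℝ := (⟪v, a⟫ * ⟪w, b⟫ + ⟪w, a⟫ * ⟪v, b⟫) / 2

/-- The tensor `(F^k)^{ij} = ∂F^k/∂a_{ij}` of `F^k(D²u + u I)` at `x`, evaluated on `v, w`.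
It depends only on the components of `v` and `w` tangential to the sphere at `x`. -/
def curvTensor {n : ℕ} (F : (Fin n → ℝ) → ℝ) (k : ℕ) (u : E n → ℝ) (x v w : E n) : ℝ :=
  deriv (fun t : ℝ =>
    F (tangentEigenvalues x fun a b => radiiForm u x a b + t * symProd v w a b) ^ k) 0

/-- The covariant divergence `∑ᵢ Dᵢ (F^k)^{ij}` on the sphere at `x`, contracted with `w ⟂ x`.
The derivative in the direction `eᵢ` is taken along the great circle through `x` in that direction.
As `curvTensor` vanishes on normal vectors, its covariant derivative is the tangential
part of its derivative as a tensor in the ambient space, so `eᵢ` and `w` stay fixed. -/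
def curvTensorDiv {n : ℕ} (F : (Fin n → ℝ) → ℝ) (k : ℕ) (u : E n → ℝ) (x w : E n) : ℝ :=
  ∑ i : Fin n, deriv (fun s : ℝ =>
    curvTensor F k u (Real.cos s • x + Real.sin s • frame x i) (frame x i) w) 0

/-- `F^k` is divergence-free: `∑ᵢ Dᵢ (F^k)^{ij} = 0` on the sphere for `F^k(D²u + u I)`,
for every smooth `u` with `D²u + u I > 0`. -/
def IsDivergenceFree {n : ℕ} (F : (Fin n → ℝ) → ℝ) (k : ℕ) : Prop :=
  ∀ u : E n → ℝ, SphereContDiff ∞ u → RadiiPos u →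
    ∀ x : E n, ‖x‖ = 1 → ∀ w : E n, ⟪x, w⟫ = 0 → curvTensorDiv F k u x w = 0

/-! ### Convex bodies

`ConvexBody V` is the type of nonempty compact convex subsets of `V`, with the Hausdorff metric. -/

/-- The support function `u_K`. -/
def supp {n : ℕ} (K : ConvexBody (E n)) (x : E n) : ℝ :=
  sSup ((fun y => ⟪x, y⟫) '' (K : Set (E n)))

/-- `K` is of class `C^r` and strictly convex: its support function is of class `C^r`
and all principal radii of curvature of `∂K` are positive (and finite). -/
def IsRegular {n : ℕ} (r : WithTop ℕ∞) (K : ConvexBody (E n)) : Prop :=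
  SphereContDiff r (supp K) ∧ RadiiPos (supp K)

/-- The principal radii of curvature `λ_{∂K}` at the boundary point with outer normal `x`:
the eigenvalues of `D²u_K + u_K I`. -/
def radii {n : ℕ} (K : ConvexBody (E n)) (x : E n) : Fin n → ℝ :=
  tangentEigenvalues x (radiiForm (supp K) x)

/-- Integration over `𝕊ⁿ` with respect to the standard surface measure. -/
def sphereIntegral {n : ℕ} (f : E n → ℝ) : ℝ :=
  ∫ x : Metric.sphere (0 : E n) 1, f x ∂((volume : Measure (E n)).toSphere)

/-- `1/(k+1) ∫ u_K F^k(λ_{∂K}) dx`, for bodies whose boundary has principal radii. -/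
def quermassRegular {n : ℕ} (F : (Fin n → ℝ) → ℝ) (k : ℕ) (K : ConvexBody (E n)) : ℝ :=
  1 / ((k : ℝ) + 1) * sphereIntegral fun x => supp K x * F (radii K x) ^ k

open Classical in
/-- The modified quermassintegral `W_F(K)`. It is given by the integral formula if `K` is of class
`C²` with positive principal radii, and for all other convex bodies by
continuity in the Hausdorff metric. -/
def quermass {n : ℕ} (F : (Fin n → ℝ) → ℝ) (k : ℕ) (K : ConvexBody (E n)) : ℝ :=
  if IsRegular 2 K then quermassRegular F k K
  else extendFrom {M : ConvexBody (E n) | IsRegular 2 M} (quermassRegular F k) K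

/-! ### Orlicz combinations -/

/-- Orlicz functions `[0,∞) → [0,∞)`. -/
structure IsOrlicz (φ : ℝ → ℝ) : Prop where
  convexOn : ConvexOn ℝ (Ici 0) φ
  strictMonoOn : StrictMonoOn φ (Ici 0)
  map_zero : φ 0 = 0
  map_one : φ 1 = 1

/-- The support function of the Orlicz combination `+_φ(K, L, α, β)`. -/
def orliczSupp {n : ℕ} (φ₁ φ₂ : ℝ → ℝ) (K L : ConvexBody (E n)) (α β : ℝ) (x : E n) : ℝ :=
  sInf {l : ℝ | 0 < l ∧ α * φ₁ (supp K x / l) + β * φ₂ (supp L x / l) ≤ 1}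

theorem orliczSupp_nonneg {n : ℕ} (φ₁ φ₂ : ℝ → ℝ) (K L : ConvexBody (E n)) (α β : ℝ) (x : E n) :
    0 ≤ orliczSupp φ₁ φ₂ K L α β x :=
  Real.sInf_nonneg fun _ h => h.1.le

/-- The Orlicz combination `+_φ(K, L, α, β)`: the convex body with support
function `orliczSupp`. -/
def orliczComb {n : ℕ} (φ₁ φ₂ : ℝ → ℝ) (K L : ConvexBody (E n)) (α β : ℝ) :
    ConvexBody (E n) where
  carrier := {y | ∀ x, ⟪x, y⟫ ≤ orliczSupp φ₁ φ₂ K L α β x}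
  convex' := by
    intro y hy z hz a b ha hb hab x
    have h1 := mul_le_mul_of_nonneg_left (hy x) ha
    have h2 := mul_le_mul_of_nonneg_left (hz x) hb
    rw [inner_add_right, inner_smul_right, inner_smul_right]
    calc _ ≤ _ := add_le_add h1 h2
      _ = _ := by rw [← add_mul, hab, one_mul]
  isCompact' := by
    refine Metric.isCompact_of_isClosed_isBounded ?_ ?_
    · rw [Set.ofPred_forall]
      exact isClosed_iInter fun x =>
        isClosed_le (continuous_const.inner continuous_id) continuous_const
    · let c : Fin (n + 1) → ℝ := fun i =>
        orliczSupp φ₁ φ₂ K L α β (EuclideanSpace.single i 1) +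
          orliczSupp φ₁ φ₂ K L α β (-EuclideanSpace.single i 1)
      refine (isBounded_iff_forall_norm_le).2 ⟨√(∑ i, c i ^ 2), fun y hy => ?_⟩
      rw [EuclideanSpace.norm_eq]
      refine Real.sqrt_le_sqrt (Finset.sum_le_sum fun i _ => ?_)
      have h1 := hy (EuclideanSpace.single i 1)
      have h2 := hy (-EuclideanSpace.single i 1)
      have h3 := orliczSupp_nonneg φ₁ φ₂ K L α β (EuclideanSpace.single i 1)
      have h4 := orliczSupp_nonneg φ₁ φ₂ K L α β (-EuclideanSpace.single i 1)
      rw [inner_neg_left] at h2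
      rw [EuclideanSpace.inner_single_left] at h1 h2
      simp only [map_one, one_mul] at h1 h2
      rw [Real.norm_eq_abs, sq_abs]
      exact sq_le_sq' (by simp only [c]; linarith) (by simp only [c]; linarith)
  nonempty' := ⟨0, fun x => by rw [inner_zero_right]; exact orliczSupp_nonneg ..⟩

/-- The left derivative of `φ` at `t`. -/
def leftDeriv (φ : ℝ → ℝ) (t : ℝ) : ℝ := derivWithin φ (Iio t) t

end

end OrliczQuermass

open OrliczQuermass

/-! For C² functions u with D²u + uI > 0 put W(u) = 1/(k+1) ∫ u F^k(D²u + uI). The formula rests on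
the fact that the first variation of W at u in direction v is ∫ v F^k(D²u + uI).

To prove this, the divergence condition is converted into algebra. It is tested on the restriction
to the sphere of a quadratic plus a small cubic polynomial, whose radii at a point are prescribed
and of which exactly one moves to first order along a suitable great circle. This forces ∂²F^k/∂λ_j²
= 0 on Γ₊ (`fderiv_fderiv_pow_eq_zero`). Being symmetric and affine in each variable, F^k is a
combination Σ w_i ∏_j (α_i λ_j + β_i) (`exists_pow_eq_sum_prod`), so F^k(D²u + uI) is a combination
of determinants det(D²u_i + u_i I) with u_i = α_i u + β_i.

For the determinant, let U be the 1-homogeneous extension of u. At a unit vector x the adjugate of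
the Hessian of U is det(D²u + uI) x ⊗ x, and the cofactors of a Hessian are divergence-free.
Integration by parts against a radial cutoff then shows that ∫ u det(D²u + uI) has first variation
(n+1) ∫ v det(D²u + uI) (`sphereIntegral_mul_radiiDet_sub`). Integrating from the zero function and
using that F^k is k-homogeneous recovers W (`detFunctional_sub_zero`). Hence W(u + v) - W(u) is the
integral over t in (0, 1] of ∫ v F^k(D²(u + tv) + (u + tv)I) (`quermassFun_sub`), which yields both
the first variation and the monotonicity of W.

An Orlicz combination need not be C², so there W_F is only a limit. Monotonicity, homogeneity and
the density of regular bodies show that, for bodies with the origin in the interior, this limit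
exists and lies between W(u) and W(v) whenever u ≤ u_M ≤ v with u, v regular (`quermass_sandwich`).
The support function of the combination is u_K + ε(g + o(1)) uniformly on the sphere, with g = u_K
φ₂(u_L/u_K) / (φ₁)'_l(1) (`orlicz_expansion`). Since g is merely continuous, it is replaced by a
smooth ψ up to δ; the difference quotient is squeezed between those of two C² perturbations of u_K,
and δ tends to 0. -/

namespace OrliczQuermass

noncomputable section

/-! ### Frames of the tangent space -/

/-- `b` is an orthonormal basis of the tangent space of the sphere at the unit vector `x`. -/
structure IsTangentFrame {n : ℕ} (x : E n) (b : Fin n → E n) : Prop where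
  norm_eq : ‖x‖ = 1
  orthonormal : Orthonormal ℝ b
  inner_eq : ∀ i, ⟪x, b i⟫ = 0

theorem isTangentFrame_frame {n : ℕ} {x : E n} (hx : ‖x‖ = 1) : IsTangentFrame x (frame x) := by
  have : Fact (Module.finrank ℝ (E n) = n + 1) := ⟨by simp⟩
  have h0 : x ≠ 0 := by
    rintro rfl
    simp at hx
  have hf : frame x = fun i =>
      ((OrthonormalBasis.fromOrthogonalSpanSingleton (𝕜 := ℝ) n h0 i : (ℝ ∙ x)ᗮ) : E n) := by
    rw [frame, dif_pos h0]
  refine ⟨hx, ?_, fun i => ?_⟩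
  · rw [hf]
    exact (OrthonormalBasis.orthonormal
      (OrthonormalBasis.fromOrthogonalSpanSingleton (𝕜 := ℝ) n h0)).comp_linearIsometry
      (Submodule.subtypeₗᵢ _)
  · rw [hf]
    exact Submodule.mem_orthogonal_singleton_iff_inner_right.1 (Subtype.property _)

namespace IsTangentFrame

variable {n : ℕ} {x : E n} {b c : Fin n → E n}

theorem orthonormal_cons (h : IsTangentFrame x b) :
    Orthonormal ℝ (Fin.cons x b : Fin (n + 1) → E n) := by
  rw [orthonormal_iff_ite]
  intro i j
  have hb := orthonormal_iff_ite.1 h.orthonormal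
  refine Fin.cases ?_ (fun i => ?_) i <;> refine Fin.cases ?_ (fun j => ?_) j
  · simp [h.norm_eq]
  · simp [h.inner_eq, (Fin.succ_ne_zero j).symm]
  · simp only [Fin.cons_zero, Fin.cons_succ]
    rw [real_inner_comm, h.inner_eq, if_neg (Fin.succ_ne_zero i)]
  · simp only [Fin.cons_succ, Fin.succ_inj]
    exact hb i j

/-- The orthonormal basis of the ambient space consisting of `x` and a tangent frame at `x`. -/
def basis (h : IsTangentFrame x b) : OrthonormalBasis (Fin (n + 1)) ℝ (E n) :=
  OrthonormalBasis.mk h.orthonormal_cons (by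
    rw [h.orthonormal_cons.linearIndependent.span_eq_top_of_card_eq_finrank' (by simp)])

@[simp] theorem basis_zero (h : IsTangentFrame x b) : h.basis 0 = x := by
  simp [basis]

@[simp] theorem basis_succ (h : IsTangentFrame x b) (i : Fin n) : h.basis i.succ = b i := by
  simp [basis]

theorem inner_eq_ite (h : IsTangentFrame x b) (i j : Fin n) :
    ⟪b i, b j⟫ = if i = j then (1 : ℝ) else 0 := orthonormal_iff_ite.1 h.orthonormal i j

theorem sum_inner_smul (h : IsTangentFrame x b) {v : E n} (hv : ⟪x, v⟫ = 0) :
    ∑ i, ⟪b i, v⟫ • b i = v := by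
  have := h.basis.sum_repr' v
  rw [Fin.sum_univ_succ] at this
  simpa [hv] using this

theorem sum_inner_mul_inner (h : IsTangentFrame x b) {v w : E n} (hv : ⟪x, v⟫ = 0) :
    ∑ i, ⟪b i, v⟫ * ⟪b i, w⟫ = ⟪v, w⟫ := by
  conv_rhs => rw [← h.sum_inner_smul hv]
  simp [sum_inner, inner_smul_left]

end IsTangentFrame

/-- The matrix of a bilinear form with respect to a family of vectors. -/
def formMatrix {n : ℕ} {ι : Type*} (b : ι → E n) (B : E n →L[ℝ] E n →L[ℝ] ℝ) : Matrix ι ι ℝ :=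
  Matrix.of fun i j => B (b i) (b j)

theorem formMatrix_apply {n : ℕ} {ι : Type*} (b : ι → E n) (B : E n →L[ℝ] E n →L[ℝ] ℝ) (i j : ι) :
    formMatrix b B i j = B (b i) (b j) := rfl

/-- The change of basis formula for bilinear forms. -/
theorem formMatrix_change {n : ℕ} {ι : Type*} [Fintype ι] {b c : ι → E n}
    (B : E n →L[ℝ] E n →L[ℝ] ℝ) (P : Matrix ι ι ℝ) (h : ∀ j, b j = ∑ i, P i j • c i) :
    formMatrix b B = P.transpose * formMatrix c B * P := by
  ext i j
  simp only [formMatrix_apply, Matrix.mul_apply, Matrix.transpose_apply]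
  rw [h i, h j]
  simp only [map_sum, map_smul, sum_apply, smul_apply,
    smul_eq_mul, Finset.mul_sum, Finset.sum_mul]
  refine Finset.sum_congr rfl fun k _ => Finset.sum_congr rfl fun l _ => ?_
  ring

/-- The change of frame is an orthogonal matrix. This frees later computations from the arbitrary
choice made in `frame`: eigenvalues may be read off in any tangent frame that diagonalizes the form.
-/
theorem charpoly_formMatrix_eq {n : ℕ} {x : E n} {b c : Fin n → E n} (hb : IsTangentFrame x b)
    (hc : IsTangentFrame x c) (B : E n →L[ℝ] E n →L[ℝ] ℝ) :
    (formMatrix b B).charpoly = (formMatrix c B).charpoly := by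
  let P : Matrix (Fin n) (Fin n) ℝ := Matrix.of fun i j => ⟪c i, b j⟫
  have h : ∀ j, b j = ∑ i, P i j • c i := fun j => (hc.sum_inner_smul (hb.inner_eq j)).symm
  have hP : P.transpose * P = 1 := by
    ext i j
    rw [Matrix.mul_apply]
    simp only [Matrix.transpose_apply, P, Matrix.of_apply]
    rw [hc.sum_inner_mul_inner (hb.inner_eq i), hb.inner_eq_ite, Matrix.one_apply]
  rw [formMatrix_change B P h, mul_assoc, Matrix.charpoly_mul_comm, mul_assoc,
    mul_eq_one_comm.1 hP, mul_one]

/-! ### Eigenvalues of forms on the tangent space -/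

theorem isHermitian_formMatrix {n : ℕ} {ι : Type*} {b : ι → E n} {B : E n →L[ℝ] E n →L[ℝ] ℝ}
    (hB : ∀ v w, B v w = B w v) : (formMatrix b B).IsHermitian := by
  ext i j
  simp [formMatrix_apply, hB (b i)]

theorem tangentEigenvalues_eq {n : ℕ} (x : E n) {B : E n →L[ℝ] E n →L[ℝ] ℝ}
    (hB : ∀ v w, B v w = B w v) :
    tangentEigenvalues x (fun v w => B v w) =
      (isHermitian_formMatrix (b := frame x) hB).eigenvalues := by
  rw [tangentEigenvalues]
  exact dif_pos (isHermitian_formMatrix (b := frame x) hB)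

/-- The ordered eigenvalues are determined by the characteristic polynomial, so a common matrix
suffices even if it arises in two different frames. The intended use is with frames that differ by a
reflection. -/
theorem tangentEigenvalues_congr {n : ℕ} {x : E n} {b c : Fin n → E n} (hb : IsTangentFrame x b)
    (hc : IsTangentFrame x c)
    {B B' : E n →L[ℝ] E n →L[ℝ] ℝ} (hB : ∀ v w, B v w = B w v) (hB' : ∀ v w, B' v w = B' w v)
    (h : formMatrix b B = formMatrix c B') :
    tangentEigenvalues x (fun v w => B v w) = tangentEigenvalues x (fun v w => B' v w) := by
  rw [tangentEigenvalues_eq x hB, tangentEigenvalues_eq x hB',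
    Matrix.IsHermitian.eigenvalues_eq_eigenvalues_iff,
    charpoly_formMatrix_eq (isTangentFrame_frame hb.norm_eq) hb,
    charpoly_formMatrix_eq (isTangentFrame_frame hb.norm_eq) hc, h]

theorem exists_perm_of_map_univ_eq {n : ℕ} {f g : Fin n → ℝ}
    (h : Multiset.map f Finset.univ.val = Multiset.map g Finset.univ.val) :
    ∃ σ : Equiv.Perm (Fin n), f = g ∘ σ := by
  rw [Fin.univ_val_map, Fin.univ_val_map, Multiset.coe_eq_coe] at h
  have h1 : List.ofFn (f ∘ Tuple.sort f) = List.ofFn (g ∘ Tuple.sort g) :=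
    List.Perm.eq_of_pairwise' (Tuple.monotone_sort f).sortedLE_ofFn.pairwise
      (Tuple.monotone_sort g).sortedLE_ofFn.pairwise
      ((((Tuple.sort f).ofFn_comp_perm f).trans h).trans ((Tuple.sort g).ofFn_comp_perm g).symm)
  refine ⟨(Tuple.sort f).symm.trans (Tuple.sort g), funext fun i => ?_⟩
  have h2 := congrFun (List.ofFn_injective h1) ((Tuple.sort f).symm i)
  simpa using h2

theorem exists_perm_tangentEigenvalues {n : ℕ} {x : E n} {b : Fin n → E n}
    (hb : IsTangentFrame x b) {B : E n →L[ℝ] E n →L[ℝ] ℝ} (hB : ∀ v w, B v w = B w v)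
    {d : Fin n → ℝ} (h : formMatrix b B = Matrix.diagonal d) :
    ∃ σ : Equiv.Perm (Fin n), tangentEigenvalues x (fun v w => B v w) = d ∘ σ := by
  rw [tangentEigenvalues_eq x hB]
  set hA := isHermitian_formMatrix (b := frame x) hB
  have h1 := hA.roots_charpoly_eq_eigenvalues
  rw [charpoly_formMatrix_eq (isTangentFrame_frame hb.norm_eq) hb, h, Matrix.charpoly_diagonal,
    Polynomial.roots_prod _ _ (by
      simp [Finset.prod_ne_zero_iff, Polynomial.X_sub_C_ne_zero])] at h1
  refine exists_perm_of_map_univ_eq ?_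
  simpa using h1.symm

/-- For α ≠ 0 this is the characteristic polynomial evaluated at -β/α. It is the bridge from
products of affine functions of the radii to determinants. -/
theorem prod_tangentEigenvalues {n : ℕ} (x : E n) {B : E n →L[ℝ] E n →L[ℝ] ℝ}
    (hB : ∀ v w, B v w = B w v) (α β : ℝ) :
    ∏ i, (α * tangentEigenvalues x (fun v w => B v w) i + β) =
      (α • formMatrix (frame x) B + β • (1 : Matrix (Fin n) (Fin n) ℝ)).det := by
  rw [tangentEigenvalues_eq x hB]
  set hA := isHermitian_formMatrix (b := frame x) hB
  set A := formMatrix (frame x) B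
  by_cases hα : α = 0
  · simp [hα]
  have h1 := congrArg (Polynomial.eval (-(β / α))) hA.charpoly_eq
  rw [Matrix.eval_charpoly, Polynomial.eval_prod] at h1
  have h2 : α • A + β • (1 : Matrix (Fin n) (Fin n) ℝ) =
      (-α) • (Matrix.scalar (Fin n) (-(β / α)) - A) := by
    ext i j
    simp [Matrix.one_apply, Matrix.diagonal_apply]
    split_ifs <;> field_simp <;> ring
  rw [h2, Matrix.det_smul, h1, ← Finset.card_univ, ← Finset.prod_const, ← Finset.prod_mul_distrib]
  refine Finset.prod_congr rfl fun i _ => ?_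
  simp
  field_simp
  ring

theorem tangentEigenvalues_pos {n : ℕ} {x : E n} (hx : ‖x‖ = 1) {B : E n →L[ℝ] E n →L[ℝ] ℝ}
    (hB : ∀ v w, B v w = B w v) (hpos : ∀ v, ⟪x, v⟫ = 0 → v ≠ 0 → 0 < B v v) :
    tangentEigenvalues x (fun v w => B v w) ∈ posCone n := by
  intro i
  rw [tangentEigenvalues_eq x hB]
  set hA := isHermitian_formMatrix (b := frame x) hB
  refine Matrix.PosDef.eigenvalues_pos (Matrix.PosDef.of_dotProduct_mulVec_pos hA fun w hw => ?_) i
  have hf := isTangentFrame_frame hx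
  have h1 : star w ⬝ᵥ Matrix.mulVec (formMatrix (frame x) B) w =
      B (∑ i, w i • frame x i) (∑ i, w i • frame x i) := by
    simp only [dotProduct, Matrix.mulVec, formMatrix_apply, map_sum, map_smul, sum_apply,
      smul_apply, smul_eq_mul, Finset.mul_sum, star_trivial, Pi.star_apply]
    rw [Finset.sum_comm]
    refine Finset.sum_congr rfl fun k _ => Finset.sum_congr rfl fun l _ => ?_
    ring
  rw [h1]
  refine hpos _ ?_ fun h0 => hw ?_
  · simp [inner_sum, inner_smul_right, hf.inner_eq]
  · exact funext (Fintype.linearIndependent_iff.1 hf.orthonormal.linearIndependent w h0)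

/-! ### The adjugate of a degenerate form -/

/-- The standard basis vectors. -/
abbrev stdVec {n : ℕ} (a : Fin (n + 1)) : E n := EuclideanSpace.single a 1

/-- In the orthonormal basis formed by x and b, the matrix of B has zero column 0. Every minor that
keeps this column vanishes, so column 0 of the adjugate has a single entry, the determinant of B on
x^⊥. In other words, adj(B) x = det(B|x^⊥) x. -/
theorem sum_adjugate_mul_mul {n : ℕ} {x : E n} {b : Fin n → E n} (hb : IsTangentFrame x b)
    {B : E n →L[ℝ] E n →L[ℝ] ℝ} (hBx : ∀ v, B v x = 0) (p : E n) :
    ∑ i, ∑ j, (formMatrix stdVec B).adjugate i j * p i * x j =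
      ⟪x, p⟫ * (formMatrix b B).det := by
  let O : Matrix (Fin (n + 1)) (Fin (n + 1)) ℝ := Matrix.of fun a i => hb.basis i a
  have hO : O.transpose * O = 1 := by
    ext i j
    rw [Matrix.mul_apply, Matrix.one_apply, ← orthonormal_iff_ite.1 hb.basis.orthonormal i j]
    simp [O, PiLp.inner_apply, mul_comm]
  have hO' : O * O.transpose = 1 := mul_eq_one_comm.1 hO
  have hdet : O.det * O.det = 1 := by
    have := congrArg Matrix.det hO
    rwa [Matrix.det_mul, Matrix.det_transpose, Matrix.det_one] at this
  -- The adjugate of an orthogonal matrix is its transpose up to the sign det O; conjugation by O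
  -- uses it twice, so the sign cancels.
  have hadjO : O.adjugate = O.det • O.transpose := by
    calc O.adjugate = O.adjugate * (O * O.transpose) := by rw [hO', mul_one]
      _ = _ := by rw [← mul_assoc, Matrix.adjugate_mul, smul_mul_assoc, one_mul]
  have hexp : ∀ j, hb.basis j = ∑ a, O a j • stdVec a := fun j => by
    ext a
    simp [O, Pi.single_apply]
  have hM : formMatrix hb.basis B = O.transpose * formMatrix stdVec B * O :=
    formMatrix_change B O hexp
  have hM' : formMatrix stdVec B = O * formMatrix hb.basis B * O.transpose := by
    rw [hM, ← mul_assoc, ← mul_assoc, hO', one_mul, mul_assoc, hO', mul_one]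
  have hadj : (formMatrix stdVec B).adjugate =
      O * (formMatrix hb.basis B).adjugate * O.transpose := by
    rw [hM', Matrix.adjugate_mul_distrib, Matrix.adjugate_mul_distrib, ← Matrix.adjugate_transpose,
      hadjO, Matrix.transpose_smul, Matrix.transpose_transpose]
    simp only [smul_mul_assoc, mul_smul_comm, smul_smul, hdet, one_smul, mul_assoc]
  have hentry : ∀ j, (formMatrix hb.basis B).adjugate j 0 =
      if j = 0 then (formMatrix b B).det else 0 := by
    intro j
    rw [Matrix.adjugate_fin_succ_eq_det_submatrix]
    refine Fin.cases ?_ (fun j => ?_) j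
    · simp only [if_true]
      have : (formMatrix hb.basis B).submatrix (Fin.succAbove 0) (Fin.succAbove 0) =
          formMatrix b B := by
        ext k l
        simp [formMatrix_apply]
      rw [this]
      simp
    · rw [if_neg (Fin.succ_ne_zero j)]
      have : NeZero n := ⟨fun h => by subst h; exact j.elim0⟩
      rw [Matrix.det_eq_zero_of_column_eq_zero 0, mul_zero]
      intro k
      simp [formMatrix_apply, hBx]
  have hx : ∀ i, ∑ j, O j i * x j = if i = 0 then 1 else 0 := by
    intro i
    have := orthonormal_iff_ite.1 hb.basis.orthonormal i 0
    rw [hb.basis_zero] at this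
    rw [← this]
    simp [O, PiLp.inner_apply, mul_comm]
  have hp : ∑ j, O j 0 * p j = ⟪x, p⟫ := by
    simp [O, PiLp.inner_apply, mul_comm]
  have hx' : O.transpose.mulVec x.ofLp = Pi.single 0 1 := by
    ext i
    simp [Matrix.mulVec, dotProduct, hx, Pi.single_apply]
  have hsum : ∑ i, ∑ j, (formMatrix stdVec B).adjugate i j * p i * x j =
      p.ofLp ⬝ᵥ (formMatrix stdVec B).adjugate.mulVec x.ofLp := by
    simp only [dotProduct, Matrix.mulVec, Finset.mul_sum]
    refine Finset.sum_congr rfl fun i _ => Finset.sum_congr rfl fun j _ => ?_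
    ring
  rw [hsum, hadj, ← Matrix.mulVec_mulVec, hx', ← Matrix.mulVec_mulVec, Matrix.mulVec_single_one,
    Matrix.dotProduct_mulVec, ← hp]
  have hcol : (formMatrix hb.basis B).adjugate.col 0 = Pi.single 0 (formMatrix b B).det := by
    ext j
    simp [Matrix.col, hentry, Pi.single_apply]
  rw [hcol, dotProduct_single]
  simp [Matrix.vecMul, dotProduct, mul_comm]

/-! ### Symmetric functions that are affine in each variable -/

/-- Linear interpolation between the nodes 1 and 2, one variable of T at a time. Both nodes are
positive, so the updated points stay in the cone. -/
theorem multiAffine_expansion {n : ℕ} {f : (Fin n → ℝ) → ℝ}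
    (haff : ∀ l ∈ posCone n, ∀ j, f l =
      (l j - 1) * f (Function.update l j 2) + (2 - l j) * f (Function.update l j 1))
    (T : Finset (Fin n)) : ∀ l ∈ posCone n,
      f l = ∑ S ∈ T.powerset, (∏ i ∈ S, (l i - 1)) * (∏ i ∈ T \ S, (2 - l i)) *
        f (fun i => if i ∈ S then 2 else if i ∈ T then 1 else l i) := by
  classical
  induction T using Finset.induction_on with
  | empty => intro l _; simp
  | insert a T ha ih =>
    intro l hl
    have hupd : ∀ t : ℝ, 0 < t → Function.update l a t ∈ posCone n := by
      intro t ht i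
      by_cases h : i = a
      · subst h; simpa using ht
      · simpa [h] using hl i
    have hne : ∀ i ∈ T, i ≠ a := fun i hi h => ha (h ▸ hi)
    rw [haff l hl a, ih _ (hupd 2 (by norm_num)), ih _ (hupd 1 (by norm_num)),
      Finset.sum_powerset_insert ha, add_comm, Finset.mul_sum, Finset.mul_sum]
    congr 1
    · refine Finset.sum_congr rfl fun S hS => ?_
      have hST := Finset.mem_powerset.1 hS
      have haS : a ∉ S := fun h => ha (hST h)
      have h1 : ∏ i ∈ S, (Function.update l a 1 i - 1) = ∏ i ∈ S, (l i - 1) :=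
        Finset.prod_congr rfl fun i hi => by rw [Function.update_of_ne (hne i (hST hi))]
      have h2 : ∏ i ∈ T \ S, (2 - Function.update l a 1 i) = ∏ i ∈ T \ S, (2 - l i) :=
        Finset.prod_congr rfl fun i hi => by
          rw [Function.update_of_ne (hne i (Finset.mem_sdiff.1 hi).1)]
      have h3 : insert a T \ S = insert a (T \ S) := Finset.insert_sdiff_of_notMem _ haS
      have h4 : (fun i => if i ∈ S then (2 : ℝ) else if i ∈ T then 1 else
          Function.update l a 1 i) =
          fun i => if i ∈ S then 2 else if i ∈ insert a T then 1 else l i := by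
        ext i
        by_cases hi : i = a
        · subst hi; simp [ha, haS]
        · simp [hi]
      rw [h1, h2, h3, h4, Finset.prod_insert (by simp [ha])]
      ring
    · refine Finset.sum_congr rfl fun S hS => ?_
      have hST := Finset.mem_powerset.1 hS
      have haS : a ∉ S := fun h => ha (hST h)
      have h1 : ∏ i ∈ S, (Function.update l a 2 i - 1) = ∏ i ∈ S, (l i - 1) :=
        Finset.prod_congr rfl fun i hi => by rw [Function.update_of_ne (hne i (hST hi))]
      have h2 : ∏ i ∈ T \ S, (2 - Function.update l a 2 i) = ∏ i ∈ T \ S, (2 - l i) :=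
        Finset.prod_congr rfl fun i hi => by
          rw [Function.update_of_ne (hne i (Finset.mem_sdiff.1 hi).1)]
      have h3 : insert a T \ insert a S = T \ S := by
        ext i
        by_cases hi : i = a
        · subst hi; simp [ha]
        · simp [hi]
      have h4 : (fun i => if i ∈ S then (2 : ℝ) else if i ∈ T then 1 else
          Function.update l a 2 i) =
          fun i => if i ∈ insert a S then 2 else if i ∈ insert a T then 1 else l i := by
        ext i
        by_cases hi : i = a
        · subst hi; simp [ha, haS]
        · simp [hi]
      rw [h1, h2, h3, h4, Finset.prod_insert haS]
      ring

/-- A symmetric function on the positive cone that is affine in each variable is a linear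
combination of products of identical affine functions of the variables. -/
theorem exists_sum_prod_of_multiAffine {n : ℕ} {f : (Fin n → ℝ) → ℝ}
    (hsymm : ∀ (σ : Equiv.Perm (Fin n)), ∀ l ∈ posCone n, f (l ∘ σ) = f l)
    (haff : ∀ l ∈ posCone n, ∀ j, f l =
      (l j - 1) * f (Function.update l j 2) + (2 - l j) * f (Function.update l j 1)) :
    ∃ (w α β : Fin (n + 1) → ℝ), (∀ i, α i ≠ 0) ∧
      ∀ l ∈ posCone n, f l = ∑ i, w i * ∏ j, (α i * l j + β i) := by
  classical
  let ind : Finset (Fin n) → Fin n → ℝ := fun S i => if i ∈ S then 2 else 1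
  have hind : ∀ S, ind S ∈ posCone n := fun S i => by
    simp only [ind]; split_ifs <;> norm_num
  have hcard : ∀ S S' : Finset (Fin n), S.card = S'.card → f (ind S) = f (ind S') := by
    intro S S' h
    let e := Finset.equivOfCardEq h
    rw [← hsymm e.extendSubtype (ind S') (hind S')]
    congr 1
    ext i
    by_cases hi : i ∈ S
    · have := e.extendSubtype_mem i hi
      simp [ind, hi, this]
    · have := e.extendSubtype_not_mem i hi
      simp [ind, hi, this]
  -- By symmetry the value at a vertex of {1, 2}^n depends only on the number of coordinates equal
  -- to 2.
  obtain ⟨a, ha⟩ : ∃ a : Fin (n + 1) → ℝ, ∀ S : Finset (Fin n), ∀ m : Fin (n + 1),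
      S.card = m → f (ind S) = a m := by
    refine ⟨fun m => if h : ∃ S : Finset (Fin n), S.card = m then f (ind h.choose) else 0, ?_⟩
    intro S m hS
    have h : ∃ S : Finset (Fin n), S.card = m := ⟨S, hS⟩
    simp only [dif_pos h]
    exact hcard _ _ (hS.trans h.choose_spec.symm)
  -- The nodes must be distinct, for the Vandermonde matrix to be invertible, and different from 1,
  -- because x i - 1 becomes the coefficient α i.
  let x : Fin (n + 1) → ℝ := fun i => i + 2
  have hV : IsUnit (Matrix.vandermonde x).det := by
    rw [isUnit_iff_ne_zero, Matrix.det_vandermonde_ne_zero_iff]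
    intro i j hij
    exact Fin.ext (by simpa [x] using hij)
  let w := Matrix.vecMul a (Matrix.vandermonde x)⁻¹
  -- The vertex values are written as moments Σ w_i x_i^m, by solving a Vandermonde system.
  have hw : ∀ m : Fin (n + 1), ∑ i, w i * x i ^ (m : ℕ) = a m := by
    intro m
    have : Matrix.vecMul w (Matrix.vandermonde x) = a := by
      rw [Matrix.vecMul_vecMul, Matrix.nonsing_inv_mul _ hV, Matrix.vecMul_one]
    rw [← congrFun this m]
    simp [Matrix.vecMul, dotProduct, Matrix.vandermonde_apply]
  refine ⟨w, fun i => x i - 1, fun i => 2 - x i, fun i => ?_, fun l hl => ?_⟩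
  · have : (0 : ℝ) ≤ i := by positivity
    simp only [x]
    linarith
  · rw [multiAffine_expansion haff Finset.univ l hl]
    -- Expanding ∏ (x (l_j - 1) + (2 - l_j)) gives the generating function in x of the interpolation
    -- weights, graded by the number of coordinates equal to 2.
    have hprod : ∀ i, ∏ j, ((x i - 1) * l j + (2 - x i)) =
        ∑ S ∈ Finset.univ.powerset, x i ^ S.card * ((∏ j ∈ S, (l j - 1)) *
          ∏ j ∈ Finset.univ \ S, (2 - l j)) := by
      intro i
      have : ∀ j, (x i - 1) * l j + (2 - x i) = x i * (l j - 1) + (2 - l j) := fun j => by ring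
      simp only [this]
      rw [Finset.prod_add]
      refine Finset.sum_congr rfl fun S _ => ?_
      rw [Finset.prod_mul_distrib, Finset.prod_const]
      ring
    simp only [hprod, Finset.mul_sum]
    rw [Finset.sum_comm]
    refine Finset.sum_congr rfl fun S _ => ?_
    have hS : S.card < n + 1 := Nat.lt_succ_of_le (by simpa using Finset.card_le_univ S)
    have h1 : (fun i => if i ∈ S then (2 : ℝ) else if i ∈ Finset.univ then 1 else l i) = ind S := by
      ext i; simp [ind]
    rw [h1, ha S ⟨S.card, hS⟩ rfl, ← hw, Finset.mul_sum]
    refine Finset.sum_congr rfl fun i _ => ?_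
    ring

/-! ### Second derivatives of products and of powers of the norm -/

theorem fderiv_fderiv_mul {V : Type*} [NormedAddCommGroup V] [NormedSpace ℝ V] {f g : V → ℝ}
    {x : V} (hf : ContDiffAt ℝ 2 f x) (hg : ContDiffAt ℝ 2 g x) (v w : V) :
    fderiv ℝ (fderiv ℝ fun y => f y * g y) x v w =
      f x * fderiv ℝ (fderiv ℝ g) x v w + fderiv ℝ f x v * fderiv ℝ g x w +
        fderiv ℝ g x v * fderiv ℝ f x w + g x * fderiv ℝ (fderiv ℝ f) x v w := by
  have hev : fderiv ℝ (fun y => f y * g y) =ᶠ[𝓝 x]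
      fun y => f y • fderiv ℝ g y + g y • fderiv ℝ f y := by
    filter_upwards [hf.eventually (by simp), hg.eventually (by simp)] with y hy hy'
    exact fderiv_fun_mul (hy.differentiableAt (by simp)) (hy'.differentiableAt (by simp))
  have hf1 := hf.differentiableAt (by simp)
  have hg1 := hg.differentiableAt (by simp)
  have hf2 : DifferentiableAt ℝ (fderiv ℝ f) x :=
    (hf.fderiv_right (m := 1) (by norm_num)).differentiableAt (by simp)
  have hg2 : DifferentiableAt ℝ (fderiv ℝ g) x :=
    (hg.fderiv_right (m := 1) (by norm_num)).differentiableAt (by simp)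
  rw [hev.fderiv_eq, fderiv_fun_add (hf1.fun_smul hg2) (hg1.fun_smul hf2), fderiv_fun_smul hf1 hg2,
    fderiv_fun_smul hg1 hf2]
  simp
  ring

/-- The inner product as a continuous bilinear form. -/
def innerBilin (n : ℕ) : E n →L[ℝ] E n →L[ℝ] ℝ :=
  LinearMap.mkContinuous₂ (innerₗ (E n)) 1 fun v w => by
    simpa using norm_inner_le_norm (𝕜 := ℝ) v w

@[simp] theorem innerBilin_apply {n : ℕ} (v w : E n) : innerBilin n v w = ⟪v, w⟫ := rfl

theorem contDiffAt_normSq_rpow {n : ℕ} {x : E n} (hx : x ≠ 0) (s : ℝ) (r : WithTop ℕ∞) :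
    ContDiffAt ℝ r (fun y : E n => (‖y‖ ^ 2) ^ s) x :=
  ((contDiff_norm_sq ℝ).contDiffAt).rpow_const_of_ne (by positivity)

theorem fderiv_normSq_rpow {n : ℕ} {x : E n} (hx : x ≠ 0) (s : ℝ) (v : E n) :
    fderiv ℝ (fun y : E n => (‖y‖ ^ 2) ^ s) x v = 2 * s * (‖x‖ ^ 2) ^ (s - 1) * ⟪x, v⟫ := by
  have h := ((hasStrictFDerivAt_norm_sq x).hasFDerivAt.rpow_const (p := s)
    (Or.inl (by positivity : ‖x‖ ^ 2 ≠ 0))).fderiv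
  rw [h]
  simp
  ring

theorem fderiv_fderiv_normSq_rpow {n : ℕ} {x : E n} (hx : ‖x‖ = 1) (s : ℝ) (v w : E n) :
    fderiv ℝ (fderiv ℝ fun y : E n => (‖y‖ ^ 2) ^ s) x v w =
      2 * s * ⟪v, w⟫ + 4 * s * (s - 1) * ⟪x, v⟫ * ⟪x, w⟫ := by
  have hx0 : x ≠ 0 := by
    rintro rfl
    simp at hx
  have hev : fderiv ℝ (fun y : E n => (‖y‖ ^ 2) ^ s) =ᶠ[𝓝 x]
      fun y => (2 * s * (‖y‖ ^ 2) ^ (s - 1)) • innerBilin n y := by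
    filter_upwards [isOpen_ne.mem_nhds hx0] with y hy
    ext v
    rw [fderiv_normSq_rpow hy]
    simp
  have h1 : DifferentiableAt ℝ (fun y : E n => 2 * s * (‖y‖ ^ 2) ^ (s - 1)) x :=
    ((contDiffAt_normSq_rpow hx0 (s - 1) 1).differentiableAt (by simp)).const_mul _
  rw [hev.fderiv_eq, fderiv_fun_smul h1 (innerBilin n).differentiableAt, fderiv_const_mul
    ((contDiffAt_normSq_rpow hx0 (s - 1) 1).differentiableAt (by simp))]
  simp only [add_apply, ContinuousLinearMap.smulRight_apply, smul_apply,
    ContinuousLinearMap.fderiv, innerBilin_apply, fderiv_normSq_rpow hx0, hx, smul_eq_mul, one_pow,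
    Real.one_rpow]
  ring

/-- The covariant Hessian of the restriction to the sphere of a function that is, near `x`,
proportional to `radialExt u` with a power of the norm as factor. -/
theorem sphereHess_eq {n : ℕ} {u U : E n → ℝ} {x : E n} (hx : ‖x‖ = 1) (s : ℝ)
    (hU : ContDiffAt ℝ 2 U x) (h : radialExt u =ᶠ[𝓝 x] fun y => U y * (‖y‖ ^ 2) ^ s)
    {v w : E n} (hv : ⟪x, v⟫ = 0) (hw : ⟪x, w⟫ = 0) :
    sphereHess u x v w = fderiv ℝ (fderiv ℝ U) x v w + 2 * s * U x * ⟪v, w⟫ := by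
  have hx0 : x ≠ 0 := by
    rintro rfl
    simp at hx
  rw [sphereHess, h.fderiv.fderiv_eq, fderiv_fderiv_mul hU (contDiffAt_normSq_rpow hx0 s 2),
    fderiv_normSq_rpow hx0, fderiv_normSq_rpow hx0, fderiv_fderiv_normSq_rpow hx, hv, hw]
  simp [hx]
  ring

/-! ### The calculus of functions on the sphere -/

section

variable {n : ℕ} {r : WithTop ℕ∞} {u v : E n → ℝ}

theorem radialExt_of_norm_eq_one {x : E n} (hx : ‖x‖ = 1) : radialExt u x = u x := by
  simp [radialExt, hx]

theorem SphereContDiff.add (hu : SphereContDiff r u) (hv : SphereContDiff r v) :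
    SphereContDiff r (u + v) := ContDiffOn.add hu hv

theorem SphereContDiff.const_smul (c : ℝ) (hu : SphereContDiff r u) :
    SphereContDiff r (c • u) := ContDiffOn.const_smul c hu

theorem sphereContDiff_const (c : ℝ) : SphereContDiff r (fun _ : E n => c) := contDiffOn_const

theorem contDiffOn_normalize : ContDiffOn ℝ r (fun y : E n => ‖y‖⁻¹ • y) {0}ᶜ := by
  intro y hy
  exact (((contDiffAt_norm ℝ hy).inv (norm_ne_zero_iff.2 hy)).smul contDiffAt_id).contDiffWithinAt

theorem sphereContDiff_of_contDiff (hu : ContDiff ℝ r u) : SphereContDiff r u :=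
  hu.comp_contDiffOn contDiffOn_normalize

theorem sphereContDiff_of_contDiffOn (hu : ContDiffOn ℝ r u {0}ᶜ) : SphereContDiff r u :=
  hu.comp contDiffOn_normalize fun y hy => by simpa using hy

theorem SphereContDiff.contDiffAt (hu : SphereContDiff r u) {x : E n} (hx : x ≠ 0) :
    ContDiffAt ℝ r (radialExt u) x :=
  ContDiffOn.contDiffAt hu (isOpen_compl_singleton.mem_nhds hx)

theorem ne_zero_of_norm_eq_one {x : E n} (hx : ‖x‖ = 1) : x ≠ 0 := by
  rintro rfl
  simp at hx

/-- The form `D²u + u I` as a continuous bilinear form. -/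
def radiiBilin (u : E n → ℝ) (x : E n) : E n →L[ℝ] E n →L[ℝ] ℝ :=
  fderiv ℝ (fderiv ℝ (radialExt u)) x + u x • innerBilin n

theorem radiiBilin_apply (x v w : E n) : radiiBilin u x v w = radiiForm u x v w := by
  simp [radiiBilin, radiiForm, sphereHess]

theorem radiiForm_eq_radiiBilin (x : E n) : radiiForm u x = fun v w => radiiBilin u x v w := by
  ext v w
  rw [radiiBilin_apply]

theorem fderiv_fderiv_symm {f : E n → ℝ} {x : E n} (hf : ContDiffAt ℝ 2 f x) (v w : E n) :
    fderiv ℝ (fderiv ℝ f) x v w = fderiv ℝ (fderiv ℝ f) x w v :=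
  (hf.isSymmSndFDerivAt (by simp)).eq v w

theorem radiiBilin_symm (hu : SphereContDiff 2 u) {x : E n} (hx : ‖x‖ = 1) (v w : E n) :
    radiiBilin u x v w = radiiBilin u x w v := by
  rw [radiiBilin_apply, radiiBilin_apply, radiiForm, radiiForm, sphereHess, sphereHess,
    fderiv_fderiv_symm (hu.contDiffAt (ne_zero_of_norm_eq_one hx)), real_inner_comm]

theorem radiiBilin_add (hu : SphereContDiff 2 u) (hv : SphereContDiff 2 v) {x : E n}
    (hx : ‖x‖ = 1) : radiiBilin (u + v) x = radiiBilin u x + radiiBilin v x := by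
  have hx0 := ne_zero_of_norm_eq_one hx
  have hev : fderiv ℝ (radialExt (u + v)) =ᶠ[𝓝 x]
      fun y => fderiv ℝ (radialExt u) y + fderiv ℝ (radialExt v) y := by
    filter_upwards [isOpen_ne.mem_nhds hx0] with y hy
    exact fderiv_fun_add ((hu.contDiffAt hy).differentiableAt (by simp))
      ((hv.contDiffAt hy).differentiableAt (by simp))
  have hd : ∀ {w : E n → ℝ}, SphereContDiff 2 w → DifferentiableAt ℝ (fderiv ℝ (radialExt w)) x :=
    fun hw => ((hw.contDiffAt hx0).fderiv_right (m := 1) (by norm_num)).differentiableAt (by simp)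
  rw [radiiBilin, hev.fderiv_eq, fderiv_fun_add (hd hu) (hd hv), radiiBilin, radiiBilin]
  ext v' w'
  simp only [add_apply, smul_apply, innerBilin_apply, Pi.add_apply, smul_eq_mul]
  ring

theorem radiiBilin_smul (c : ℝ) (hu : SphereContDiff 2 u) {x : E n}
    (hx : ‖x‖ = 1) : radiiBilin (c • u) x = c • radiiBilin u x := by
  have hx0 := ne_zero_of_norm_eq_one hx
  have hev : fderiv ℝ (radialExt (c • u)) =ᶠ[𝓝 x]
      fun y => c • fderiv ℝ (radialExt u) y := by
    filter_upwards [isOpen_ne.mem_nhds hx0] with y hy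
    exact fderiv_fun_const_smul ((hu.contDiffAt hy).differentiableAt (by simp)) c
  have hd : DifferentiableAt ℝ (fderiv ℝ (radialExt u)) x :=
    ((hu.contDiffAt hx0).fderiv_right (m := 1) (by norm_num)).differentiableAt (by simp)
  rw [radiiBilin, hev.fderiv_eq, fderiv_fun_const_smul hd, radiiBilin]
  ext v' w'
  simp only [add_apply, smul_apply, innerBilin_apply, Pi.smul_apply, smul_eq_mul]
  ring

theorem radiiBilin_const (c : ℝ) (x : E n) :
    radiiBilin (fun _ : E n => c) x = c • innerBilin n := by
  have : fderiv ℝ (radialExt fun _ : E n => c) = fun _ => 0 := by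
    ext1 y
    exact fderiv_const_apply c
  rw [radiiBilin, this]
  simp

/-- The extension of `u|_{𝕊ⁿ}` that is positively homogeneous of degree one. -/
def homExt (u : E n → ℝ) (y : E n) : ℝ := ‖y‖ * radialExt u y

theorem homExt_of_norm_eq_one {x : E n} (hx : ‖x‖ = 1) : homExt u x = u x := by
  simp [homExt, radialExt, hx]

theorem homExt_smul {t : ℝ} (ht : 0 < t) (y : E n) : homExt u (t • y) = t * homExt u y := by
  simp only [homExt, radialExt, norm_smul, Real.norm_eq_abs, abs_of_pos ht, smul_smul]
  have : (t * ‖y‖)⁻¹ * t = ‖y‖⁻¹ := by field_simp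
  rw [this, mul_assoc]

theorem contDiffAt_homExt (hu : SphereContDiff r u) {x : E n} (hx : x ≠ 0) :
    ContDiffAt ℝ r (homExt u) x := (contDiffAt_norm ℝ hx).mul (hu.contDiffAt hx)

/-- On the tangent space, `D²u + u I` is the Hessian of the homogeneous extension. -/
theorem radiiBilin_eq_homExt (hu : SphereContDiff 2 u) {x : E n} (hx : ‖x‖ = 1) {v w : E n}
    (hv : ⟪x, v⟫ = 0) (hw : ⟪x, w⟫ = 0) :
    radiiBilin u x v w = fderiv ℝ (fderiv ℝ (homExt u)) x v w := by
  have hx0 := ne_zero_of_norm_eq_one hx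
  -- Here `radialExt u` is `homExt u` times (‖y‖²)^(-1/2), and the correction 2s u ⟪v, w⟫ with s =
  -- -1/2 cancels the term uI.
  rw [radiiBilin_apply, radiiForm, sphereHess_eq hx (-1 / 2) (contDiffAt_homExt hu hx0) ?_ hv hw,
    homExt_of_norm_eq_one hx]
  · ring
  · filter_upwards [isOpen_ne.mem_nhds hx0] with y hy
    have h0 : 0 < ‖y‖ := norm_pos_iff.2 hy
    rw [homExt, ← Real.rpow_natCast_mul h0.le, show ((2 : ℕ) : ℝ) * (-1 / 2) = -1 by norm_num,
      Real.rpow_neg_one]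
    field_simp

end

/-! ### Functions on the sphere given by homogeneous polynomials -/

section

variable {n : ℕ}

/-- The bilinear form `v, w ↦ ⟪a, v⟫ ⟪b, w⟫`. -/
def tensorBilin (a b : E n) : E n →L[ℝ] E n →L[ℝ] ℝ := (innerBilin n a).smulRight (innerBilin n b)

@[simp] theorem tensorBilin_apply (a b v w : E n) : tensorBilin a b v w = ⟪a, v⟫ * ⟪b, w⟫ := by
  simp [tensorBilin]

/-- The 0-homogeneous extension of P is P times (‖y‖²)^(-d/2). The power of the norm contributes -d
P ⟪v, w⟫, of which the term uI gives back one P ⟪v, w⟫. -/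
theorem radiiForm_of_homogeneous {P : E n → ℝ} {d : ℕ} (hP : ContDiff ℝ 2 P)
    (hhom : ∀ (t : ℝ) (y : E n), P (t • y) = t ^ d * P y) {x : E n} (hx : ‖x‖ = 1) {v w : E n}
    (hv : ⟪x, v⟫ = 0) (hw : ⟪x, w⟫ = 0) :
    radiiForm P x v w = fderiv ℝ (fderiv ℝ P) x v w - (d - 1) * P x * ⟪v, w⟫ := by
  rw [radiiForm, sphereHess_eq hx (-d / 2) hP.contDiffAt ?_ hv hw]
  · ring
  · filter_upwards [isOpen_ne.mem_nhds (ne_zero_of_norm_eq_one hx)] with y hy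
    have h0 : 0 < ‖y‖ := norm_pos_iff.2 hy
    rw [radialExt, hhom, ← Real.rpow_natCast_mul h0.le,
      show ((2 : ℕ) : ℝ) * (-d / 2) = -(d : ℝ) by push_cast; ring, Real.rpow_neg h0.le,
      Real.rpow_natCast, inv_pow, mul_comm]

theorem fderiv_fderiv_quadratic {Q : E n →L[ℝ] E n →L[ℝ] ℝ} (hQ : ∀ v w, Q v w = Q w v)
    (x v w : E n) : fderiv ℝ (fderiv ℝ fun y => 1 / 2 * Q y y) x v w = Q v w := by
  have h1 : fderiv ℝ (fun y => 1 / 2 * Q y y) = fun y => Q y := by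
    ext y v
    have h := ((Q.hasFDerivAt (x := y)).clm_apply (hasFDerivAt_id y)).const_mul (1 / 2 : ℝ)
    have h2 := h.fderiv
    simp only [id] at h2
    rw [h2]
    simp [hQ v y]
    ring
  rw [h1]
  simp

theorem fderiv_fderiv_cubic (a x v w : E n) :
    fderiv ℝ (fderiv ℝ fun y => ⟪a, y⟫ ^ 3) x v w = 6 * ⟪a, x⟫ * ⟪a, v⟫ * ⟪a, w⟫ := by
  have h0 : ∀ y, HasFDerivAt (fun y : E n => ⟪a, y⟫) (innerBilin n a) y :=
    fun y => (innerBilin n a).hasFDerivAt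
  have h1 : fderiv ℝ (fun y : E n => ⟪a, y⟫ ^ 3) = fun y => (3 * ⟪a, y⟫ ^ 2) • innerBilin n a := by
    ext y v
    rw [((h0 y).pow 3).fderiv]
    simp
  have h2 : HasFDerivAt (fun y : E n => (3 * ⟪a, y⟫ ^ 2) • innerBilin n a)
      (((3 : ℝ) • ((2 * ⟪a, x⟫) • innerBilin n a)).smulRight (innerBilin n a)) x := by
    have := (((h0 x).pow 2).const_mul 3).smul_const (innerBilin n a)
    simpa using this
  rw [h1, h2.fderiv]
  simp only [ContinuousLinearMap.smulRight_apply, smul_apply, innerBilin_apply, smul_eq_mul]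
  ring

/-- The sum of a quadratic and a cubic form used to test the divergence condition. -/
def testFun (Q : E n →L[ℝ] E n →L[ℝ] ℝ) (ε : ℝ) (a : E n) : E n → ℝ :=
  (fun y => 1 / 2 * Q y y) + ε • fun y => ⟪a, y⟫ ^ 3

theorem contDiff_quadratic (Q : E n →L[ℝ] E n →L[ℝ] ℝ) {r : WithTop ℕ∞} :
    ContDiff ℝ r fun y => 1 / 2 * Q y y :=
  contDiff_const.mul (Q.contDiff.clm_apply contDiff_id)

theorem contDiff_cubic (a : E n) {r : WithTop ℕ∞} : ContDiff ℝ r fun y : E n => ⟪a, y⟫ ^ 3 :=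
  (contDiff_const.inner ℝ contDiff_id).pow 3

theorem sphereContDiff_testFun (Q : E n →L[ℝ] E n →L[ℝ] ℝ) (ε : ℝ) (a : E n) {r : WithTop ℕ∞} :
    SphereContDiff r (testFun Q ε a) :=
  (sphereContDiff_of_contDiff (contDiff_quadratic Q)).add
    ((sphereContDiff_of_contDiff (contDiff_cubic a)).const_smul ε)

theorem radiiBilin_testFun {Q : E n →L[ℝ] E n →L[ℝ] ℝ} (hQ : ∀ v w, Q v w = Q w v) (ε : ℝ)
    (a : E n) {x : E n} (hx : ‖x‖ = 1) {v w : E n} (hv : ⟪x, v⟫ = 0) (hw : ⟪x, w⟫ = 0) :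
    radiiBilin (testFun Q ε a) x v w = Q v w - 1 / 2 * Q x x * ⟪v, w⟫ +
      ε * (6 * ⟪a, x⟫ * ⟪a, v⟫ * ⟪a, w⟫ - 2 * ⟪a, x⟫ ^ 3 * ⟪v, w⟫) := by
  rw [testFun, radiiBilin_add (sphereContDiff_of_contDiff (contDiff_quadratic Q))
    ((sphereContDiff_of_contDiff (contDiff_cubic a)).const_smul ε) hx,
    radiiBilin_smul ε (sphereContDiff_of_contDiff (contDiff_cubic a)) hx]
  simp only [add_apply, smul_apply, smul_eq_mul, radiiBilin_apply]
  rw [radiiForm_of_homogeneous (d := 2) (contDiff_quadratic Q) (fun t y => by simp; ring) hx hv hw,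
    radiiForm_of_homogeneous (d := 3) (contDiff_cubic a)
      (fun t y => by rw [inner_smul_right]; ring) hx hv hw, fderiv_fderiv_quadratic hQ,
    fderiv_fderiv_cubic]
  push_cast
  ring

/-! ### Great circles and their frames -/

/-- The tangent frame along the great circle through `x` in the direction `b i`. -/
def circleFrame (x : E n) (b : Fin n → E n) (i : Fin n) (s : ℝ) : Fin n → E n :=
  Function.update b i (-Real.sin s • x + Real.cos s • b i)

theorem isTangentFrame_circleFrame {x : E n} {b : Fin n → E n} (hb : IsTangentFrame x b)
    (i : Fin n) (s : ℝ) :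
    IsTangentFrame (Real.cos s • x + Real.sin s • b i) (circleFrame x b i s) := by
  have hxx : ⟪x, x⟫ = 1 := by rw [real_inner_self_eq_norm_sq, hb.norm_eq, one_pow]
  have hbx : ∀ p, ⟪b p, x⟫ = 0 := fun p => by rw [real_inner_comm, hb.inner_eq]
  have hcs := Real.sin_sq_add_cos_sq s
  refine ⟨?_, ?_, fun p => ?_⟩
  · have : ‖Real.cos s • x + Real.sin s • b i‖ ^ 2 = 1 := by
      rw [← real_inner_self_eq_norm_sq]
      simp only [inner_add_left, inner_add_right, inner_smul_left, inner_smul_right, hxx, hbx,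
        hb.inner_eq, hb.inner_eq_ite]
      simp
      linarith
    exact (pow_eq_one_iff_of_nonneg (norm_nonneg _) two_ne_zero).1 this
  · rw [orthonormal_iff_ite]
    intro p q
    by_cases hp : p = i <;> by_cases hq : q = i
    · subst hp; subst hq
      simp only [circleFrame, Function.update_self, inner_add_left, inner_add_right,
        inner_smul_left, inner_smul_right, hxx, hbx, hb.inner_eq, hb.inner_eq_ite]
      simp
      linarith
    · subst hp
      simp [circleFrame, hq, Ne.symm hq, inner_add_left, inner_smul_left, hb.inner_eq,
        hb.inner_eq_ite]
    · subst hq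
      simp [circleFrame, hp, inner_add_right, inner_smul_right, hbx, hb.inner_eq_ite]
    · simp [circleFrame, hp, hq, hb.inner_eq_ite]
  · by_cases hp : p = i
    · subst hp
      simp [circleFrame, inner_add_left, inner_add_right, inner_smul_left, inner_smul_right,
        hbx, hb.inner_eq, hb.norm_eq, hb.orthonormal.1]
      ring
    · simp [circleFrame, hp, inner_add_left, inner_smul_left, hb.inner_eq, hb.inner_eq_ite]
      exact fun h => absurd h.symm hp

theorem inner_circleFrame {x : E n} {b : Fin n → E n} (hb : IsTangentFrame x b)
    (i : Fin n) (s : ℝ) (q p : Fin n) : ⟪b q, circleFrame x b i s p⟫ =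
      if q = p then (if p = i then Real.cos s else 1) else 0 := by
  have hbx : ∀ p, ⟪b p, x⟫ = 0 := fun p => by rw [real_inner_comm, hb.inner_eq]
  by_cases hp : p = i
  · subst hp
    simp [circleFrame, inner_add_right, inner_smul_right, hbx, hb.inner_eq_ite]
  · simp [circleFrame, hp, hb.inner_eq_ite]

theorem inner_self_circleFrame {x : E n} {b : Fin n → E n} (hb : IsTangentFrame x b)
    (i : Fin n) (s : ℝ) (p : Fin n) : ⟪x, circleFrame x b i s p⟫ =
      if p = i then -Real.sin s else 0 := by
  have hxx : ⟪x, x⟫ = 1 := by rw [real_inner_self_eq_norm_sq, hb.norm_eq, one_pow]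
  by_cases hp : p = i
  · subst hp
    simp [circleFrame, inner_add_right, inner_smul_right, hb.inner_eq, hb.norm_eq]
  · simp [circleFrame, hp, hb.inner_eq]

/-- The quadratic form whose restriction to the sphere has radii `l` at `x`. -/
def testQuad (x : E n) (b : Fin n → E n) (m : ℝ) (l : Fin n → ℝ) : E n →L[ℝ] E n →L[ℝ] ℝ :=
  (2 * m) • innerBilin n + (2 * m) • tensorBilin x x + ∑ p, l p • tensorBilin (b p) (b p)

theorem testQuad_apply (x : E n) (b : Fin n → E n) (m : ℝ) (l : Fin n → ℝ) (v w : E n) :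
    testQuad x b m l v w = 2 * m * ⟪v, w⟫ + 2 * m * (⟪x, v⟫ * ⟪x, w⟫) +
      ∑ p, l p * (⟪b p, v⟫ * ⟪b p, w⟫) := by
  simp [testQuad, sum_apply]

theorem testQuad_symm (x : E n) (b : Fin n → E n) (m : ℝ) (l : Fin n → ℝ) (v w : E n) :
    testQuad x b m l v w = testQuad x b m l w v := by
  simp only [testQuad_apply, real_inner_comm v w, mul_comm]

theorem IsTangentFrame.sum_sq {x : E n} {b : Fin n → E n} (hb : IsTangentFrame x b) (v : E n) :
    ⟪x, v⟫ ^ 2 + ∑ p, ⟪b p, v⟫ ^ 2 = ‖v‖ ^ 2 := by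
  have := hb.basis.sum_sq_norm_inner_right v
  rw [Fin.sum_univ_succ] at this
  simpa using this

/-- At a unit vector z the part of `testQuad` beyond 2m⟪·,·⟫ is at least μ‖v‖² on v and at most 2m
on z, so the quadratic polynomial contributes at least 2m + μ - (m + m) = μ times ‖v‖². The cubic
term costs at most (6 + 2) μ/16 = μ/2 times ‖v‖², which explains the factor 1/16. -/
theorem radiiPos_testFun {x : E n} {b : Fin n → E n} (hb : IsTangentFrame x b) {m μ : ℝ}
    {l : Fin n → ℝ} (hμ : 0 < μ) (hμl : ∀ p, μ ≤ l p) (hμm : μ ≤ 2 * m) (hlm : ∀ p, l p ≤ 2 * m)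
    (j : Fin n) : RadiiPos (testFun (testQuad x b m l) (μ / 16) (b j)) := by
  intro z hz v hzv hv
  rw [← radiiBilin_apply, radiiBilin_testFun (testQuad_symm x b m l) _ _ hz hzv hzv,
    testQuad_apply, testQuad_apply, real_inner_self_eq_norm_sq, real_inner_self_eq_norm_sq, hz]
  have hv2 : 0 < ‖v‖ ^ 2 := by positivity
  have h1 := hb.sum_sq v
  have h2 := hb.sum_sq z
  rw [hz] at h2
  have h3 : μ * ‖v‖ ^ 2 ≤ 2 * m * (⟪x, v⟫ * ⟪x, v⟫) + ∑ p, l p * (⟪b p, v⟫ * ⟪b p, v⟫) := by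
    rw [← h1, mul_add, Finset.mul_sum]
    refine add_le_add ?_ (Finset.sum_le_sum fun p _ => ?_)
    · nlinarith [sq_nonneg ⟪x, v⟫]
    · nlinarith [sq_nonneg ⟪b p, v⟫, hμl p]
  have h4 : 2 * m * (⟪x, z⟫ * ⟪x, z⟫) + ∑ p, l p * (⟪b p, z⟫ * ⟪b p, z⟫) ≤ 2 * m := by
    calc _ ≤ 2 * m * ⟪x, z⟫ ^ 2 + ∑ p, 2 * m * ⟪b p, z⟫ ^ 2 := by
          refine add_le_add (by nlinarith) (Finset.sum_le_sum fun p _ => ?_)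
          nlinarith [sq_nonneg ⟪b p, z⟫, hlm p]
      _ = 2 * m := by rw [← Finset.mul_sum, ← mul_add, h2]; ring
  have hz1 : |⟪b j, z⟫| ≤ 1 := by
    have := abs_real_inner_le_norm (b j) z
    rwa [hb.orthonormal.1, hz, one_mul] at this
  have hv1 : ⟪b j, v⟫ ^ 2 ≤ ‖v‖ ^ 2 := by
    have := abs_real_inner_le_norm (b j) v
    rw [hb.orthonormal.1, one_mul] at this
    exact sq_le_sq.2 (by rwa [abs_norm])
  obtain ⟨ha, ha'⟩ := abs_le.1 hz1
  have hc3 : |⟪b j, z⟫ ^ 3| ≤ 1 := by rw [abs_pow]; exact pow_le_one₀ (abs_nonneg _) hz1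
  obtain ⟨hc, hc'⟩ := abs_le.1 hc3
  have h5 : -(6 * ‖v‖ ^ 2) ≤ 6 * ⟪b j, z⟫ * ⟪b j, v⟫ * ⟪b j, v⟫ := by
    nlinarith [sq_nonneg ⟪b j, v⟫]
  have h6 : 2 * ⟪b j, z⟫ ^ 3 * ‖v‖ ^ 2 ≤ 2 * ‖v‖ ^ 2 := by nlinarith
  have h7 : -(μ / 2 * ‖v‖ ^ 2) ≤ μ / 16 * (6 * ⟪b j, z⟫ * ⟪b j, v⟫ * ⟪b j, v⟫ -
      2 * ⟪b j, z⟫ ^ 3 * ‖v‖ ^ 2) := by nlinarith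
  nlinarith

end

/-! ### From the divergence condition to a function affine in each variable. -/

section

variable {n : ℕ}

/-! ### Radii of the test functions along great circles -/

theorem isOpen_posCone : IsOpen (posCone n) := by
  have : posCone n = ⋂ i, {l : Fin n → ℝ | 0 < l i} := by
    ext l
    simp [posCone]
  rw [this]
  exact isOpen_iInter_of_finite fun i => isOpen_lt continuous_const (continuous_apply i)

/-- Moving along the circle rotates only the plane of x and b i. Each of x and the b p is therefore
orthogonal to all but at most one vector of the moved frame, and every tensor square in the test
function remains diagonal. -/
theorem formMatrix_testFun_circle {x : E n} {b : Fin n → E n} (hb : IsTangentFrame x b) (m ε : ℝ)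
    (l : Fin n → ℝ) (i j : Fin n) (s : ℝ) :
    formMatrix (circleFrame x b i s)
      (radiiBilin (testFun (testQuad x b m l) ε (b j)) (Real.cos s • x + Real.sin s • b i)) =
      Matrix.diagonal fun p =>
        radiiBilin (testFun (testQuad x b m l) ε (b j)) (Real.cos s • x + Real.sin s • b i)
          (circleFrame x b i s p) (circleFrame x b i s p) := by
  have hc := isTangentFrame_circleFrame hb i s
  ext p q
  by_cases hpq : p = q
  · subst hpq
    simp [formMatrix_apply]
  · rw [Matrix.diagonal_apply_ne _ hpq, formMatrix_apply,
      radiiBilin_testFun (testQuad_symm x b m l) _ _ hc.norm_eq (hc.inner_eq p) (hc.inner_eq q),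
      testQuad_apply, hc.inner_eq_ite, if_neg hpq, inner_self_circleFrame hb,
      inner_self_circleFrame hb, inner_circleFrame hb, inner_circleFrame hb]
    have h1 : ∀ r, ⟪b r, circleFrame x b i s p⟫ * ⟪b r, circleFrame x b i s q⟫ = 0 := by
      intro r
      rw [inner_circleFrame hb, inner_circleFrame hb]
      by_cases hr : r = p
      · rw [if_neg (show ¬r = q from fun h => hpq (hr.symm.trans h)), mul_zero]
      · rw [if_neg hr, zero_mul]
    have h2 : ((if p = i then -Real.sin s else 0) * if q = i then -Real.sin s else 0) = 0 := by
      by_cases hp : p = i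
      · rw [if_neg (show ¬q = i from fun h => hpq (hp.trans h.symm)), mul_zero]
      · rw [if_neg hp, zero_mul]
    have h3 := h1 j
    rw [inner_circleFrame hb, inner_circleFrame hb] at h3
    simp only [h1, h2, mul_assoc, h3]
    simp

theorem radiiBilin_testFun_circle {x : E n} {b : Fin n → E n} (hb : IsTangentFrame x b) (m ε : ℝ)
    (l : Fin n → ℝ) (j : Fin n) (s : ℝ) (p : Fin n) :
    radiiBilin (testFun (testQuad x b m l) ε (b j)) (Real.cos s • x + Real.sin s • b j)
      (circleFrame x b j s p) (circleFrame x b j s p) =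
      if p = j then 2 * m + 2 * m * Real.sin s ^ 2 + l j * Real.cos s ^ 2 -
          (m + m * Real.cos s ^ 2 + 1 / 2 * l j * Real.sin s ^ 2) +
          ε * (6 * Real.sin s * Real.cos s ^ 2 - 2 * Real.sin s ^ 3)
        else 2 * m + l p - (m + m * Real.cos s ^ 2 + 1 / 2 * l j * Real.sin s ^ 2) +
          ε * (-2 * Real.sin s ^ 3) := by
  have hc := isTangentFrame_circleFrame hb j s
  have hbx : ∀ p, ⟪b p, x⟫ = 0 := fun p => by rw [real_inner_comm, hb.inner_eq]
  have hz : ∀ q, ⟪b q, Real.cos s • x + Real.sin s • b j⟫ = if q = j then Real.sin s else 0 := by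
    intro q
    simp [inner_add_right, inner_smul_right, hbx, hb.inner_eq_ite]
  have hxz : ⟪x, Real.cos s • x + Real.sin s • b j⟫ = Real.cos s := by
    simp [inner_add_right, inner_smul_right, hb.inner_eq, hb.norm_eq]
  rw [radiiBilin_testFun (testQuad_symm x b m l) _ _ hc.norm_eq (hc.inner_eq p) (hc.inner_eq p),
    testQuad_apply, testQuad_apply, hc.inner_eq_ite, if_pos rfl, real_inner_self_eq_norm_sq,
    hc.norm_eq]
  simp only [hz, hxz, inner_self_circleFrame hb, inner_circleFrame hb]
  by_cases hp : p = j
  · subst hp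
    simp
    ring
  · simp [hp, Ne.symm hp]
    ring

/-- The symmetrized product as a continuous bilinear form. -/
def symBilin (v w : E n) : E n →L[ℝ] E n →L[ℝ] ℝ :=
  (1 / 2 : ℝ) • (tensorBilin v w + tensorBilin w v)

theorem symBilin_apply (v w a b : E n) : symBilin v w a b = symProd v w a b := by
  simp only [symBilin, symProd, smul_apply, add_apply, tensorBilin_apply, smul_eq_mul]
  ring

theorem curvTensor_eq (F : (Fin n → ℝ) → ℝ) (k : ℕ) (u : E n → ℝ) (x v w : E n) :
    curvTensor F k u x v w = deriv (fun t : ℝ =>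
      F (tangentEigenvalues x fun a b => (radiiBilin u x + t • symBilin v w) a b) ^ k) 0 := by
  simp only [curvTensor, add_apply, smul_apply, smul_eq_mul, symBilin_apply, radiiBilin_apply]

theorem symm_radiiBilin_add {u : E n → ℝ} (hu : SphereContDiff 2 u) {x : E n} (hx : ‖x‖ = 1)
    (t : ℝ) (v w a b : E n) : (radiiBilin u x + t • symBilin v w) a b =
      (radiiBilin u x + t • symBilin v w) b a := by
  simp only [add_apply, smul_apply, radiiBilin_symm hu hx a b, symBilin_apply, symProd]
  simp only [smul_eq_mul]
  ring

/-- The off-diagonal components of `∂F^k/∂a` at a diagonal matrix vanish. -/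
theorem curvTensor_testFun_of_ne (F : (Fin n → ℝ) → ℝ) (k : ℕ) {x : E n} {b : Fin n → E n}
    (hb : IsTangentFrame x b) (m ε : ℝ) (l : Fin n → ℝ) {i j : Fin n} (hij : i ≠ j) (s : ℝ) :
    curvTensor F k (testFun (testQuad x b m l) ε (b j)) (Real.cos s • x + Real.sin s • b i)
      (b i) (b j) = 0 := by
  set u := testFun (testQuad x b m l) ε (b j)
  set z := Real.cos s • x + Real.sin s • b i
  have hu : SphereContDiff 2 u := sphereContDiff_testFun _ _ _
  have hc := isTangentFrame_circleFrame hb i s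
  set c := circleFrame x b i s
  rw [curvTensor_eq]
  set f : ℝ → ℝ := fun t =>
    F (tangentEigenvalues z fun a b' => (radiiBilin u z + t • symBilin (b i) (b j)) a b') ^ k
  -- Reflecting the j-th frame vector preserves the diagonal form and changes the sign of the
  -- off-diagonal perturbation. The eigenvalues are thus even in t.
  let sg : Fin n → ℝ := fun p => if p = j then -1 else 1
  have hsg : ∀ p, sg p * sg p = 1 := fun p => by simp only [sg]; split_ifs <;> norm_num
  have hc' : IsTangentFrame z (fun p => sg p • c p) := by
    refine ⟨hc.norm_eq, ?_, fun p => by rw [inner_smul_right, hc.inner_eq, mul_zero]⟩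
    rw [orthonormal_iff_ite]
    intro p q
    rw [inner_smul_left, inner_smul_right, hc.inner_eq_ite]
    by_cases hpq : p = q
    · subst hpq
      simp [hsg]
    · simp [hpq]
  have heven : ∀ t, f (-t) = f t := by
    intro t
    simp only [f]
    rw [tangentEigenvalues_congr hc' hc (symm_radiiBilin_add hu hc.norm_eq (-t) (b i) (b j))
      (symm_radiiBilin_add hu hc.norm_eq t (b i) (b j))]
    ext p q
    have hd := congrFun (congrFun (formMatrix_testFun_circle hb m ε l i j s) p) q
    rw [formMatrix_apply] at hd
    simp only [formMatrix_apply, add_apply, smul_apply, map_smul, smul_eq_mul, symBilin_apply,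
      symProd]
    change radiiBilin u z (c p) (c q) = _ at hd
    rw [hd]
    simp only [c, inner_circleFrame hb]
    by_cases hpq : p = q
    · subst hpq
      rw [Matrix.diagonal_apply_eq]
      simp only [sg]
      by_cases h1 : i = p
      · have : ¬j = p := fun h => hij (h1.trans h.symm)
        simp [this, Ne.symm this]
      · simp [h1]
        split_ifs <;> simp
    · rw [Matrix.diagonal_apply_ne _ hpq]
      simp only [sg]
      by_cases h1 : i = p
      · have h2 : ¬j = p := fun h => hij (h1.trans h.symm)
        subst h1
        by_cases h3 : j = q
        · subst h3
          simp [hpq, Ne.symm hpq]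
        · simp [h3, h2]
      · by_cases h2 : i = q
        · have h3 : ¬j = q := fun h => hij (h2.trans h.symm)
          subst h2
          by_cases h4 : j = p
          · subst h4
            simp [hpq, Ne.symm hpq]
          · simp [h4, h3]
        · simp [h1, h2]
  -- An even function has `deriv` zero at 0; no differentiability is needed, because this identity
  -- also holds for the default value.
  have h := deriv_comp_neg f 0
  have h2 : (fun t => f (-t)) = f := funext heven
  rw [h2, neg_zero] at h
  linarith

/-- The radii of the test function along the great circle in the direction of its cubic term. -/
def circleRadii (m ε : ℝ) (l : Fin n → ℝ) (j : Fin n) (s : ℝ) (p : Fin n) : ℝ :=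
  if p = j then 2 * m + 2 * m * Real.sin s ^ 2 + l j * Real.cos s ^ 2 -
      (m + m * Real.cos s ^ 2 + 1 / 2 * l j * Real.sin s ^ 2) +
      ε * (6 * Real.sin s * Real.cos s ^ 2 - 2 * Real.sin s ^ 3)
    else 2 * m + l p - (m + m * Real.cos s ^ 2 + 1 / 2 * l j * Real.sin s ^ 2) +
      ε * (-2 * Real.sin s ^ 3)

theorem circleRadii_zero (m ε : ℝ) (l : Fin n → ℝ) (j : Fin n) : circleRadii m ε l j 0 = l := by
  ext p
  by_cases hp : p = j
  · subst hp
    simp [circleRadii]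
    ring
  · simp [circleRadii, hp]
    ring

/-- The quadratic part is even in s and contributes nothing to first order. The cubic term was
chosen so that its only linear contribution, 6ε sin s, falls on the j-th radius. -/
theorem hasDerivAt_circleRadii (m ε : ℝ) (l : Fin n → ℝ) (j : Fin n) :
    HasDerivAt (circleRadii m ε l j) ((6 * ε) • Pi.single j 1) 0 := by
  rw [hasDerivAt_pi]
  intro p
  have hs := Real.hasDerivAt_sin 0
  have hc := Real.hasDerivAt_cos 0
  simp only [circleRadii]
  by_cases hp : p = j
  · subst hp
    simp only [if_true]
    have h := ((((hs.pow 2).const_mul (2 * m)).const_add (2 * m)).add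
      ((hc.pow 2).const_mul (l p))).sub ((((hc.pow 2).const_mul m).const_add m).add
      ((hs.pow 2).const_mul (1 / 2 * l p)))
    have h' := (((hs.const_mul 6).mul (hc.pow 2)).sub ((hs.pow 3).const_mul 2)).const_mul ε
    refine (h.add h').congr_deriv ?_
    simp
    ring
  · simp only [if_neg hp]
    have h := ((((hc.pow 2).const_mul m).const_add m).add
      ((hs.pow 2).const_mul (1 / 2 * l j))).const_sub (2 * m + l p)
    have h' := ((hs.pow 3).const_mul (-2)).const_mul ε
    refine (h.add h').congr_deriv ?_
    simp [hp]

/-- The diagonal entries are the eigenvalues up to order, and F ignores the order. -/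
theorem map_tangentEigenvalues_of_diagonal {F : (Fin n → ℝ) → ℝ}
    (hsymm : ∀ (σ : Equiv.Perm (Fin n)), ∀ l ∈ posCone n, F (l ∘ σ) = F l)
    {x : E n} {b : Fin n → E n} (hb : IsTangentFrame x b) {B : E n →L[ℝ] E n →L[ℝ] ℝ}
    (hB : ∀ v w, B v w = B w v) {d : Fin n → ℝ} (hd : d ∈ posCone n)
    (h : formMatrix b B = Matrix.diagonal d) :
    F (tangentEigenvalues x fun v w => B v w) = F d := by
  obtain ⟨σ, hσ⟩ := exists_perm_tangentEigenvalues hb hB h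
  rw [hσ, hsymm σ d hd]

/-- The tangential part of b j at the moved point is cos s times the j-th vector of the moved frame.
Perturbing by b j ⊗ b j therefore moves only the j-th diagonal entry, at speed cos² s. -/
theorem curvTensor_testFun_self {F : (Fin n → ℝ) → ℝ} (k : ℕ)
    (hsymm : ∀ (σ : Equiv.Perm (Fin n)), ∀ l ∈ posCone n, F (l ∘ σ) = F l)
    (hF : ContDiffOn ℝ 2 F (posCone n)) {x : E n} {b : Fin n → E n}
    (hb : IsTangentFrame x b) (m ε : ℝ) (l : Fin n → ℝ) (j : Fin n)
    (hpos : RadiiPos (testFun (testQuad x b m l) ε (b j))) (s : ℝ) :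
    circleRadii m ε l j s ∈ posCone n ∧
    curvTensor F k (testFun (testQuad x b m l) ε (b j)) (Real.cos s • x + Real.sin s • b j)
      (b j) (b j) =
      Real.cos s ^ 2 * fderiv ℝ (fun l => F l ^ k) (circleRadii m ε l j s) (Pi.single j 1) := by
  have hmat := formMatrix_testFun_circle hb m ε l j j s
  have hrad := fun p => radiiBilin_testFun_circle hb m ε l j s p
  set u := testFun (testQuad x b m l) ε (b j)
  set z := Real.cos s • x + Real.sin s • b j
  have hu : SphereContDiff 2 u := sphereContDiff_testFun _ _ _
  have hc := isTangentFrame_circleFrame hb j s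
  set d := circleRadii m ε l j s with hd_def
  have hd : ∀ p, radiiBilin u z (circleFrame x b j s p) (circleFrame x b j s p) = d p := hrad
  have hdpos : d ∈ posCone n := by
    intro p
    rw [← hd, radiiBilin_apply]
    exact hpos z hc.norm_eq _ (hc.inner_eq p) (norm_ne_zero_iff.1 (by simp [hc.orthonormal.1 p]))
  refine ⟨hdpos, ?_⟩
  simp only [hd] at hmat
  have hline : ∀ t : ℝ, formMatrix (circleFrame x b j s)
      (radiiBilin u z + t • symBilin (b j) (b j)) =
      Matrix.diagonal (d + t • (Real.cos s ^ 2 • Pi.single j 1)) := by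
    intro t
    ext p q
    have h1 := congrFun (congrFun hmat p) q
    rw [formMatrix_apply] at h1
    simp only [formMatrix_apply, add_apply, smul_apply, h1, symBilin_apply, symProd,
      inner_circleFrame hb, smul_eq_mul]
    by_cases hpq : p = q
    · subst hpq
      by_cases hp : p = j
      · subst hp
        simp
        left
        ring
      · simp [hp, Ne.symm hp]
    · rw [Matrix.diagonal_apply_ne _ hpq, Matrix.diagonal_apply_ne _ hpq]
      by_cases hp : j = p
      · have : ¬j = q := fun h => hpq (hp.symm.trans h)
        simp [this]
      · simp [hp]
  have hcont : Continuous fun t : ℝ => d + t • (Real.cos s ^ 2 • Pi.single j (1 : ℝ)) := by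
    fun_prop
  have hev : ∀ᶠ t : ℝ in 𝓝 0, d + t • (Real.cos s ^ 2 • Pi.single j (1 : ℝ)) ∈ posCone n :=
    hcont.continuousAt.eventually_mem (isOpen_posCone.mem_nhds (by simpa using hdpos))
  rw [curvTensor_eq]
  have hev2 : (fun t : ℝ => F (tangentEigenvalues z fun a b' =>
      (radiiBilin u z + t • symBilin (b j) (b j)) a b') ^ k) =ᶠ[𝓝 0]
      fun t => (fun l => F l ^ k) (d + t • (Real.cos s ^ 2 • Pi.single j (1 : ℝ))) := by
    filter_upwards [hev] with t ht
    rw [map_tangentEigenvalues_of_diagonal hsymm hc (symm_radiiBilin_add hu hc.norm_eq t _ _)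
      ht (hline t)]
  have hdiff : DifferentiableAt ℝ (fun l => F l ^ k) d :=
    (((hF.pow k).contDiffAt (isOpen_posCone.mem_nhds hdpos)).differentiableAt (by simp))
  have hl : HasDerivAt (fun t : ℝ => d + t • (Real.cos s ^ 2 • Pi.single j (1 : ℝ)))
      (Real.cos s ^ 2 • Pi.single j (1 : ℝ)) 0 := by
    simpa using ((hasDerivAt_id (0 : ℝ)).smul_const
      (Real.cos s ^ 2 • Pi.single j (1 : ℝ))).const_add d
  have hcomp := HasFDerivAt.comp_hasDerivAt_of_eq (0 : ℝ) hdiff.hasFDerivAt hl (by simp)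
  rw [hev2.deriv_eq]
  refine hcomp.deriv.trans ?_
  simp

/-- If `F^k` is divergence-free, then `F^k` has vanishing pure second derivatives. -/
theorem fderiv_fderiv_pow_eq_zero {F : (Fin n → ℝ) → ℝ} {k : ℕ} (hF : IsCurvatureFunction F)
    (hdiv : IsDivergenceFree F k) {l : Fin n → ℝ} (hl : l ∈ posCone n) (j : Fin n) :
    fderiv ℝ (fderiv ℝ fun l => F l ^ k) l (Pi.single j 1) (Pi.single j 1) = 0 := by
  have hne : Nonempty (Fin n) := ⟨j⟩
  set x : E n := EuclideanSpace.single 0 1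
  have hx : ‖x‖ = 1 := by simp [x]
  have hb := isTangentFrame_frame hx
  obtain ⟨i₀, hi₀⟩ := Finite.exists_min l
  -- Any m with l p ≤ 2m for all p would do; the sum of the positive l p is such a bound.
  set m := ∑ p, l p
  have hlm : ∀ p, l p ≤ 2 * m := fun p => by
    have := Finset.single_le_sum (fun q _ => (hl q).le) (Finset.mem_univ p)
    have hp := hl p
    simp only [m]
    linarith
  have hpos := radiiPos_testFun hb (hl i₀) hi₀ (hlm i₀) hlm j
  set ε := l i₀ / 16
  have hε : 0 < ε := div_pos (hl i₀) (by norm_num)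
  have h0 := hdiv _ (sphereContDiff_testFun _ _ _) hpos x hx (frame x j) (hb.inner_eq j)
  -- In the divergence contracted with e_j, the terms with i ≠ j vanish identically along their
  -- great circles.
  rw [curvTensorDiv, Finset.sum_eq_single j] at h0
  · have hself := fun s => (curvTensor_testFun_self k hF.symm hF.contDiffOn hb m ε l j hpos s).2
    simp only [hself] at h0
    have hf2 : DifferentiableAt ℝ (fderiv ℝ fun l => F l ^ k) l :=
      (((hF.contDiffOn.pow k).contDiffAt (isOpen_posCone.mem_nhds hl)).fderiv_right (m := 1)
        (by norm_num)).differentiableAt (by simp)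
    -- As cos² has zero derivative at 0, what remains of the product rule is 6ε ∂_j∂_j F^k(l), and ε
    -- > 0.
    have h1 := HasFDerivAt.comp_hasDerivAt_of_eq (0 : ℝ) hf2.hasFDerivAt
      (hasDerivAt_circleRadii m ε l j) (circleRadii_zero m ε l j).symm
    have h2 := ((Real.hasDerivAt_cos 0).pow 2).mul
      (h1.clm_apply (hasDerivAt_const (0 : ℝ) (Pi.single j (1 : ℝ))))
    have h3 := h2.deriv
    simp only [Function.comp_def] at h3
    have h4 : deriv (fun s => Real.cos s ^ 2 *
        fderiv ℝ (fun l => F l ^ k) (circleRadii m ε l j s) (Pi.single j 1)) 0 = 0 := h0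
    have h5 := h3.symm.trans h4
    simpa [hε.ne'] using h5
  · intro i _ hij
    have := fun s => curvTensor_testFun_of_ne F k hb m ε l hij s
    simp only [this, deriv_const]
  · simp

/-- If `F^k` is divergence-free, then `F^k` is affine in each variable. -/
theorem pow_eq_of_isDivergenceFree {F : (Fin n → ℝ) → ℝ} {k : ℕ} (hF : IsCurvatureFunction F)
    (hdiv : IsDivergenceFree F k) {l : Fin n → ℝ} (hl : l ∈ posCone n) (j : Fin n) :
    F l ^ k = (l j - 1) * F (Function.update l j 2) ^ k +
      (2 - l j) * F (Function.update l j 1) ^ k := by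
  set f : (Fin n → ℝ) → ℝ := fun l => F l ^ k
  have hf : ContDiffOn ℝ 2 f (posCone n) := hF.contDiffOn.pow k
  have hmem : ∀ t : ℝ, 0 < t → Function.update l j t ∈ posCone n := by
    intro t ht i
    by_cases h : i = j
    · subst h; simpa using ht
    · simpa [h] using hl i
  have hupd : ∀ t : ℝ, HasDerivAt (fun t => Function.update l j t) (Pi.single j (1 : ℝ)) t :=
    fun t => hasDerivAt_update l j t
  have h1 : ∀ t : ℝ, 0 < t → HasDerivAt (fun t => f (Function.update l j t))
      (fderiv ℝ f (Function.update l j t) (Pi.single j 1)) t := fun t ht =>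
    HasFDerivAt.comp_hasDerivAt t ((hf.contDiffAt (isOpen_posCone.mem_nhds
      (hmem t ht))).differentiableAt (by simp)).hasFDerivAt (hupd t)
  have h2 : ∀ t : ℝ, 0 < t → HasDerivAt
      (fun t => fderiv ℝ f (Function.update l j t) (Pi.single j 1)) 0 t := by
    intro t ht
    have hd : DifferentiableAt ℝ (fderiv ℝ f) (Function.update l j t) :=
      ((hf.contDiffAt (isOpen_posCone.mem_nhds (hmem t ht))).fderiv_right (m := 1)
        (by norm_num)).differentiableAt (by simp)
    have := (HasFDerivAt.comp_hasDerivAt t hd.hasFDerivAt (hupd t)).clm_apply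
      (hasDerivAt_const t (Pi.single j (1 : ℝ)))
    refine this.congr_deriv ?_
    simpa using fderiv_fderiv_pow_eq_zero hF hdiv (hmem t ht) j
  -- On the ray t > 0 the second derivative vanishes, so the function is a + c t; comparing the
  -- values at l j, 1 and 2 eliminates a and c.
  obtain ⟨c, hc⟩ : ∃ c, ∀ t ∈ Ioi (0 : ℝ),
      fderiv ℝ f (Function.update l j t) (Pi.single j 1) = c :=
    isOpen_Ioi.exists_is_const_of_deriv_eq_zero isPreconnected_Ioi
      (fun t ht => (h2 t ht).differentiableAt.differentiableWithinAt)
      (fun t ht => (h2 t ht).deriv)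
  obtain ⟨a, ha⟩ : ∃ a, ∀ t ∈ Ioi (0 : ℝ), f (Function.update l j t) - c * t = a := by
    have h3 : ∀ t ∈ Ioi (0 : ℝ), HasDerivAt (fun t => f (Function.update l j t) - c * t) 0 t := by
      intro t ht
      refine ((h1 t ht).fun_sub ((hasDerivAt_id t).const_mul c)).congr_deriv ?_
      rw [hc t ht]
      simp
    exact isOpen_Ioi.exists_is_const_of_deriv_eq_zero isPreconnected_Ioi
      (fun t ht => (h3 t ht).differentiableAt.differentiableWithinAt)
      (fun t ht => (h3 t ht).deriv)
  have e0 := ha (l j) (hl j)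
  have e1 := ha 1 (mem_Ioi.2 one_pos)
  have e2 := ha 2 (mem_Ioi.2 two_pos)
  rw [Function.update_eq_self] at e0
  simp only [f] at e0 e1 e2
  rw [show F l ^ k = a + c * l j by linarith, show F (Function.update l j 2) ^ k = a + c * 2 by
    linarith, show F (Function.update l j 1) ^ k = a + c * 1 by linarith]
  ring

/-- If `F^k` is divergence-free, then `F^k` is a linear combination of products of identical affine
functions of the variables. -/
theorem exists_pow_eq_sum_prod {F : (Fin n → ℝ) → ℝ} {k : ℕ} (hF : IsCurvatureFunction F)
    (hdiv : IsDivergenceFree F k) : ∃ (w α β : Fin (n + 1) → ℝ), (∀ i, α i ≠ 0) ∧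
      ∀ l ∈ posCone n, F l ^ k = ∑ i, w i * ∏ j, (α i * l j + β i) :=
  exists_sum_prod_of_multiAffine (f := fun l => F l ^ k) (fun σ l hl => by simp only [hF.symm σ l hl])
    fun _ hl j => pow_eq_of_isDivergenceFree hF hdiv hl j

end

/-! ### The derivative of the determinant -/

section

variable {ι : Type*} [Fintype ι] [DecidableEq ι]

/-- The determinant as a continuous multilinear map of the rows. -/
def detMultilinear (ι : Type*) [Fintype ι] [DecidableEq ι] :
    ContinuousMultilinearMap ℝ (fun _ : ι => ι → ℝ) ℝ where
  toMultilinearMap := (Matrix.detRowAlternating (n := ι) (R := ℝ)).toMultilinearMap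
  cont := Continuous.matrix_det (A := fun M : ι → ι → ℝ => Matrix.of M) continuous_id

theorem det_updateRow_eq_sum (M : Matrix ι ι ℝ) (i : ι) (v : ι → ℝ) :
    (M.updateRow i v).det = ∑ j, M.adjugate j i * v j := by
  rw [← Matrix.cramer_transpose_apply, Matrix.cramer_eq_adjugate_mulVec,
    ← Matrix.adjugate_transpose]
  rfl

theorem hasFDerivAt_det {G : Type*} [NormedAddCommGroup G] [NormedSpace ℝ G]
    {g : ι → G → ι → ℝ} {g' : ι → G →L[ℝ] ι → ℝ} {x : G} (hg : ∀ i, HasFDerivAt (g i) (g' i) x) :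
    ∃ L : G →L[ℝ] ℝ, HasFDerivAt (fun y => (Matrix.of fun i => g i y).det) L x ∧
      ∀ v, L v = ∑ i, ((Matrix.of fun i => g i x).updateRow i (g' i v)).det := by
  refine ⟨_, HasFDerivAt.multilinear_comp (detMultilinear ι) hg, fun v => ?_⟩
  rw [sum_apply]
  rfl

/-- Jacobi's formula: multilinearity differentiates one row at a time, and Laplace expansion along
that row produces the adjugate. -/
theorem hasDerivAt_det_add_smul (A B : Matrix ι ι ℝ) (t : ℝ) :
    HasDerivAt (fun t : ℝ => (A + t • B).det) (∑ i, ∑ j, (A + t • B).adjugate j i * B i j) t := by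
  obtain ⟨L, hL, hL'⟩ := hasFDerivAt_det (ι := ι) (x := t) (g := fun i t => (A + t • B) i)
    (g' := fun i => (ContinuousLinearMap.id ℝ ℝ).smulRight (B i))
    (fun i => ((hasFDerivAt_id t).smul_const (B i)).const_add (A i))
  have h := hL.hasDerivAt
  rw [hL'] at h
  simp only [ContinuousLinearMap.smulRight_apply, ContinuousLinearMap.id_apply, one_smul,
    det_updateRow_eq_sum] at h
  exact h

theorem contDiff_det {G : Type*} [NormedAddCommGroup G] [NormedSpace ℝ G] {r : WithTop ℕ∞}
    {M : G → Matrix ι ι ℝ} (hM : ∀ i j, ContDiff ℝ r fun y => M y i j) :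
    ContDiff ℝ r fun y => (M y).det :=
  (detMultilinear ι).contDiff.comp (contDiff_pi.2 fun i => contDiff_pi.2 fun j => hM i j)

theorem contDiff_adjugate {G : Type*} [NormedAddCommGroup G] [NormedSpace ℝ G] {r : WithTop ℕ∞}
    {M : G → Matrix ι ι ℝ} (hM : ∀ i j, ContDiff ℝ r fun y => M y i j) (i j : ι) :
    ContDiff ℝ r fun y => (M y).adjugate i j := by
  simp only [Matrix.adjugate_apply]
  refine contDiff_det fun p q => ?_
  by_cases hp : p = j
  · subst hp
    simpa using contDiff_const
  · simpa [hp] using hM p q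

end

/-! ### Cofactors of Jacobians are divergence-free -/

section

variable {n : ℕ}

/-- The Hessian matrix. -/
def hessMat (U : E n → ℝ) (y : E n) : Matrix (Fin (n + 1)) (Fin (n + 1)) ℝ :=
  formMatrix stdVec (fderiv ℝ (fderiv ℝ U) y)

theorem hessMat_apply (U : E n → ℝ) (y : E n) (i j : Fin (n + 1)) :
    hessMat U y i j = fderiv ℝ (fderiv ℝ U) y (stdVec i) (stdVec j) := rfl

theorem sum_mul_eq_zero_of_antisymm {ι : Type*} [Fintype ι] {T X : ι → ι → ℝ}
    (hT : ∀ b d, T b d = T d b) (hX : ∀ b d, X b d = -X d b) : ∑ b, ∑ d, T b d * X b d = 0 := by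
  have h : ∑ b, ∑ d, T b d * X b d = -∑ b, ∑ d, T b d * X b d := by
    conv_lhs => rw [Finset.sum_comm]
    rw [← Finset.sum_neg_distrib]
    refine Finset.sum_congr rfl fun b _ => ?_
    rw [← Finset.sum_neg_distrib]
    refine Finset.sum_congr rfl fun d _ => ?_
    rw [hT, hX d b]
    ring
  linarith

/-- The Piola identity. Differentiating row c of a cofactor produces the third derivative ∂_b∂_c∂_d
U, symmetric in b and d, times a determinant whose rows a and c are unit vectors e_b and e_d,
antisymmetric in b and d. The contraction over b and d vanishes. -/
theorem sum_fderiv_adjugate_eq_zero {U : E n → ℝ} (hU : ContDiff ℝ 3 U) (y : E n)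
    (a : Fin (n + 1)) :
    ∑ b, fderiv ℝ (fun y => (hessMat U y).adjugate b a) y (stdVec b) = 0 := by
  have hH : ∀ i j, ContDiff ℝ 1 fun y => hessMat U y i j := fun i j =>
    (((hU.fderiv_right (m := 2) (by norm_num)).fderiv_right (m := 1) (by norm_num)).clm_apply
      contDiff_const).clm_apply contDiff_const
  let T : Fin (n + 1) → Fin (n + 1) → Fin (n + 1) → ℝ := fun b c d =>
    fderiv ℝ (fun y => hessMat U y c d) y (stdVec b)
  have hT : ∀ c b d, T b c d = T d c b := by
    intro c b d
    have hg : ContDiff ℝ 2 fun y => fderiv ℝ U y (stdVec c) :=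
      (hU.fderiv_right (m := 2) (by norm_num)).clm_apply contDiff_const
    have h1 : ∀ d, (fun y => hessMat U y c d) =
        fun y => fderiv ℝ (fun y => fderiv ℝ U y (stdVec c)) y (stdVec d) := by
      intro d
      ext z
      rw [hessMat_apply, fderiv_fderiv_symm (hU.of_le (by norm_num)).contDiffAt,
        fderiv_clm_apply ((hU.fderiv_right (m := 2) (by norm_num)).differentiable (by simp) z)
          (differentiableAt_const _)]
      simp
    have h2 : ∀ b d, T b c d =
        fderiv ℝ (fderiv ℝ fun y => fderiv ℝ U y (stdVec c)) y (stdVec b) (stdVec d) := by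
      intro b d
      simp only [T]
      rw [h1 d, fderiv_clm_apply
        ((hg.fderiv_right (m := 1) (by norm_num)).differentiable (by simp) y)
          (differentiableAt_const _)]
      simp
    rw [h2, h2, fderiv_fderiv_symm hg.contDiffAt]
  have hder : ∀ b, fderiv ℝ (fun y => (hessMat U y).adjugate b a) y (stdVec b) =
      ∑ c, if c = a then 0 else
        ∑ d, T b c d * (((hessMat U y).updateRow a (Pi.single b 1)).updateRow c
          (Pi.single d 1)).det := by
    intro b
    have hrow : ∀ i, HasFDerivAt (fun y => (hessMat U y).updateRow a (Pi.single b 1) i)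
        (if i = a then 0 else ContinuousLinearMap.pi fun j =>
          fderiv ℝ (fun y => hessMat U y i j) y) y := by
      intro i
      by_cases hi : i = a
      · subst hi
        simpa using hasFDerivAt_const (𝕜 := ℝ) (Pi.single b (1 : ℝ) : Fin (n + 1) → ℝ) y
      · simp only [if_neg hi, Matrix.updateRow_ne hi]
        exact hasFDerivAt_pi.2 fun j => ((hH i j).differentiable (by simp) y).hasFDerivAt
    obtain ⟨L, hL, hL'⟩ := hasFDerivAt_det hrow
    have : (fun y => (hessMat U y).adjugate b a) =
        fun y => (Matrix.of fun i => (hessMat U y).updateRow a (Pi.single b 1) i).det := by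
      ext z
      rw [Matrix.adjugate_apply]
      rfl
    rw [this, hL.fderiv, hL']
    refine Finset.sum_congr rfl fun c _ => ?_
    by_cases hc : c = a
    · simp only [if_pos hc]
      exact Matrix.det_eq_zero_of_row_eq_zero c (by simp)
    · simp only [if_neg hc, det_updateRow_eq_sum]
      refine Finset.sum_congr rfl fun d _ => ?_
      simp [Pi.single_apply, T]
      exact mul_comm _ _
  simp only [hder]
  rw [Finset.sum_comm]
  refine Finset.sum_eq_zero fun c _ => ?_
  by_cases hc : c = a
  · simp [hc]
  · simp only [if_neg hc]
    refine sum_mul_eq_zero_of_antisymm (hT c) fun b d => ?_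
    -- Exchanging b and d amounts to exchanging rows a and c.
    have hsw : (((hessMat U y).updateRow a (Pi.single b 1)).updateRow c (Pi.single d 1)) =
        (((hessMat U y).updateRow a (Pi.single d 1)).updateRow c (Pi.single b 1)).submatrix
          (Equiv.swap a c) id := by
      ext i j
      by_cases hia : i = a
      · subst hia
        simp [Matrix.updateRow_ne (Ne.symm hc)]
      · by_cases hic : i = c
        · subst hic
          simp [Matrix.updateRow_ne (Ne.symm hc)]
        · simp [Matrix.updateRow_ne hia, Matrix.updateRow_ne hic,
            Equiv.swap_apply_of_ne_of_ne hia hic]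
    rw [hsw, Matrix.det_permute, Equiv.Perm.sign_swap (Ne.symm hc)]
    simp

/-! ### Integration by parts against cofactors of Hessians -/

/-- The pairing of two vectors by the adjugate matrix. -/
def adjPair (H : Matrix (Fin (n + 1)) (Fin (n + 1)) ℝ) (p q : Fin (n + 1) → ℝ) : ℝ :=
  ∑ i, ∑ j, H.adjugate i j * p i * q j

theorem adjPair_comm {H : Matrix (Fin (n + 1)) (Fin (n + 1)) ℝ} (hH : H.IsSymm)
    (p q : Fin (n + 1) → ℝ) : adjPair H p q = adjPair H q p := by
  rw [adjPair, Finset.sum_comm, adjPair]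
  refine Finset.sum_congr rfl fun i _ => Finset.sum_congr rfl fun j _ => ?_
  rw [hH.adjugate.apply]
  ring

/-- The components of the gradient. -/
def gradVec (U : E n → ℝ) (y : E n) (i : Fin (n + 1)) : ℝ := fderiv ℝ U y (stdVec i)

theorem isSymm_hessMat {U : E n → ℝ} {y : E n} (hU : ContDiffAt ℝ 2 U y) : (hessMat U y).IsSymm := by
  ext i j
  rw [Matrix.transpose_apply, hessMat_apply, hessMat_apply, fderiv_fderiv_symm hU]

theorem contDiff_hessMat {U : E n → ℝ} {r s : WithTop ℕ∞} (hU : ContDiff ℝ s U)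
    (hr : r + 1 + 1 ≤ s) (i j : Fin (n + 1)) : ContDiff ℝ r fun y => hessMat U y i j :=
  (((hU.fderiv_right (m := r + 1) hr).fderiv_right (m := r) le_rfl).clm_apply
      contDiff_const).clm_apply contDiff_const

theorem contDiff_gradVec {U : E n → ℝ} {r s : WithTop ℕ∞} (hU : ContDiff ℝ s U)
    (hr : r + 1 ≤ s) (i : Fin (n + 1)) : ContDiff ℝ r fun y => gradVec U y i :=
  (hU.fderiv_right (m := r) hr).clm_apply contDiff_const

theorem fderiv_gradVec {U : E n → ℝ} (hU : ContDiff ℝ 2 U) (y : E n) (i j : Fin (n + 1)) :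
    fderiv ℝ (fun y => gradVec U y j) y (stdVec i) = hessMat U y i j := by
  simp only [gradVec]
  rw [fderiv_clm_apply ((hU.fderiv_right (m := 1) (by norm_num)).differentiable (by simp) y)
    (differentiableAt_const _)]
  simp [hessMat_apply]

/-- Integration by parts; the derivative falling on the cofactors drops out by the Piola identity. U
has to be C³ for its cofactors to be C¹. -/
theorem integral_adjugate_hessMat {U V χ : E n → ℝ} (hU : ContDiff ℝ 3 U) (hV : ContDiff ℝ 2 V)
    (hχ : ContDiff ℝ 1 χ) (hχc : HasCompactSupport χ) :
    ∫ y, χ y * ∑ i, ∑ j, (hessMat U y).adjugate i j * hessMat V y i j =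
      -∫ y, adjPair (hessMat U y) (gradVec χ y) (gradVec V y) := by
  have hA : ∀ i j, ContDiff ℝ 1 fun y => (hessMat U y).adjugate i j :=
    contDiff_adjugate fun i j => contDiff_hessMat hU (by norm_num) i j
  have hg : ∀ j, ContDiff ℝ 1 fun y => χ y * gradVec V y j :=
    fun j => hχ.mul (contDiff_gradVec hV (by norm_num) j)
  have hgc : ∀ j, HasCompactSupport fun y => χ y * gradVec V y j := fun j => hχc.mul_right
  have hcont' : ∀ i j, Continuous fun y =>
      fderiv ℝ (fun y => (hessMat U y).adjugate i j) y (stdVec i) := fun i j =>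
    ((hA i j).continuous_fderiv (by simp)).clm_apply continuous_const
  have hgcont' : ∀ i j, Continuous fun y =>
      fderiv ℝ (fun y => χ y * gradVec V y j) y (stdVec i) := fun i j =>
    ((hg j).continuous_fderiv (by simp)).clm_apply continuous_const
  have hgc' : ∀ i j, HasCompactSupport fun y =>
      fderiv ℝ (fun y => χ y * gradVec V y j) y (stdVec i) := fun i j =>
    (hgc j).fderiv_apply (𝕜 := ℝ) (stdVec i)
  have hI1 : ∀ i j, Integrable fun y =>
      fderiv ℝ (fun y => (hessMat U y).adjugate i j) y (stdVec i) * (χ y * gradVec V y j) :=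
    fun i j => ((hcont' i j).mul (hg j).continuous).integrable_of_hasCompactSupport
      (hgc j).mul_left
  have hI2 : ∀ i j, Integrable fun y => (hessMat U y).adjugate i j *
      fderiv ℝ (fun y => χ y * gradVec V y j) y (stdVec i) :=
    fun i j => ((hA i j).continuous.mul (hgcont' i j)).integrable_of_hasCompactSupport
      (hgc' i j).mul_left
  have hibp : ∀ i j, ∫ y, (hessMat U y).adjugate i j *
      fderiv ℝ (fun y => χ y * gradVec V y j) y (stdVec i) =
      -∫ y, fderiv ℝ (fun y => (hessMat U y).adjugate i j) y (stdVec i) *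
        (χ y * gradVec V y j) := fun i j =>
    integral_mul_fderiv_eq_neg_fderiv_mul_of_integrable (hI1 i j) (hI2 i j)
      (((hA i j).continuous.mul (hg j).continuous).integrable_of_hasCompactSupport
        (hgc j).mul_left)
      (fun y _ => (hA i j).differentiable (by simp) y)
      (fun y _ => (hg j).differentiable (by simp) y)
  have hzero : ∫ y, ∑ i, ∑ j, (hessMat U y).adjugate i j *
      fderiv ℝ (fun y => χ y * gradVec V y j) y (stdVec i) = 0 := by
    rw [integral_finsetSum _ fun i _ => integrable_finsetSum _ fun j _ => hI2 i j]
    simp only [fun i => integral_finsetSum Finset.univ fun j _ => hI2 i j, hibp]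
    rw [Finset.sum_comm]
    refine Finset.sum_eq_zero fun j _ => ?_
    rw [Finset.sum_neg_distrib, neg_eq_zero, ← integral_finsetSum _ fun i _ => hI1 i j]
    simp only [← Finset.sum_mul, sum_fderiv_adjugate_eq_zero hU, zero_mul, integral_zero]
  have hprod : ∀ y i j, fderiv ℝ (fun y => χ y * gradVec V y j) y (stdVec i) =
      gradVec χ y i * gradVec V y j + χ y * hessMat V y i j := by
    intro y i j
    rw [fderiv_fun_mul (hχ.differentiable (by simp) y)
      ((contDiff_gradVec (r := 1) hV (by norm_num) j).differentiable (by simp) y)]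
    simp only [add_apply, smul_apply, smul_eq_mul, fderiv_gradVec hV]
    rw [add_comm, mul_comm (gradVec V y j)]
    rfl
  have hsplit : ∀ y, ∑ i, ∑ j, (hessMat U y).adjugate i j *
      fderiv ℝ (fun y => χ y * gradVec V y j) y (stdVec i) =
      adjPair (hessMat U y) (gradVec χ y) (gradVec V y) +
      χ y * ∑ i, ∑ j, (hessMat U y).adjugate i j * hessMat V y i j := by
    intro y
    simp only [hprod, adjPair, Finset.mul_sum, ← Finset.sum_add_distrib]
    refine Finset.sum_congr rfl fun i _ => Finset.sum_congr rfl fun j _ => ?_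
    ring
  simp only [hsplit] at hzero
  have hχ' : ∀ i, Continuous fun y => gradVec χ y i := fun i =>
    (contDiff_gradVec (r := 0) hχ (by norm_num) i).continuous
  have hV' : ∀ i, Continuous fun y => gradVec V y i := fun i =>
    (contDiff_gradVec (r := 1) hV (by norm_num) i).continuous
  have hJ1 : Integrable fun y => adjPair (hessMat U y) (gradVec χ y) (gradVec V y) := by
    refine integrable_finsetSum _ fun i _ => integrable_finsetSum _ fun j _ => ?_
    refine (((hA i j).continuous.mul (hχ' i)).mul (hV' j)).integrable_of_hasCompactSupport ?_
    exact ((hχc.fderiv_apply (𝕜 := ℝ) (stdVec i)).mul_left).mul_right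
  have hJ2 : Integrable fun y => χ y * ∑ i, ∑ j, (hessMat U y).adjugate i j * hessMat V y i j := by
    refine (hχ.continuous.mul (continuous_finsetSum _ fun i _ => continuous_finsetSum _ fun j _ =>
      (hA i j).continuous.mul
        (contDiff_hessMat (r := 0) hV (by norm_num) i j).continuous)).integrable_of_hasCompactSupport
      hχc.mul_right
  rw [integral_add hJ1 hJ2] at hzero
  linarith

end

/-! ### First variation of ∫ u det(D²u + uI). -/

section

variable {n : ℕ}

/-! ### The variation of the Monge-Ampère functional: smooth functions -/

theorem integrable_prod_of_continuous {f : ℝ × E n → ℝ} (hf : Continuous f) {K : Set (E n)}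
    (hK : IsCompact K) (h0 : ∀ t, ∀ y ∉ K, f (t, y) = 0) :
    Integrable f ((volume.restrict (Ioc (0 : ℝ) 1)).prod volume) := by
  have h1 : IntegrableOn f (Icc (0 : ℝ) 1 ×ˢ K) (volume.prod volume) :=
    hf.continuousOn.integrableOn_compact (isCompact_Icc.prod hK)
  have h2 : (volume.restrict (Ioc (0 : ℝ) 1)).prod (volume : Measure (E n)) =
      (volume.prod volume).restrict (Ioc (0 : ℝ) 1 ×ˢ univ) := by
    rw [← Measure.prod_restrict, Measure.restrict_univ]
  rw [h2]
  refine h1.of_forall_sdiff_eq_zero (measurableSet_Ioc.prod MeasurableSet.univ) ?_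
  rintro ⟨t, y⟩ ⟨ht, hty⟩
  refine h0 t y fun hy => hty ⟨Ioc_subset_Icc_self ht.1, hy⟩

theorem continuous_adjPair {X : Type*} [TopologicalSpace X]
    {H : X → Matrix (Fin (n + 1)) (Fin (n + 1)) ℝ} {p q : X → Fin (n + 1) → ℝ}
    (hH : Continuous H) (hp : Continuous p) (hq : Continuous q) :
    Continuous fun x => adjPair (H x) (p x) (q x) := by
  refine continuous_finsetSum _ fun i _ => continuous_finsetSum _ fun j _ => ?_
  exact ((hH.matrix_adjugate.matrix_elem i j).mul ((continuous_apply i).comp hp)).mul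
    ((continuous_apply j).comp hq)

theorem continuous_hessMat {U : E n → ℝ} (hU : ContDiff ℝ 2 U) : Continuous (hessMat U) :=
  continuous_matrix fun i j => (contDiff_hessMat (r := 0) hU (by norm_num) i j).continuous

theorem continuous_gradVec {U : E n → ℝ} (hU : ContDiff ℝ 1 U) : Continuous (gradVec U) :=
  continuous_pi fun i => (contDiff_gradVec (r := 0) hU (by norm_num) i).continuous

theorem hessMat_add_smul {U V : E n → ℝ} {y : E n} (hU : ContDiffAt ℝ 2 U y)
    (hV : ContDiffAt ℝ 2 V y) (t : ℝ) :
    hessMat (U + t • V) y = hessMat U y + t • hessMat V y := by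
  have hev : fderiv ℝ (U + t • V) =ᶠ[𝓝 y] fun y => fderiv ℝ U y + t • fderiv ℝ V y := by
    filter_upwards [hU.eventually (by simp), hV.eventually (by simp)] with z hz hz'
    have h1 := hz.differentiableAt (by simp)
    have h2 := hz'.differentiableAt (by simp)
    exact (h1.hasFDerivAt.add (h2.hasFDerivAt.const_smul t)).fderiv
  have hd : ∀ {W : E n → ℝ}, ContDiffAt ℝ 2 W y → DifferentiableAt ℝ (fderiv ℝ W) y := fun hW =>
    (hW.fderiv_right (m := 1) (by norm_num)).differentiableAt (by simp)
  have h3 := hev.fderiv_eq.trans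
    ((hd hU).hasFDerivAt.add ((hd hV).hasFDerivAt.const_smul t)).fderiv
  ext i j
  rw [hessMat_apply, h3]
  simp only [add_apply, smul_apply]
  rfl

theorem gradVec_add_smul {U V : E n → ℝ} {y : E n} (hU : DifferentiableAt ℝ U y)
    (hV : DifferentiableAt ℝ V y) (t : ℝ) :
    gradVec (U + t • V) y = gradVec U y + t • gradVec V y := by
  ext i
  simp only [gradVec]
  rw [(hU.hasFDerivAt.add (hV.hasFDerivAt.const_smul t)).fderiv]
  rfl

/-- The case V = U of the integration by parts: the trace of adj(H) H is (n+1) det H in dimension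
n+1. -/
theorem integral_adjPair_self {U χ : E n → ℝ} (hU : ContDiff ℝ 3 U)
    (hχ : ContDiff ℝ 1 χ) (hχc : HasCompactSupport χ) :
    ∫ y, adjPair (hessMat U y) (gradVec χ y) (gradVec U y) =
      -((n + 1) * ∫ y, χ y * (hessMat U y).det) := by
  have hU2 : ContDiff ℝ 2 U := hU.of_le (by norm_num)
  have h := integral_adjugate_hessMat hU hU2 hχ hχc
  have h1 : ∀ y, ∑ i, ∑ j, (hessMat U y).adjugate i j * hessMat U y i j =
      (n + 1) * (hessMat U y).det := by
    intro y
    have hs := isSymm_hessMat (U := U) hU2.contDiffAt (y := y)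
    have : ∀ i, ∑ j, (hessMat U y).adjugate i j * hessMat U y i j = (hessMat U y).det := by
      intro i
      rw [Matrix.det_eq_sum_mul_adjugate_row (hessMat U y) i]
      refine Finset.sum_congr rfl fun j _ => ?_
      rw [hs.adjugate.apply, mul_comm]
    simp [this]
  simp only [h1] at h
  rw [← neg_eq_iff_eq_neg, ← h, ← integral_const_mul]
  congr 1
  ext y
  ring

/-- Both sides come from ∫ χ det: the left through `integral_adjPair_self`, the right by
differentiating det(D²U + tD²V) in t and integrating by parts. They are written with ∇χ and
derivatives of order at most two. The identity therefore survives C² limits and sees U and V only on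
the support of ∇χ. -/
theorem integral_adjPair_variation_smooth {U V χ : E n → ℝ} (hU : ContDiff ℝ 3 U)
    (hV : ContDiff ℝ 3 V) (hχ : ContDiff ℝ 1 χ) (hχc : HasCompactSupport χ) :
    (∫ y, adjPair (hessMat U y + hessMat V y) (gradVec χ y) (gradVec U y + gradVec V y)) -
      ∫ y, adjPair (hessMat U y) (gradVec χ y) (gradVec U y) =
    (n + 1) * ∫ z : ℝ × E n,
      adjPair (hessMat U z.2 + z.1 • hessMat V z.2) (gradVec χ z.2) (gradVec V z.2)
        ∂((volume.restrict (Ioc (0 : ℝ) 1)).prod volume) := by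
  have hU2 : ContDiff ℝ 2 U := hU.of_le (by norm_num)
  have hV2 : ContDiff ℝ 2 V := hV.of_le (by norm_num)
  have hK : IsCompact (tsupport χ) := hχc
  have hUt : ∀ t : ℝ, ContDiff ℝ 3 (U + t • V) := fun t => hU.add (hV.const_smul t)
  have hH : ∀ t y, hessMat (U + t • V) y = hessMat U y + t • hessMat V y := fun t y =>
    hessMat_add_smul hU2.contDiffAt hV2.contDiffAt t
  have hg : ∀ t y, gradVec (U + t • V) y = gradVec U y + t • gradVec V y := fun t y =>
    gradVec_add_smul (hU.differentiable (by simp) y) (hV.differentiable (by simp) y) t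
  have hχ0 : ∀ y ∉ tsupport χ, gradVec χ y = 0 := by
    intro y hy
    ext i
    have : fderiv ℝ χ y = 0 := image_eq_zero_of_notMem_tsupport
      fun h => hy (tsupport_fderiv_subset ℝ h)
    simp [gradVec, this]
  -- the left-hand side as a difference of determinants
  have h1 := integral_adjPair_self (hUt 1) hχ hχc
  have h0 := integral_adjPair_self hU hχ hχc
  simp only [hH, hg] at h1
  simp only [one_smul] at h1
  rw [h1, h0]
  have hHc : Continuous fun z : ℝ × E n => hessMat U z.2 + z.1 • hessMat V z.2 :=
    ((continuous_hessMat hU2).comp continuous_snd).add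
      (continuous_fst.smul ((continuous_hessMat hV2).comp continuous_snd))
  have hI1 : Integrable (fun z : ℝ × E n =>
      adjPair (hessMat U z.2 + z.1 • hessMat V z.2) (gradVec χ z.2) (gradVec V z.2))
      ((volume.restrict (Ioc (0 : ℝ) 1)).prod volume) := by
    refine integrable_prod_of_continuous (continuous_adjPair hHc
      ((continuous_gradVec hχ).comp continuous_snd)
      ((continuous_gradVec (hV.of_le (by norm_num))).comp continuous_snd)) hK fun t y hy => ?_
    simp [adjPair, hχ0 y hy]
  have hDcont : Continuous fun z : ℝ × E n => ∑ i, ∑ j,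
      (hessMat U z.2 + z.1 • hessMat V z.2).adjugate i j * hessMat V z.2 i j := by
    refine continuous_finsetSum _ fun i _ => continuous_finsetSum _ fun j _ => ?_
    exact (hHc.matrix_adjugate.matrix_elem i j).mul
      (((continuous_hessMat hV2).comp continuous_snd).matrix_elem i j)
  have hI2 : Integrable (fun z : ℝ × E n => χ z.2 * ∑ i, ∑ j,
      (hessMat U z.2 + z.1 • hessMat V z.2).adjugate i j * hessMat V z.2 i j)
      ((volume.restrict (Ioc (0 : ℝ) 1)).prod volume) := by
    refine integrable_prod_of_continuous ((hχ.continuous.comp continuous_snd).mul hDcont) hK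
      fun t y hy => ?_
    simp [image_eq_zero_of_notMem_tsupport hy]
  rw [integral_prod _ hI1]
  have hinner : ∀ t : ℝ, ∫ y, adjPair (hessMat U y + t • hessMat V y) (gradVec χ y) (gradVec V y) =
      -∫ y, χ y * ∑ i, ∑ j, (hessMat U y + t • hessMat V y).adjugate i j * hessMat V y i j := by
    intro t
    have := integral_adjugate_hessMat (hUt t) hV2 hχ hχc
    simp only [hH] at this
    rw [this, neg_neg]
  simp only [hinner]
  rw [integral_neg, integral_integral_swap hI2]
  -- Fundamental theorem of calculus in t at a fixed point, with Jacobi's formula as the derivative.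
  have hftc : ∀ y, ∫ t in Ioc (0 : ℝ) 1, χ y * ∑ i, ∑ j,
      (hessMat U y + t • hessMat V y).adjugate i j * hessMat V y i j =
      χ y * (hessMat U y + hessMat V y).det - χ y * (hessMat U y).det := by
    intro y
    rw [integral_const_mul, ← intervalIntegral.integral_of_le zero_le_one,
      intervalIntegral.integral_eq_sub_of_hasDerivAt
        (f := fun t : ℝ => (hessMat U y + t • hessMat V y).det)]
    · simp
      ring
    · intro t _
      refine (hasDerivAt_det_add_smul (hessMat U y) (hessMat V y) t).congr_deriv ?_
      rw [Finset.sum_comm]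
      refine Finset.sum_congr rfl fun i _ => Finset.sum_congr rfl fun j _ => ?_
      rw [(isSymm_hessMat (U := V) hV2.contDiffAt).apply]
    · exact (hDcont.comp (continuous_id.prodMk continuous_const)).intervalIntegrable 0 1
  simp only [hftc]
  have hdet : ∀ {H : E n → Matrix (Fin (n + 1)) (Fin (n + 1)) ℝ}, Continuous H →
      Integrable fun y => χ y * (H y).det := fun hH =>
    (hχ.continuous.mul hH.matrix_det).integrable_of_hasCompactSupport hχc.mul_right
  rw [integral_sub (hdet (H := fun y => hessMat U y + hessMat V y)
    ((continuous_hessMat hU2).add (continuous_hessMat hV2)))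
    (hdet (continuous_hessMat hU2))]
  ring

/-! ### Approximation by smooth functions -/

/-- The convolution of `g` with a normalized bump function. -/
def mollify {G : Type*} [NormedAddCommGroup G] [NormedSpace ℝ G] (φ : ContDiffBump (0 : E n))
    (g : E n → G) : E n → G :=
  convolution (φ.normed volume) g (ContinuousLinearMap.lsmul ℝ ℝ) volume

theorem fderiv_mollify {G : Type*} [NormedAddCommGroup G] [NormedSpace ℝ G]
    [CompleteSpace G] (φ : ContDiffBump (0 : E n)) {g : E n → G} (hg : ContDiff ℝ 1 g)
    (hgc : HasCompactSupport g) :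
    fderiv ℝ (mollify φ g) = mollify φ (fderiv ℝ g) := by
  ext1 y
  have hloc : LocallyIntegrable (φ.normed (volume : Measure (E n))) volume :=
    φ.continuous_normed.locallyIntegrable
  rw [mollify, (hgc.hasFDerivAt_convolution_right (ContinuousLinearMap.lsmul ℝ ℝ) hloc hg y).fderiv]
  rfl

/-- Mollification commutes with differentiation, and the compactly supported derivatives are
uniformly continuous. Convergence of the values is left out, since `adjPair` involves only first and
second derivatives. -/
theorem exists_smooth_approx {g : E n → ℝ} (hg : ContDiff ℝ 2 g) (hgc : HasCompactSupport g) :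
    ∃ G : ℕ → E n → ℝ, (∀ m, ContDiff ℝ 3 (G m)) ∧ ∀ ε > 0, ∀ᶠ m in atTop, ∀ y,
      ‖fderiv ℝ (G m) y - fderiv ℝ g y‖ ≤ ε ∧
      ‖fderiv ℝ (fderiv ℝ (G m)) y - fderiv ℝ (fderiv ℝ g) y‖ ≤ ε := by
  let φ : ℕ → ContDiffBump (0 : E n) := fun m =>
    ⟨1 / (2 * ((m : ℝ) + 1)), 1 / ((m : ℝ) + 1), by positivity, by
      have : (0 : ℝ) < (m : ℝ) + 1 := by positivity
      exact one_div_lt_one_div_of_lt this (by linarith)⟩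
  let G : ℕ → E n → ℝ := fun m => mollify (φ m) g
  have hg1 : ContDiff ℝ 1 (fderiv ℝ g) := hg.fderiv_right (by norm_num)
  have hG1 : ∀ m, fderiv ℝ (G m) = mollify (φ m) (fderiv ℝ g) := fun m =>
    fderiv_mollify (φ m) (hg.of_le (by norm_num)) hgc
  have hG2 : ∀ m, fderiv ℝ (fderiv ℝ (G m)) = mollify (φ m) (fderiv ℝ (fderiv ℝ g)) := fun m => by
    rw [hG1, fderiv_mollify (φ m) hg1 (hgc.fderiv ℝ)]
  have hr : Tendsto (fun m => (φ m).rOut) atTop (𝓝 0) := tendsto_one_div_add_atTop_nhds_zero_nat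
  have key : ∀ {W : Type} [NormedAddCommGroup W] [NormedSpace ℝ W] [CompleteSpace W]
      {f : E n → W}, Continuous f → HasCompactSupport f → ∀ ε > 0, ∀ᶠ m in atTop, ∀ y,
      ‖mollify (φ m) f y - f y‖ ≤ ε := by
    intro W _ _ _ f hf hfc ε hε
    obtain ⟨δ, hδ, hδ'⟩ := Metric.uniformContinuous_iff.1
      (hfc.uniformContinuous_of_continuous hf) ε hε
    filter_upwards [hr.eventually_lt_const hδ] with m hm y
    rw [← dist_eq_norm]
    refine (φ m).dist_normed_convolution_le hf.aestronglyMeasurable fun z hz => ?_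
    exact (hδ' ((Metric.mem_ball.1 hz).trans hm)).le
  refine ⟨G, fun m => ?_, fun ε hε => ?_⟩
  · exact ((φ m).hasCompactSupport_normed).contDiff_convolution_left _
      (φ m).contDiff_normed hg.continuous.locallyIntegrable
  · filter_upwards [key hg1.continuous (hgc.fderiv ℝ) ε hε,
      key (hg1.continuous_fderiv (by simp)) ((hgc.fderiv ℝ).fderiv ℝ) ε hε] with m h1 h2 y
    rw [hG2, hG1]
    exact ⟨h1 y, h2 y⟩

end

section

variable {n : ℕ}

/-! ### The variation of the Monge-Ampère functional: functions of class `C²` -/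

theorem exists_adjugate_bound {ι : Type*} [Fintype ι] [DecidableEq ι] (R : ℝ) :
    ∃ C, 0 ≤ C ∧ ∀ H : Matrix ι ι ℝ, (∀ i j, |H i j| ≤ R) → ∀ i j, |H.adjugate i j| ≤ C := by
  have hK : IsCompact (Set.pi univ fun _ : ι => Set.pi univ fun _ : ι => Icc (-R) R) :=
    isCompact_univ_pi fun _ => isCompact_univ_pi fun _ => isCompact_Icc
  have hc : ∀ i j, Continuous fun H : ι → ι → ℝ => (Matrix.of H).adjugate i j := fun i j =>
    (Continuous.matrix_adjugate (A := fun H : ι → ι → ℝ => Matrix.of H)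
      continuous_id).matrix_elem i j
  choose C hC using fun i j => hK.exists_bound_of_continuousOn (hc i j).continuousOn
  refine ⟨∑ i, ∑ j, |C i j|, by positivity, fun H hH i j => ?_⟩
  have h1 : |H.adjugate i j| ≤ C i j :=
    hC i j H (fun i _ j _ => abs_le.1 (hH i j))
  calc |H.adjugate i j| ≤ |C i j| := h1.trans (le_abs_self _)
    _ ≤ ∑ j, |C i j| := Finset.single_le_sum (fun j _ => abs_nonneg (C i j)) (Finset.mem_univ j)
    _ ≤ _ := Finset.single_le_sum (f := fun i => ∑ j, |C i j|)
      (fun i _ => Finset.sum_nonneg fun j _ => abs_nonneg _) (Finset.mem_univ i)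

/-- Dominated convergence: a bound on the entries bounds the adjugate, and the fixed vector p, later
∇χ, supplies integrability. -/
theorem tendsto_integral_adjPair {Z : Type*} [MeasurableSpace Z] {ν : Measure Z}
    {Hm : ℕ → Z → Matrix (Fin (n + 1)) (Fin (n + 1)) ℝ}
    {H : Z → Matrix (Fin (n + 1)) (Fin (n + 1)) ℝ} {qm : ℕ → Z → Fin (n + 1) → ℝ}
    {q p : Z → Fin (n + 1) → ℝ} {R : ℝ}
    (hmeas : ∀ m, AEStronglyMeasurable (fun z => adjPair (Hm m z) (p z) (qm m z)) ν)
    (hH : ∀ z, Tendsto (fun m => Hm m z) atTop (𝓝 (H z)))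
    (hq : ∀ z, Tendsto (fun m => qm m z) atTop (𝓝 (q z)))
    (hbd : ∀ᶠ m in atTop, ∀ᵐ z ∂ν, (∀ i j, |Hm m z i j| ≤ R) ∧ ∀ j, |qm m z j| ≤ R)
    (hp : ∀ i, Integrable (fun z => p z i) ν) :
    Tendsto (fun m => ∫ z, adjPair (Hm m z) (p z) (qm m z) ∂ν) atTop
      (𝓝 (∫ z, adjPair (H z) (p z) (q z) ∂ν)) := by
  obtain ⟨C, hC0, hC⟩ := exists_adjugate_bound (ι := Fin (n + 1)) R
  refine tendsto_integral_filter_of_dominated_convergence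
    (fun z => ∑ i, ∑ _j : Fin (n + 1), C * |p z i| * R) (Eventually.of_forall hmeas) ?_ ?_ ?_
  · filter_upwards [hbd] with m hm
    filter_upwards [hm] with z hz
    rw [adjPair, Real.norm_eq_abs]
    refine (Finset.abs_sum_le_sum_abs _ _).trans (Finset.sum_le_sum fun i _ =>
      (Finset.abs_sum_le_sum_abs _ _).trans (Finset.sum_le_sum fun j _ => ?_))
    rw [abs_mul, abs_mul]
    exact mul_le_mul (mul_le_mul_of_nonneg_right (hC _ hz.1 i j) (abs_nonneg _)) (hz.2 j)
      (abs_nonneg _) (by positivity)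
  · refine integrable_finsetSum _ fun i _ => integrable_finsetSum _ fun j _ => ?_
    exact ((hp i).abs.const_mul C).mul_const R
  · refine Eventually.of_forall fun z => ?_
    refine tendsto_finsetSum _ fun i _ => tendsto_finsetSum _ fun j _ => ?_
    have hadj : Continuous fun M : Matrix (Fin (n + 1)) (Fin (n + 1)) ℝ => M.adjugate i j :=
      continuous_id.matrix_adjugate.matrix_elem i j
    exact (((hadj.tendsto _).comp (hH z)).mul_const _).mul (tendsto_pi_nhds.1 (hq z) j)

theorem norm_stdVec (i : Fin (n + 1)) : ‖(stdVec i : E n)‖ = 1 := by simp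

theorem abs_hessMat_sub_le {U V : E n → ℝ} {y : E n} {ε : ℝ}
    (h : ‖fderiv ℝ (fderiv ℝ U) y - fderiv ℝ (fderiv ℝ V) y‖ ≤ ε) (i j : Fin (n + 1)) :
    |hessMat U y i j - hessMat V y i j| ≤ ε := by
  have h1 := (fderiv ℝ (fderiv ℝ U) y - fderiv ℝ (fderiv ℝ V) y).le_opNorm₂ (stdVec i) (stdVec j)
  rw [norm_stdVec, norm_stdVec, mul_one, mul_one] at h1
  exact h1.trans h

theorem abs_gradVec_sub_le {U V : E n → ℝ} {y : E n} {ε : ℝ}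
    (h : ‖fderiv ℝ U y - fderiv ℝ V y‖ ≤ ε) (i : Fin (n + 1)) :
    |gradVec U y i - gradVec V y i| ≤ ε := by
  have h1 := (fderiv ℝ U y - fderiv ℝ V y).le_opNorm (stdVec i)
  rw [norm_stdVec, mul_one] at h1
  exact h1.trans h

theorem exists_jet_bound {U : E n → ℝ} (hU : ContDiff ℝ 2 U) (hUc : HasCompactSupport U) :
    ∃ R, 0 ≤ R ∧ ∀ y, (∀ i j, |hessMat U y i j| ≤ R) ∧ ∀ j, |gradVec U y j| ≤ R := by
  have h1 : ContDiff ℝ 1 (fderiv ℝ U) := hU.fderiv_right (by norm_num)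
  obtain ⟨C, hC⟩ := h1.continuous.bounded_above_of_compact_support (hUc.fderiv ℝ)
  obtain ⟨D, hD⟩ := (h1.continuous_fderiv (by simp)).bounded_above_of_compact_support
    ((hUc.fderiv ℝ).fderiv ℝ)
  refine ⟨max (max C D) 0, le_max_right _ _, fun y => ⟨fun i j => ?_, fun j => ?_⟩⟩
  · have h2 := (fderiv ℝ (fderiv ℝ U) y).le_opNorm₂ (stdVec i) (stdVec j)
    rw [norm_stdVec, norm_stdVec, mul_one, mul_one] at h2
    exact h2.trans ((hD y).trans ((le_max_right _ _).trans (le_max_left _ _)))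
  · have h2 := (fderiv ℝ U y).le_opNorm (stdVec j)
    rw [norm_stdVec, mul_one] at h2
    exact h2.trans ((hC y).trans ((le_max_left _ _).trans (le_max_left _ _)))

theorem exists_smooth_jet_approx {U : E n → ℝ} (hU : ContDiff ℝ 2 U) (hUc : HasCompactSupport U) :
    ∃ (G : ℕ → E n → ℝ) (R : ℝ), (∀ m, ContDiff ℝ 3 (G m)) ∧
      (∀ y, Tendsto (fun m => hessMat (G m) y) atTop (𝓝 (hessMat U y))) ∧
      (∀ y, Tendsto (fun m => gradVec (G m) y) atTop (𝓝 (gradVec U y))) ∧ 0 ≤ R ∧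
      ∀ᶠ m in atTop, ∀ y, (∀ i j, |hessMat (G m) y i j| ≤ R) ∧ ∀ j, |gradVec (G m) y j| ≤ R := by
  obtain ⟨G, hG, hG'⟩ := exists_smooth_approx hU hUc
  obtain ⟨R, hR, hRb⟩ := exists_jet_bound hU hUc
  refine ⟨G, R + 1, hG, fun y => ?_, fun y => ?_, by positivity, ?_⟩
  · refine tendsto_pi_nhds.2 fun i => tendsto_pi_nhds.2 fun j => Metric.tendsto_nhds.2 ?_
    intro ε hε
    filter_upwards [hG' (ε / 2) (half_pos hε)] with m hm
    rw [Real.dist_eq]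
    exact (abs_hessMat_sub_le (hm y).2 i j).trans_lt (half_lt_self hε)
  · refine tendsto_pi_nhds.2 fun i => Metric.tendsto_nhds.2 ?_
    intro ε hε
    filter_upwards [hG' (ε / 2) (half_pos hε)] with m hm
    rw [Real.dist_eq]
    exact (abs_gradVec_sub_le (hm y).1 i).trans_lt (half_lt_self hε)
  · filter_upwards [hG' 1 one_pos] with m hm y
    refine ⟨fun i j => ?_, fun j => ?_⟩
    · have h1 := abs_hessMat_sub_le (hm y).2 i j
      have h2 := (hRb y).1 i j
      have h3 := abs_sub_abs_le_abs_sub (hessMat (G m) y i j) (hessMat U y i j)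
      linarith
    · have h1 := abs_gradVec_sub_le (hm y).1 j
      have h2 := (hRb y).2 j
      have h3 := abs_sub_abs_le_abs_sub (gradVec (G m) y j) (gradVec U y j)
      linarith

/-- No third derivative occurs in the identity, so it passes to the limit along mollifications of U
and V. -/
theorem integral_adjPair_variation {U V χ : E n → ℝ} (hU : ContDiff ℝ 2 U)
    (hUc : HasCompactSupport U) (hV : ContDiff ℝ 2 V) (hVc : HasCompactSupport V)
    (hχ : ContDiff ℝ 1 χ) (hχc : HasCompactSupport χ) :
    (∫ y, adjPair (hessMat U y + hessMat V y) (gradVec χ y) (gradVec U y + gradVec V y)) -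
      ∫ y, adjPair (hessMat U y) (gradVec χ y) (gradVec U y) =
    (n + 1) * ∫ z : ℝ × E n,
      adjPair (hessMat U z.2 + z.1 • hessMat V z.2) (gradVec χ z.2) (gradVec V z.2)
        ∂((volume.restrict (Ioc (0 : ℝ) 1)).prod volume) := by
  obtain ⟨G, R, hG, hGH, hGg, hR, hGR⟩ := exists_smooth_jet_approx hU hUc
  obtain ⟨K, S, hK, hKH, hKg, hS, hKS⟩ := exists_smooth_jet_approx hV hVc
  have h2 : ∀ {W : E n → ℝ}, ContDiff ℝ 3 W → ContDiff ℝ 2 W := fun h => h.of_le (by norm_num)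
  have h1 : ∀ {W : E n → ℝ}, ContDiff ℝ 3 W → ContDiff ℝ 1 W := fun h => h.of_le (by norm_num)
  have hgχ := continuous_gradVec hχ
  have hχ0 : ∀ y ∉ tsupport χ, gradVec χ y = 0 := by
    intro y hy
    ext i
    have : fderiv ℝ χ y = 0 := image_eq_zero_of_notMem_tsupport
      fun h => hy (tsupport_fderiv_subset ℝ h)
    simp [gradVec, this]
  have hpi : ∀ i, Integrable (fun y => gradVec χ y i) := fun i =>
    ((continuous_apply i).comp hgχ).integrable_of_hasCompactSupport
      (hχc.fderiv_apply (𝕜 := ℝ) (stdVec i))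
  have hpi' : ∀ i, Integrable (fun z : ℝ × E n => gradVec χ z.2 i)
      ((volume.restrict (Ioc (0 : ℝ) 1)).prod volume) := fun i =>
    integrable_prod_of_continuous ((continuous_apply i).comp (hgχ.comp continuous_snd)) hχc
      fun t y hy => by simp [hχ0 y hy]
  have habs : ∀ {a b : ℝ}, |a| ≤ R → |b| ≤ S → |a + b| ≤ R + S := fun ha hb =>
    (abs_add_le _ _).trans (add_le_add ha hb)
  have hA : Tendsto (fun m => ∫ y, adjPair (hessMat (G m) y + hessMat (K m) y) (gradVec χ y)
      (gradVec (G m) y + gradVec (K m) y)) atTop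
      (𝓝 (∫ y, adjPair (hessMat U y + hessMat V y) (gradVec χ y)
        (gradVec U y + gradVec V y))) := by
    refine tendsto_integral_adjPair (R := R + S) (fun m => ?_) (fun y => (hGH y).add (hKH y))
      (fun y => (hGg y).add (hKg y)) ?_ hpi
    · exact (continuous_adjPair ((continuous_hessMat (h2 (hG m))).add
        (continuous_hessMat (h2 (hK m)))) hgχ ((continuous_gradVec (h1 (hG m))).add
        (continuous_gradVec (h1 (hK m))))).aestronglyMeasurable
    · filter_upwards [hGR, hKS] with m hm hm'
      exact Eventually.of_forall fun y => ⟨fun i j => habs ((hm y).1 i j) ((hm' y).1 i j),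
        fun j => habs ((hm y).2 j) ((hm' y).2 j)⟩
  have hB : Tendsto (fun m => ∫ y, adjPair (hessMat (G m) y) (gradVec χ y) (gradVec (G m) y)) atTop
      (𝓝 (∫ y, adjPair (hessMat U y) (gradVec χ y) (gradVec U y))) := by
    refine tendsto_integral_adjPair (R := R) (fun m => ?_) hGH hGg ?_ hpi
    · exact (continuous_adjPair (continuous_hessMat (h2 (hG m))) hgχ
        (continuous_gradVec (h1 (hG m)))).aestronglyMeasurable
    · filter_upwards [hGR] with m hm
      exact Eventually.of_forall hm
  have hC : Tendsto (fun m => ∫ z : ℝ × E n,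
      adjPair (hessMat (G m) z.2 + z.1 • hessMat (K m) z.2) (gradVec χ z.2) (gradVec (K m) z.2)
        ∂((volume.restrict (Ioc (0 : ℝ) 1)).prod volume)) atTop (𝓝 (∫ z : ℝ × E n,
      adjPair (hessMat U z.2 + z.1 • hessMat V z.2) (gradVec χ z.2) (gradVec V z.2)
        ∂((volume.restrict (Ioc (0 : ℝ) 1)).prod volume))) := by
    refine tendsto_integral_adjPair (R := R + S) (fun m => ?_)
      (fun z => (hGH z.2).add ((hKH z.2).const_smul z.1)) (fun z => hKg z.2) ?_ hpi'
    · exact (continuous_adjPair (((continuous_hessMat (h2 (hG m))).comp continuous_snd).add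
        (continuous_fst.smul ((continuous_hessMat (h2 (hK m))).comp continuous_snd)))
        (hgχ.comp continuous_snd)
        ((continuous_gradVec (h1 (hK m))).comp continuous_snd)).aestronglyMeasurable
    · have hae : ∀ᵐ z ∂((volume.restrict (Ioc (0 : ℝ) 1)).prod (volume : Measure (E n))),
          z.1 ∈ Ioc (0 : ℝ) 1 :=
        Measure.quasiMeasurePreserving_fst.ae (ae_restrict_mem measurableSet_Ioc)
      filter_upwards [hGR, hKS] with m hm hm'
      filter_upwards [hae] with z hz
      refine ⟨fun i j => habs ((hm z.2).1 i j) ?_, fun j => ((hm' z.2).2 j).trans (by linarith)⟩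
      rw [Matrix.smul_apply, smul_eq_mul, abs_mul, abs_of_pos hz.1]
      calc z.1 * |hessMat (K m) z.2 i j| ≤ 1 * |hessMat (K m) z.2 i j| :=
            mul_le_mul_of_nonneg_right hz.2 (abs_nonneg _)
        _ ≤ S := by rw [one_mul]; exact (hm' z.2).1 i j
  refine tendsto_nhds_unique (hA.sub hB) ?_
  simp only [fun m => integral_adjPair_variation_smooth (hG m) (hK m) hχ hχc]
  exact hC.const_mul _

end

section

variable {n : ℕ}

/-! ### Derivatives of homogeneous functions -/

theorem fderiv_smul_of_homogeneous {U : E n → ℝ} (hU : ∀ t : ℝ, 0 < t → ∀ y, U (t • y) = t * U y)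
    {t : ℝ} (ht : 0 < t) (y : E n) : fderiv ℝ U (t • y) = fderiv ℝ U y := by
  have h1 : (fun y => U (t • y)) = t • U := by
    ext z; exact hU t ht z
  have h2 := fderiv_comp_smul (𝕜 := ℝ) (f := U) (x := y) t
  rw [h1, fderiv_const_smul_field] at h2
  exact (smul_right_injective _ ht.ne' h2).symm

theorem fderiv_fderiv_smul_of_homogeneous {U : E n → ℝ}
    (hU : ∀ t : ℝ, 0 < t → ∀ y, U (t • y) = t * U y) {t : ℝ} (ht : 0 < t) (y : E n) :
    fderiv ℝ (fderiv ℝ U) (t • y) = t⁻¹ • fderiv ℝ (fderiv ℝ U) y := by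
  have h1 : (fun y => fderiv ℝ U (t • y)) = fderiv ℝ U := by
    ext1 z; exact fderiv_smul_of_homogeneous hU ht z
  have h2 := fderiv_comp_smul (𝕜 := ℝ) (f := fderiv ℝ U) (x := y) t
  rw [h1] at h2
  rw [h2, smul_smul, inv_mul_cancel₀ ht.ne', one_smul]

theorem fderiv_apply_self_of_homogeneous {U : E n → ℝ}
    (hU : ∀ t : ℝ, 0 < t → ∀ y, U (t • y) = t * U y) {y : E n} (hd : DifferentiableAt ℝ U y) :
    fderiv ℝ U y y = U y := by
  have h1 : HasDerivAt (fun t : ℝ => t • y) y 1 := by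
    simpa using (hasDerivAt_id (1 : ℝ)).smul_const y
  have h2 : HasDerivAt (fun t : ℝ => U (t • y)) (fderiv ℝ U y y) 1 := by
    refine HasFDerivAt.comp_hasDerivAt (f := fun t : ℝ => t • y) 1 ?_ h1
    simpa using hd.hasFDerivAt
  have h3 : HasDerivAt (fun t : ℝ => t * U y) (U y) 1 := by
    simpa using (hasDerivAt_id (1 : ℝ)).mul_const (U y)
  refine h2.unique (h3.congr_of_eventuallyEq ?_)
  filter_upwards [lt_mem_nhds (zero_lt_one (α := ℝ))] with t ht using hU t ht y

/-- The gradient is constant along rays. Thus the Hessian is degenerate in the radial direction, as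
the adjugate lemma `sum_adjugate_mul_mul` requires. -/
theorem fderiv_fderiv_apply_self_of_homogeneous {U : E n → ℝ}
    (hU : ∀ t : ℝ, 0 < t → ∀ y, U (t • y) = t * U y) {y : E n} (hd : ContDiffAt ℝ 2 U y) :
    fderiv ℝ (fderiv ℝ U) y y = 0 := by
  have hd1 : DifferentiableAt ℝ (fderiv ℝ U) y :=
    (hd.fderiv_right (m := 1) (by norm_num)).differentiableAt (by simp)
  have h1 : HasDerivAt (fun t : ℝ => t • y) y 1 := by
    simpa using (hasDerivAt_id (1 : ℝ)).smul_const y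
  have h2 : HasDerivAt (fun t : ℝ => fderiv ℝ U (t • y)) (fderiv ℝ (fderiv ℝ U) y y) 1 := by
    refine HasFDerivAt.comp_hasDerivAt (f := fun t : ℝ => t • y) 1 ?_ h1
    simpa using hd1.hasFDerivAt
  refine h2.unique ((hasDerivAt_const (1 : ℝ) (fderiv ℝ U y)).congr_of_eventuallyEq ?_)
  filter_upwards [lt_mem_nhds (zero_lt_one (α := ℝ))] with t ht
    using fderiv_smul_of_homogeneous hU ht y

/-! ### The determinant of `D²u + u I` -/

/-- The determinant of `D²u + u I` at the unit vector `x`, the product of the principal radii. -/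
def radiiDet (u : E n → ℝ) (x : E n) : ℝ := (formMatrix (frame x) (radiiBilin u x)).det

theorem radiiDet_eq {u : E n → ℝ} (hu : SphereContDiff 2 u) {x : E n} (hx : ‖x‖ = 1) :
    radiiDet u x = (formMatrix (frame x) (fderiv ℝ (fderiv ℝ (homExt u)) x)).det := by
  rw [radiiDet]
  congr 1
  ext i j
  have hb := isTangentFrame_frame hx
  rw [formMatrix_apply, formMatrix_apply, radiiBilin_eq_homExt hu hx (hb.inner_eq i)
    (hb.inner_eq j)]

theorem homExt_fderiv_fderiv_apply_right {u : E n → ℝ} (hu : SphereContDiff 2 u) {x : E n}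
    (hx : x ≠ 0) (v : E n) : fderiv ℝ (fderiv ℝ (homExt u)) x v x = 0 := by
  have h := contDiffAt_homExt hu hx
  rw [fderiv_fderiv_symm h,
    fderiv_fderiv_apply_self_of_homogeneous (fun t ht y => homExt_smul ht y) h]
  rfl

/-- The adjugate of the degenerate Hessian sends x to `radiiDet u x` times x, and Euler's relation
gives ⟪∇V, x⟫ = v(x). -/
theorem adjPair_homExt_of_norm_eq_one {u v : E n → ℝ} (hu : SphereContDiff 2 u)
    (hv : SphereContDiff 1 v) {x : E n} (hx : ‖x‖ = 1) :
    adjPair (hessMat (homExt u) x) x (gradVec (homExt v) x) = v x * radiiDet u x := by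
  have hx0 := ne_zero_of_norm_eq_one hx
  rw [adjPair_comm (isSymm_hessMat (contDiffAt_homExt hu hx0)), radiiDet_eq hu hx]
  have h := sum_adjugate_mul_mul (isTangentFrame_frame hx)
    (B := fderiv ℝ (fderiv ℝ (homExt u)) x)
    (homExt_fderiv_fderiv_apply_right hu hx0) (WithLp.toLp 2 (gradVec (homExt v) x))
  refine h.trans ?_
  congr 1
  rw [← homExt_of_norm_eq_one (u := v) hx, ← fderiv_apply_self_of_homogeneous
    (fun t ht y => homExt_smul ht y) ((contDiffAt_homExt hv hx0).differentiableAt (by simp))]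
  have hs : ∀ T : E n →L[ℝ] ℝ, T x = ∑ i, x i * T (stdVec i) := fun T => by
    conv_lhs => rw [← (EuclideanSpace.basisFun (Fin (n + 1)) ℝ).sum_repr x, map_sum]
    simp
  rw [hs]
  simp [PiLp.inner_apply, gradVec, mul_comm]

/-- The powers of ‖y‖ count degrees of homogeneity: the Hessian has degree -1, so its adjugate of
size n+1 has degree -n, while y has degree 1 and the gradient degree 0. -/
theorem adjPair_homExt {u v : E n → ℝ} (hu : SphereContDiff 2 u)
    (hv : SphereContDiff 1 v) {y : E n} (hy : y ≠ 0) :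
    adjPair (hessMat (homExt u) y) y (gradVec (homExt v) y) =
      ‖y‖ * ‖y‖⁻¹ ^ n * (v (‖y‖⁻¹ • y) * radiiDet u (‖y‖⁻¹ • y)) := by
  have h0 : 0 < ‖y‖ := norm_pos_iff.2 hy
  have hx : ‖‖y‖⁻¹ • y‖ = 1 := by
    rw [norm_smul, norm_inv, norm_norm, inv_mul_cancel₀ h0.ne']
  rw [← adjPair_homExt_of_norm_eq_one hu hv hx]
  set x := ‖y‖⁻¹ • y with hxd
  have hyx : y = ‖y‖ • x := by rw [hxd, smul_smul, mul_inv_cancel₀ h0.ne', one_smul]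
  have hg : gradVec (homExt v) y = gradVec (homExt v) x := by
    ext i
    rw [gradVec, hyx, fderiv_smul_of_homogeneous (fun t ht y => homExt_smul ht y) h0]
    rfl
  have hH : hessMat (homExt u) y = ‖y‖⁻¹ • hessMat (homExt u) x := by
    ext i j
    rw [hessMat_apply, hyx,
      fderiv_fderiv_smul_of_homogeneous (fun t ht y => homExt_smul ht y) h0, ← hyx]
    rfl
  rw [hg, hH]
  simp only [adjPair, Matrix.adjugate_smul, Fintype.card_fin, Nat.add_sub_cancel,
    Matrix.smul_apply, smul_eq_mul, Finset.mul_sum]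
  refine Finset.sum_congr rfl fun i _ => Finset.sum_congr rfl fun j _ => ?_
  have : y i = ‖y‖ * x i := by conv_lhs => rw [hyx]; simp
  rw [this]; ring

/-- An expression for the determinant that avoids `frame`, which is not chosen continuously in x. -/
theorem radiiDet_eq_adjPair {u : E n → ℝ} (hu : SphereContDiff 2 u) {x : E n} (hx : ‖x‖ = 1) :
    radiiDet u x = adjPair (hessMat (homExt u) x) x x := by
  have h := sum_adjugate_mul_mul (isTangentFrame_frame hx)
    (B := fderiv ℝ (fderiv ℝ (homExt u)) x)
    (homExt_fderiv_fderiv_apply_right hu (ne_zero_of_norm_eq_one hx)) x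
  rw [radiiDet_eq hu hx]
  refine Eq.trans ?_ h.symm
  rw [real_inner_self_eq_norm_sq, hx]; simp

/-! ### Polar coordinates -/

theorem integral_norm_mul_normalize (m : ℝ → ℝ) (h : E n → ℝ) :
    ∫ y : E n, m ‖y‖ * h (‖y‖⁻¹ • y) =
      (∫ r in Ioi (0 : ℝ), r ^ n * m r) * sphereIntegral h := by
  have hdim : Module.finrank ℝ (E n) - 1 = n := by simp
  calc ∫ y : E n, m ‖y‖ * h (‖y‖⁻¹ • y)
      = ∫ y : ({(0 : E n)}ᶜ : Set (E n)), m ‖y.1‖ * h (‖y.1‖⁻¹ • y.1) ∂((volume : Measure (E n)).comap Subtype.val) := by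
        rw [integral_subtype_comap (measurableSet_singleton _).compl
          fun y : E n ↦ m ‖y‖ * h (‖y‖⁻¹ • y), restrict_compl_singleton]
    _ = ∫ z : Metric.sphere (0 : E n) 1 × Ioi (0 : ℝ), h z.1 * m z.2
          ∂(volume : Measure (E n)).toSphere.prod (.volumeIoiPow (Module.finrank ℝ (E n) - 1)) := by
        have := (volume : Measure (E n)).measurePreserving_homeomorphUnitSphereProd.integral_comp
          (Homeomorph.measurableEmbedding _)
          (fun z : Metric.sphere (0 : E n) 1 × Ioi (0 : ℝ) => h z.1 * m z.2)
        rw [← this]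
        refine integral_congr_ae (Eventually.of_forall fun y => ?_)
        simp [mul_comm]
    _ = sphereIntegral h * ∫ r : Ioi (0 : ℝ), m r ∂.volumeIoiPow (Module.finrank ℝ (E n) - 1) :=
        integral_prod_mul (fun x : Metric.sphere (0 : E n) 1 => h x) fun r : Ioi (0 : ℝ) => m r
    _ = _ := by
      rw [mul_comm, hdim]
      congr 1
      simp only [Measure.volumeIoiPow, ENNReal.ofReal]
      rw [integral_withDensity_eq_integral_smul,
        integral_subtype_comap measurableSet_Ioi fun a ↦ Real.toNNReal (a ^ n) • m a,
        setIntegral_congr_fun measurableSet_Ioi fun x hx ↦ ?_]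
      · rw [NNReal.smul_def, Real.coe_toNNReal _ (pow_nonneg hx.out.le _), smul_eq_mul]
      · exact (measurable_subtype_coe.pow_const _).real_toNNReal

end

section

variable {n : ℕ}

/-! ### The variation of the Monge-Ampère functional on the sphere -/

/-- A smooth function with compact support that vanishes near the origin and is equal to `1` near
`1 ≤ ‖y‖² ≤ 2`. -/
def annulusBump (y : E n) : ℝ :=
  Real.smoothTransition (4 * ‖y‖ ^ 2 - 1) * Real.smoothTransition (4 - ‖y‖ ^ 2)

/-- A smooth function that is equal to `1` for `‖y‖² ≤ 1` and vanishes for `2 ≤ ‖y‖²`. -/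
def ballBump (y : E n) : ℝ := Real.smoothTransition (2 - ‖y‖ ^ 2)

theorem contDiff_annulusBump {r : ℕ∞} : ContDiff ℝ r (annulusBump (n := n)) :=
  (Real.smoothTransition.contDiff.comp ((contDiff_const.mul (contDiff_norm_sq ℝ)).sub
    contDiff_const)).mul
    (Real.smoothTransition.contDiff.comp (contDiff_const.sub (contDiff_norm_sq ℝ)))

theorem contDiff_ballBump {r : ℕ∞} : ContDiff ℝ r (ballBump (n := n)) :=
  Real.smoothTransition.contDiff.comp (contDiff_const.sub (contDiff_norm_sq ℝ))

theorem hasCompactSupport_annulusBump : HasCompactSupport (annulusBump (n := n)) := by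
  refine HasCompactSupport.intro (isCompact_closedBall (0 : E n) 2) fun y hy => ?_
  rw [mem_closedBall_zero_iff, not_le] at hy
  rw [annulusBump, Real.smoothTransition.zero_of_nonpos (x := 4 - ‖y‖ ^ 2) (by nlinarith), mul_zero]

theorem hasCompactSupport_ballBump : HasCompactSupport (ballBump (n := n)) := by
  refine HasCompactSupport.intro (isCompact_closedBall (0 : E n) 2) fun y hy => ?_
  rw [mem_closedBall_zero_iff, not_le] at hy
  rw [ballBump, Real.smoothTransition.zero_of_nonpos (by nlinarith)]

theorem annulusBump_eventually_zero : annulusBump (n := n) =ᶠ[𝓝 0] 0 := by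
  have h : ∀ᶠ y : E n in 𝓝 0, 4 * ‖y‖ ^ 2 - 1 < 0 :=
    (Continuous.tendsto (by fun_prop) 0).eventually_lt_const (by norm_num)
  filter_upwards [h] with y hy
  simp [annulusBump, Real.smoothTransition.zero_of_nonpos hy.le]

theorem annulusBump_eventually_one {y : E n} (h1 : 1 ≤ ‖y‖ ^ 2) (h2 : ‖y‖ ^ 2 ≤ 2) :
    annulusBump =ᶠ[𝓝 y] 1 := by
  have h : ∀ᶠ z : E n in 𝓝 y, 1 < 4 * ‖z‖ ^ 2 - 1 :=
    (Continuous.tendsto (by fun_prop) y).eventually_const_lt (by nlinarith)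
  have h3 : ∀ᶠ z : E n in 𝓝 y, 1 < 4 - ‖z‖ ^ 2 :=
    (Continuous.tendsto (by fun_prop) y).eventually_const_lt (by nlinarith)
  filter_upwards [h, h3] with z hz hw
  simp [annulusBump, Real.smoothTransition.one_of_one_le hz.le,
    Real.smoothTransition.one_of_one_le hw.le]

/-- The homogeneous extension, cut off away from the annulus. -/
def cutExt (u : E n → ℝ) (y : E n) : ℝ := annulusBump y * homExt u y

theorem contDiff_cutExt {u : E n → ℝ} {r : ℕ∞} (hu : SphereContDiff r u) :
    ContDiff ℝ r (cutExt u) := by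
  rw [contDiff_iff_contDiffAt]
  intro y
  by_cases hy : y = 0
  · subst hy
    refine (contDiffAt_const (c := (0 : ℝ))).congr_of_eventuallyEq ?_
    filter_upwards [annulusBump_eventually_zero] with z hz
    simp [cutExt, hz]
  · exact contDiff_annulusBump.contDiffAt.mul (contDiffAt_homExt hu hy)

theorem hasCompactSupport_cutExt {u : E n → ℝ} : HasCompactSupport (cutExt u) :=
  hasCompactSupport_annulusBump.mul_right

theorem cutExt_add_smul (u v : E n → ℝ) (t : ℝ) : cutExt (u + t • v) = cutExt u + t • cutExt v := by
  ext y
  simp only [cutExt, homExt, radialExt, Pi.add_apply, Pi.smul_apply, smul_eq_mul]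
  ring

theorem cutExt_eventuallyEq {u : E n → ℝ} {y : E n} (h1 : 1 ≤ ‖y‖ ^ 2) (h2 : ‖y‖ ^ 2 ≤ 2) :
    cutExt u =ᶠ[𝓝 y] homExt u := by
  filter_upwards [annulusBump_eventually_one h1 h2] with z hz
  simp [cutExt, hz]

/-- The radial profile of the gradient of `ballBump`. -/
def ballProfile (r : ℝ) : ℝ := -2 * deriv Real.smoothTransition (2 - r ^ 2)

theorem deriv_smoothTransition_of_neg {s : ℝ} (hs : s < 0) : deriv Real.smoothTransition s = 0 := by
  have : Real.smoothTransition =ᶠ[𝓝 s] fun _ => 0 := by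
    filter_upwards [gt_mem_nhds hs] with r hr using Real.smoothTransition.zero_of_nonpos hr.le
  rw [this.deriv_eq]; simp

theorem deriv_smoothTransition_of_gt {s : ℝ} (hs : 1 < s) : deriv Real.smoothTransition s = 0 := by
  have : Real.smoothTransition =ᶠ[𝓝 s] fun _ => 1 := by
    filter_upwards [lt_mem_nhds hs] with r hr using Real.smoothTransition.one_of_one_le hr.le
  rw [this.deriv_eq]; simp

theorem hasDerivAt_smoothTransition (s : ℝ) :
    HasDerivAt Real.smoothTransition (deriv Real.smoothTransition s) s :=
  (Real.smoothTransition.contDiff (n := 1)).contDiffAt.differentiableAt (by simp) |>.hasDerivAt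

theorem ballProfile_eq_zero {r : ℝ} (h : ¬(1 ≤ r ^ 2 ∧ r ^ 2 ≤ 2)) : ballProfile r = 0 := by
  rw [ballProfile]
  by_cases h1 : r ^ 2 < 1
  · rw [deriv_smoothTransition_of_gt (by linarith), mul_zero]
  · rw [deriv_smoothTransition_of_neg, mul_zero]
    have : 2 < r ^ 2 := by
      by_contra hh
      exact h ⟨not_lt.1 h1, not_lt.1 hh⟩
    linarith

theorem gradVec_ballBump (y : E n) : gradVec ballBump y = ballProfile ‖y‖ • (y : Fin (n + 1) → ℝ) := by
  ext i
  have h : HasFDerivAt (ballBump (n := n)) (deriv Real.smoothTransition (2 - ‖y‖ ^ 2) •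
      (-(2 • innerSL ℝ y) : E n →L[ℝ] ℝ)) y := by
    refine (hasDerivAt_smoothTransition _).comp_hasFDerivAt y ?_
    exact (hasStrictFDerivAt_norm_sq y).hasFDerivAt.const_sub 2
  rw [gradVec, h.fderiv]
  have hi : ⟪y, stdVec i⟫ = y i := by
    rw [real_inner_comm, EuclideanSpace.inner_single_left]; simp
  simp [ballProfile, hi]
  ring

/-- The gradient of `ballBump` is radial and lives on 1 ≤ ‖y‖² ≤ 2, where `cutExt` agrees with the
homogeneous extension. The integrand thus splits into a radial factor and a function on the sphere.
-/
theorem adjPair_cutExt {u v : E n → ℝ} (hu : SphereContDiff 2 u) (hv : SphereContDiff 1 v)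
    (y : E n) :
    adjPair (hessMat (cutExt u) y) (gradVec ballBump y) (gradVec (cutExt v) y) =
      (ballProfile ‖y‖ * (‖y‖ * ‖y‖⁻¹ ^ n)) *
        (v (‖y‖⁻¹ • y) * radiiDet u (‖y‖⁻¹ • y)) := by
  rw [gradVec_ballBump]
  by_cases h : 1 ≤ ‖y‖ ^ 2 ∧ ‖y‖ ^ 2 ≤ 2
  · have hy : y ≠ 0 := by
      rintro rfl
      norm_num at h
    have hH : hessMat (cutExt u) y = hessMat (homExt u) y := by
      ext i j
      rw [hessMat_apply, hessMat_apply, (cutExt_eventuallyEq h.1 h.2).fderiv.fderiv_eq]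
    have hg : gradVec (cutExt v) y = gradVec (homExt v) y := by
      ext i
      rw [gradVec, gradVec, (cutExt_eventuallyEq h.1 h.2).fderiv_eq]
    rw [hH, hg, mul_assoc, ← adjPair_homExt hu hv hy]
    simp only [adjPair, Finset.mul_sum, Pi.smul_apply, smul_eq_mul]
    exact Finset.sum_congr rfl fun i _ => Finset.sum_congr rfl fun j _ => by ring
  · rw [ballProfile_eq_zero h]
    simp [adjPair]

/-- The Jacobian r^n cancels the degree -n of the adjugate. What is left is the derivative of a
cutoff that falls from 1 to 0. -/
theorem integral_ballProfile :
    ∫ r in Ioi (0 : ℝ), r ^ n * (ballProfile r * (r * r⁻¹ ^ n)) = -1 := by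
  have h1 : ∀ r ∈ Ioi (0 : ℝ), r ^ n * (ballProfile r * (r * r⁻¹ ^ n)) =
      deriv Real.smoothTransition (2 - r ^ 2) * (-(2 * r)) := by
    intro r hr
    have hr' : (0 : ℝ) < r := hr
    rw [ballProfile, inv_pow]
    field_simp
  rw [setIntegral_congr_fun measurableSet_Ioi h1]
  have hder : ∀ r : ℝ, HasDerivAt (fun r : ℝ => Real.smoothTransition (2 - r ^ 2))
      (deriv Real.smoothTransition (2 - r ^ 2) * (-(2 * r))) r := fun r => by
    refine (hasDerivAt_smoothTransition _).comp r ?_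
    simpa using (hasDerivAt_pow 2 r).const_sub 2
  rw [integral_Ioi_of_hasDerivAt_of_nonpos (g := fun r : ℝ => Real.smoothTransition (2 - r ^ 2))
    (l := 0) (hder 0).continuousAt.continuousWithinAt (fun r _ => hder r)]
  · norm_num [Real.smoothTransition.one_of_one_le]
  · intro r hr
    refine mul_nonpos_of_nonneg_of_nonpos ?_ (by simpa using (le_of_lt hr))
    exact Real.smoothTransition.monotone.deriv_nonneg
  · refine tendsto_const_nhds.congr' ?_
    filter_upwards [eventually_ge_atTop 2] with r hr
    rw [Real.smoothTransition.zero_of_nonpos (by nlinarith)]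

theorem integral_adjPair_cutExt {u v : E n → ℝ} (hu : SphereContDiff 2 u)
    (hv : SphereContDiff 1 v) :
    ∫ y, adjPair (hessMat (cutExt u) y) (gradVec ballBump y) (gradVec (cutExt v) y) =
      -sphereIntegral fun x => v x * radiiDet u x := by
  simp_rw [adjPair_cutExt hu hv]
  rw [integral_norm_mul_normalize (fun r => ballProfile r * (r * r⁻¹ ^ n))
    fun x => v x * radiiDet u x, integral_ballProfile, neg_one_mul]

theorem SphereContDiff.add_smul {r : WithTop ℕ∞} {u v : E n → ℝ} (hu : SphereContDiff r u)
    (hv : SphereContDiff r v) (t : ℝ) : SphereContDiff r (u + t • v) :=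
  hu.add (hv.const_smul t)

/-- The variation of the functional `∫ u det (D²u + u I)`. -/
theorem sphereIntegral_mul_radiiDet_sub {u v : E n → ℝ} (hu : SphereContDiff 2 u)
    (hv : SphereContDiff 2 v) :
    (sphereIntegral fun x => (u + v) x * radiiDet (u + v) x) -
        (sphereIntegral fun x => u x * radiiDet u x) =
      (n + 1) * ∫ t in Ioc (0 : ℝ) 1, sphereIntegral fun x => v x * radiiDet (u + t • v) x := by
  have hu' : SphereContDiff ((2 : ℕ∞) : WithTop ℕ∞) u := hu
  have hv' : SphereContDiff ((2 : ℕ∞) : WithTop ℕ∞) v := hv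
  have hU := contDiff_cutExt hu'
  have hV := contDiff_cutExt hv'
  have h12 : ∀ {w : E n → ℝ}, SphereContDiff 2 w → SphereContDiff 1 w :=
    fun h => ContDiffOn.of_le h (by norm_num)
  have hkey := integral_adjPair_variation (U := cutExt u) (V := cutExt v)
    (χ := ballBump) hU hasCompactSupport_cutExt hV hasCompactSupport_cutExt
    (contDiff_ballBump (r := 1)) hasCompactSupport_ballBump
  have hHt : ∀ (t : ℝ) y, hessMat (cutExt u) y + t • hessMat (cutExt v) y =
      hessMat (cutExt (u + t • v)) y := fun t y => by
    rw [cutExt_add_smul, hessMat_add_smul hU.contDiffAt hV.contDiffAt]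
  have hH1 : ∀ y, hessMat (cutExt u) y + hessMat (cutExt v) y =
      hessMat (cutExt (u + v)) y := fun y => by simpa using hHt 1 y
  have hg1 : ∀ y, gradVec (cutExt u) y + gradVec (cutExt v) y =
      gradVec (cutExt (u + v)) y := fun y => by
    have := gradVec_add_smul (hU.differentiable (by simp) y) (hV.differentiable (by simp) y) 1
    rw [← cutExt_add_smul] at this
    simpa using this.symm
  rw [integral_prod] at hkey
  · simp_rw [hHt, hH1, hg1] at hkey
    rw [integral_adjPair_cutExt (hu.add hv) (h12 (hu.add hv)),
      integral_adjPair_cutExt hu (h12 hu)] at hkey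
    simp_rw [fun t : ℝ => integral_adjPair_cutExt (hu.add_smul hv t) (h12 hv)] at hkey
    rw [integral_neg] at hkey
    linarith
  · refine integrable_prod_of_continuous (K := Metric.closedBall 0 2) ?_
      (isCompact_closedBall _ _) ?_
    · refine continuous_adjPair ?_ ?_ ?_
      · exact ((continuous_hessMat hU).comp continuous_snd).add
          (continuous_fst.smul ((continuous_hessMat hV).comp continuous_snd))
      · exact (continuous_gradVec contDiff_ballBump).comp continuous_snd
      · exact (continuous_gradVec (hV.of_le (by norm_num))).comp continuous_snd
    · intro t y hy
      rw [mem_closedBall_zero_iff, not_le] at hy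
      dsimp only
      rw [gradVec_ballBump, ballProfile_eq_zero]
      · simp [adjPair]
      · rintro ⟨_, h⟩
        nlinarith

/-! ### Continuity of the determinant -/

/-- The formula through `adjPair` does not mention the frame and is polynomial in t and the
Hessians. -/
theorem continuous_radiiDet {u v : E n → ℝ} (hu : SphereContDiff 2 u)
    (hv : SphereContDiff 2 v) :
    Continuous fun p : ℝ × Metric.sphere (0 : E n) 1 => radiiDet (u + p.1 • v) p.2 := by
  have hU := contDiff_cutExt (r := 2) hu
  have hV := contDiff_cutExt (r := 2) hv
  have h : ∀ p : ℝ × Metric.sphere (0 : E n) 1, radiiDet (u + p.1 • v) p.2 =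
      adjPair (hessMat (cutExt u) p.2 + p.1 • hessMat (cutExt v) p.2) p.2.1 p.2.1 := by
    intro p
    have hx : ‖(p.2 : E n)‖ = 1 := by simp
    rw [radiiDet_eq_adjPair (hu.add_smul hv p.1) hx,
      ← hessMat_add_smul hU.contDiffAt hV.contDiffAt, ← cutExt_add_smul]
    congr 1
    ext i j
    rw [hessMat_apply, hessMat_apply,
      (cutExt_eventuallyEq (by simp) (by simp)).fderiv.fderiv_eq]
  simp_rw [h]
  refine continuous_adjPair ?_ ?_ ?_
  · exact ((continuous_hessMat hU).comp (continuous_subtype_val.comp continuous_snd)).add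
      (continuous_fst.smul ((continuous_hessMat hV).comp (continuous_subtype_val.comp continuous_snd)))
  all_goals
    exact (PiLp.continuous_ofLp 2 _).comp (continuous_subtype_val.comp continuous_snd)

end

/-! ### The quermassintegral as a functional of C² functions with positive radii. -/

section

variable {n : ℕ}

/-! ### Positivity of the principal radii -/

theorem radiiBilin_eq_cutExt {u : E n → ℝ} (hu : SphereContDiff 2 u) {x : E n} (hx : ‖x‖ = 1)
    {v w : E n} (hv : ⟪x, v⟫ = 0) (hw : ⟪x, w⟫ = 0) :
    radiiBilin u x v w = fderiv ℝ (fderiv ℝ (cutExt u)) x v w := by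
  rw [radiiBilin_eq_homExt hu hx hv hw,
    (cutExt_eventuallyEq (u := u) (y := x) (by simp [hx]) (by simp [hx])).fderiv.fderiv_eq]

theorem continuous_fderiv_fderiv_cutExt {u : E n → ℝ} (hu : SphereContDiff 2 u) :
    Continuous (fderiv ℝ (fderiv ℝ (cutExt u))) :=
  ((contDiff_cutExt (r := 2) hu).fderiv_right (m := 1) (by norm_num)).continuous_fderiv (by simp)

theorem exists_abs_radiiBilin_le {u : E n → ℝ} (hu : SphereContDiff 2 u) :
    ∃ C, 0 < C ∧ ∀ x, ‖x‖ = 1 → ∀ v, ⟪x, v⟫ = 0 → |radiiBilin u x v v| ≤ C * ‖v‖ ^ 2 := by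
  obtain ⟨C, hC⟩ := (isCompact_sphere (0 : E n) 1).exists_bound_of_continuousOn
    (f := fun x => fderiv ℝ (fderiv ℝ (cutExt u)) x)
    (continuous_fderiv_fderiv_cutExt hu).continuousOn
  refine ⟨max C 1, by positivity, fun x hx v hv => ?_⟩
  rw [radiiBilin_eq_cutExt hu hx hv hv, ← Real.norm_eq_abs]
  refine (ContinuousLinearMap.le_opNorm₂ _ v v).trans ?_
  rw [mul_assoc, ← sq]
  refine mul_le_mul_of_nonneg_right ((hC x (by simpa using hx)).trans (le_max_left _ _))
    (by positivity)

/-- Compactness of the set of unit tangent vectors. -/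
theorem RadiiPos.exists_le {u : E n → ℝ} (hu : SphereContDiff 2 u) (hp : RadiiPos u) :
    ∃ c, 0 < c ∧ ∀ x, ‖x‖ = 1 → ∀ v, ⟪x, v⟫ = 0 → c * ‖v‖ ^ 2 ≤ radiiBilin u x v v := by
  let S : Set (E n × E n) := (Metric.sphere 0 1 ×ˢ Metric.sphere 0 1) ∩ {p | ⟪p.1, p.2⟫ = 0}
  have hS : IsCompact S := ((isCompact_sphere _ _).prod (isCompact_sphere _ _)).inter_right
    (isClosed_eq (by fun_prop) continuous_const)
  have hcont : Continuous fun p : E n × E n => fderiv ℝ (fderiv ℝ (cutExt u)) p.1 p.2 p.2 :=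
    (((continuous_fderiv_fderiv_cutExt hu).comp continuous_fst).clm_apply
      continuous_snd).clm_apply continuous_snd
  have hmem : ∀ x, ‖x‖ = 1 → ∀ v, ⟪x, v⟫ = 0 → v ≠ 0 → (x, ‖v‖⁻¹ • v) ∈ S := by
    intro x hx v hv h0
    refine ⟨⟨by simpa using hx, ?_⟩, ?_⟩
    · simp [norm_smul, h0]
    · simp [inner_smul_right, hv]
  have hpos : ∀ p ∈ S, 0 < fderiv ℝ (fderiv ℝ (cutExt u)) p.1 p.2 p.2 := by
    rintro ⟨x, v⟩ ⟨⟨hx, hv⟩, hxv⟩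
    have hx' : ‖x‖ = 1 := by simpa using hx
    have hv' : ‖v‖ = 1 := by simpa using hv
    have hxv' : ⟪x, v⟫ = 0 := hxv
    dsimp only
    rw [← radiiBilin_eq_cutExt hu hx' hxv' hxv', radiiBilin_apply]
    exact hp x hx' v hxv' (ne_zero_of_norm_eq_one hv')
  obtain ⟨c, hc, hcS⟩ : ∃ c, 0 < c ∧
      ∀ p ∈ S, c ≤ fderiv ℝ (fderiv ℝ (cutExt u)) p.1 p.2 p.2 := by
    -- The set is empty for n = 0, when there are no unit tangent vectors.
    rcases S.eq_empty_or_nonempty with h | h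
    · exact ⟨1, one_pos, by simp [h]⟩
    · obtain ⟨p, hpS, hmin⟩ := hS.exists_isMinOn h hcont.continuousOn
      exact ⟨_, hpos p hpS, fun q hq => hmin hq⟩
  refine ⟨c, hc, fun x hx v hv => ?_⟩
  by_cases h0 : v = 0
  · subst h0; simp
  have hv0 : 0 < ‖v‖ := norm_pos_iff.2 h0
  have h := hcS _ (hmem x hx v hv h0)
  rw [radiiBilin_eq_cutExt hu hx hv hv]
  simp only [map_smul, smul_apply, smul_eq_mul] at h
  have h2 : ‖v‖⁻¹ * (‖v‖⁻¹ * fderiv ℝ (fderiv ℝ (cutExt u)) x v v) * ‖v‖ ^ 2 =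
      fderiv ℝ (fderiv ℝ (cutExt u)) x v v := by field_simp
  rw [← h2]
  exact mul_le_mul_of_nonneg_right h (by positivity)

theorem RadiiPos.eventually_add_smul {u v : E n → ℝ} (hu : SphereContDiff 2 u)
    (hv : SphereContDiff 2 v) (hp : RadiiPos u) : ∀ᶠ t : ℝ in 𝓝 0, RadiiPos (u + t • v) := by
  obtain ⟨c, hc, hcu⟩ := hp.exists_le hu
  obtain ⟨C, hC, hCv⟩ := exists_abs_radiiBilin_le hv
  have h : ∀ᶠ t : ℝ in 𝓝 0, |t| * C < c :=
    (Continuous.tendsto (by fun_prop) 0).eventually_lt_const (by simpa using hc)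
  filter_upwards [h] with t ht x hx w hw hw0
  rw [← radiiBilin_apply, radiiBilin_add hu (hv.const_smul t) hx, radiiBilin_smul t hv hx]
  simp only [add_apply, smul_apply, smul_eq_mul]
  have hw' : 0 < ‖w‖ ^ 2 := by positivity
  have h1 := hcu x hx w hw
  have h2 := hCv x hx w hw
  have h3 : |t * radiiBilin v x w w| ≤ |t| * (C * ‖w‖ ^ 2) := by
    rw [abs_mul]; gcongr
  have h4 := neg_abs_le (t * radiiBilin v x w w)
  nlinarith

theorem RadiiPos.smul {u : E n → ℝ} (hu : SphereContDiff 2 u) (hp : RadiiPos u) {t : ℝ}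
    (ht : 0 < t) : RadiiPos (t • u) := by
  intro x hx v hv hv0
  rw [← radiiBilin_apply, radiiBilin_smul t hu hx]
  simp only [smul_apply, smul_eq_mul]
  rw [radiiBilin_apply]
  exact mul_pos ht (hp x hx v hv hv0)

theorem RadiiPos.add_smul_of_mem {u v : E n → ℝ} (hu : SphereContDiff 2 u)
    (hv : SphereContDiff 2 v) (hp : RadiiPos u) (hp' : RadiiPos (u + v)) {t : ℝ}
    (ht : t ∈ Icc (0 : ℝ) 1) : RadiiPos (u + t • v) := by
  intro x hx w hw hw0
  have h1 := hp x hx w hw hw0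
  have h2 := hp' x hx w hw hw0
  rw [← radiiBilin_apply] at h1 h2 ⊢
  rw [radiiBilin_add hu hv hx] at h2
  rw [radiiBilin_add hu (hv.const_smul t) hx, radiiBilin_smul t hv hx]
  simp only [add_apply, smul_apply, smul_eq_mul] at h2 ⊢
  rcases ht.1.eq_or_lt with h | h
  · rw [← h]; simpa using h1
  · nlinarith [ht.2, mul_nonneg (sub_nonneg.2 ht.2) h1.le, mul_pos h h2]

/-! ### The curvature density -/

/-- The function `F^k` of the principal radii of curvature. -/
def density (F : (Fin n → ℝ) → ℝ) (k : ℕ) (u : E n → ℝ) (x : E n) : ℝ :=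
  F (tangentEigenvalues x (radiiForm u x)) ^ k

/-- A combination of determinants of `α (D²u + u I) + β I`. -/
def detDensity (w α β : Fin (n + 1) → ℝ) (u : E n → ℝ) (x : E n) : ℝ :=
  ∑ i, w i * radiiDet (α i • u + fun _ => β i) x

theorem radiiPos_mem_posCone {u : E n → ℝ} (hu : SphereContDiff 2 u) (hp : RadiiPos u) {x : E n}
    (hx : ‖x‖ = 1) : tangentEigenvalues x (radiiForm u x) ∈ posCone n := by
  rw [radiiForm_eq_radiiBilin]
  exact tangentEigenvalues_pos hx (radiiBilin_symm hu hx) fun v hv hv0 => by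
    rw [radiiBilin_apply]; exact hp x hx v hv hv0

theorem density_pos {F : (Fin n → ℝ) → ℝ} {k : ℕ} (hF : IsCurvatureFunction F)
    {u : E n → ℝ} (hu : SphereContDiff 2 u) (hp : RadiiPos u) {x : E n}
    (hx : ‖x‖ = 1) : 0 < density F k u x :=
  pow_pos (hF.pos _ (radiiPos_mem_posCone hu hp hx)) k

/-- Since D²β + βI = βI for a constant β, the function αu + β has radii αλ_j + β. -/
theorem radiiDet_smul_add_const {u : E n → ℝ} (hu : SphereContDiff 2 u) {x : E n}
    (hx : ‖x‖ = 1) (α β : ℝ) : radiiDet (α • u + fun _ => β) x =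
      ∏ i, (α * tangentEigenvalues x (radiiForm u x) i + β) := by
  rw [radiiForm_eq_radiiBilin, prod_tangentEigenvalues x (radiiBilin_symm hu hx), radiiDet,
    radiiBilin_add (hu.const_smul α) (sphereContDiff_const β) hx, radiiBilin_smul α hu hx,
    radiiBilin_const]
  congr 1
  ext i j
  rw [formMatrix_apply]
  simp only [add_apply, smul_apply, innerBilin_apply, smul_eq_mul, Matrix.add_apply,
    Matrix.smul_apply, Matrix.one_apply, formMatrix_apply,
    (isTangentFrame_frame hx).inner_eq_ite]

section

variable {F : (Fin n → ℝ) → ℝ} {k : ℕ} {w α β : Fin (n + 1) → ℝ}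

/-- Replaces F^k by an expression that is polynomial in the second derivatives and makes sense
without positivity of the radii. -/
theorem density_eq_detDensity
    (hw : ∀ l ∈ posCone n, F l ^ k = ∑ i, w i * ∏ j, (α i * l j + β i))
    {u : E n → ℝ} (hu : SphereContDiff 2 u) (hp : RadiiPos u) {x : E n} (hx : ‖x‖ = 1) :
    density F k u x = detDensity w α β u x := by
  rw [density, hw _ (radiiPos_mem_posCone hu hp hx), detDensity]
  simp_rw [radiiDet_smul_add_const hu hx]

/-- The homogeneity of F is carried through the determinant formula evaluated at tλ, so the ordered
eigenvalues of the scaled form need not be compared with those of the original one. -/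
theorem density_smul (hF : IsCurvatureFunction F)
    (hw : ∀ l ∈ posCone n, F l ^ k = ∑ i, w i * ∏ j, (α i * l j + β i))
    {u : E n → ℝ} (hu : SphereContDiff 2 u) (hp : RadiiPos u) {x : E n} (hx : ‖x‖ = 1)
    {t : ℝ} (ht : 0 < t) : density F k (t • u) x = t ^ k * density F k u x := by
  have hl := radiiPos_mem_posCone hu hp hx
  have hl' : t • tangentEigenvalues x (radiiForm u x) ∈ posCone n := fun i => mul_pos ht (hl i)
  rw [density_eq_detDensity hw (hu.const_smul t) (hp.smul hu ht) hx, density, ← mul_pow,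
    ← hF.homogeneous t ht _ hl, hw _ hl', detDensity]
  refine Finset.sum_congr rfl fun i _ => ?_
  rw [smul_smul, radiiDet_smul_add_const hu hx]
  simp only [Pi.smul_apply, smul_eq_mul, mul_assoc]

theorem smul_add_const_add_smul (α β t : ℝ) (u v : E n → ℝ) :
    (α • (u + t • v) + fun _ => β) = (α • u + fun _ => β) + t • (α • v) := by
  ext x
  simp only [Pi.add_apply, Pi.smul_apply, smul_eq_mul]
  ring

theorem continuous_detDensity (w α β : Fin (n + 1) → ℝ) {u v : E n → ℝ} (hu : SphereContDiff 2 u)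
    (hv : SphereContDiff 2 v) :
    Continuous fun p : ℝ × Metric.sphere (0 : E n) 1 => detDensity w α β (u + p.1 • v) p.2 := by
  simp only [detDensity]
  refine continuous_finsetSum _ fun i _ => continuous_const.mul ?_
  simp_rw [smul_add_const_add_smul]
  exact continuous_radiiDet ((hu.const_smul _).add (sphereContDiff_const _)) (hv.const_smul _)

theorem SphereContDiff.continuous_sphere {r : WithTop ℕ∞} {u : E n → ℝ} (hu : SphereContDiff r u) :
    Continuous fun x : Metric.sphere (0 : E n) 1 => u x := by
  have h : Continuous fun x : Metric.sphere (0 : E n) 1 => radialExt u x :=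
    ContinuousOn.comp_continuous (g := radialExt u) (ContDiffOn.continuousOn hu)
      continuous_subtype_val fun x => ne_zero_of_norm_eq_one (by simp)
  refine h.congr fun x => radialExt_of_norm_eq_one (by simp)

theorem integrable_sphere {f : Metric.sphere (0 : E n) 1 → ℝ} (hf : Continuous f) :
    Integrable f (volume : Measure (E n)).toSphere :=
  hf.integrable_of_hasCompactSupport (HasCompactSupport.of_compactSpace f)

theorem continuous_sphereIntegral {X : Type*} [TopologicalSpace X] [FirstCountableTopology X]
    [LocallyCompactSpace X] {f : X → E n → ℝ}
    (hf : Continuous fun p : X × Metric.sphere (0 : E n) 1 => f p.1 p.2) :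
    Continuous fun t => sphereIntegral (f t) := by
  have := continuous_parametric_integral_of_continuous (μ := (volume : Measure (E n)).toSphere)
    (f := fun t (x : Metric.sphere (0 : E n) 1) => f t x) hf isCompact_univ
  simpa [sphereIntegral] using this

theorem sphereIntegral_congr {f g : E n → ℝ} (h : ∀ x, ‖x‖ = 1 → f x = g x) :
    sphereIntegral f = sphereIntegral g :=
  integral_congr_ae (Eventually.of_forall fun x => h x (by simp))

theorem sphereIntegral_const_mul (c : ℝ) (f : E n → ℝ) :
    sphereIntegral (fun x => c * f x) = c * sphereIntegral f := integral_const_mul _ _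

theorem sphereIntegral_nonneg {f : E n → ℝ} (h : ∀ x, ‖x‖ = 1 → 0 ≤ f x) : 0 ≤ sphereIntegral f :=
  integral_nonneg fun x => h x (by simp)

/-- The primitive of `detDensity`. -/
def detFunctional (w α β : Fin (n + 1) → ℝ) (u : E n → ℝ) : ℝ :=
  ∑ i, w i / α i * sphereIntegral fun x =>
    (α i • u + fun _ => β i : E n → ℝ) x * radiiDet (α i • u + fun _ => β i) x

/-- The substitution u ↦ α_i u + β_i turns the direction v into α_i v. The extra factor α_i is
compensated by the weight w_i / α_i, which is why α_i ≠ 0 is needed. -/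
theorem detFunctional_sub (w β : Fin (n + 1) → ℝ) (hα : ∀ i, α i ≠ 0) {u v : E n → ℝ}
    (hu : SphereContDiff 2 u) (hv : SphereContDiff 2 v) :
    detFunctional w α β (u + v) - detFunctional w α β u = (n + 1) *
      ∫ t in Ioc (0 : ℝ) 1, sphereIntegral fun x => v x * detDensity w α β (u + t • v) x := by
  have hui : ∀ i, SphereContDiff 2 (α i • u + fun _ => β i) := fun i =>
    (hu.const_smul _).add (sphereContDiff_const _)
  have hvi : ∀ i, SphereContDiff 2 (α i • v) := fun i => hv.const_smul _
  have hjoint : ∀ i, Continuous fun p : ℝ × Metric.sphere (0 : E n) 1 =>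
      v p.2 * radiiDet ((α i • u + fun _ => β i) + p.1 • (α i • v)) p.2 := fun i =>
    (hv.continuous_sphere.comp continuous_snd).mul (continuous_radiiDet (hui i) (hvi i))
  have hterm : ∀ i, (sphereIntegral fun x => (α i • (u + v) + fun _ => β i : E n → ℝ) x *
        radiiDet (α i • (u + v) + fun _ => β i) x) -
      (sphereIntegral fun x => (α i • u + fun _ => β i : E n → ℝ) x *
        radiiDet (α i • u + fun _ => β i) x) = (n + 1) * (α i *
      ∫ t in Ioc (0 : ℝ) 1, sphereIntegral fun x =>
        v x * radiiDet ((α i • u + fun _ => β i) + t • (α i • v)) x) := by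
    intro i
    have h := sphereIntegral_mul_radiiDet_sub (hui i) (hvi i)
    have h1 := smul_add_const_add_smul (α i) (β i) 1 u v
    rw [one_smul, one_smul] at h1
    rw [h1, h]
    congr 1
    rw [← integral_const_mul]
    congr 1
    ext t
    rw [← sphereIntegral_const_mul]
    refine sphereIntegral_congr fun x _ => ?_
    rw [Pi.smul_apply, smul_eq_mul, mul_assoc]
  have hsum : ∀ t : ℝ, (sphereIntegral fun x => v x * detDensity w α β (u + t • v) x) =
      ∑ i, w i * sphereIntegral fun x =>
        v x * radiiDet ((α i • u + fun _ => β i) + t • (α i • v)) x := by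
    intro t
    simp_rw [← sphereIntegral_const_mul]
    simp only [sphereIntegral]
    rw [← integral_finsetSum]
    · refine integral_congr_ae (Eventually.of_forall fun x => ?_)
      simp only [detDensity, Finset.mul_sum, smul_add_const_add_smul]
      exact Finset.sum_congr rfl fun i _ => by ring
    · intro i _
      exact integrable_sphere (continuous_const.mul ((hjoint i).comp (by fun_prop :
        Continuous fun x : Metric.sphere (0 : E n) 1 => (t, x))))
  simp_rw [hsum]
  rw [integral_finsetSum]
  · simp only [detFunctional, ← Finset.sum_sub_distrib, ← mul_sub]
    rw [Finset.mul_sum]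
    refine Finset.sum_congr rfl fun i _ => ?_
    rw [hterm, integral_const_mul]
    field_simp [hα i]
  · intro i _
    have hc : Continuous fun t : ℝ => w i * sphereIntegral fun x =>
        v x * radiiDet ((α i • u + fun _ => β i) + t • (α i • v)) x :=
      continuous_const.mul (continuous_sphereIntegral (hjoint i))
    exact (hc.integrableOn_Icc (a := 0) (b := 1)).mono_set Ioc_subset_Icc_self

/-! ### The quermassintegral as a functional of the support function -/

/-- `1/(k+1) ∫ u F^k(D²u + u I) dx`. -/
def quermassFun (F : (Fin n → ℝ) → ℝ) (k : ℕ) (u : E n → ℝ) : ℝ :=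
  1 / ((k : ℝ) + 1) * sphereIntegral fun x => u x * density F k u x

/-- Integrate the variation along t ↦ tu. By homogeneity the integrand is t^k ∫ u F^k, and ∫ t^k dt
= 1/(k+1) is the constant in W. The endpoint 0 has no positive radii, but the determinants are
defined there and `Ioc` leaves out t = 0. -/
theorem detFunctional_sub_zero (hF : IsCurvatureFunction F) (hα : ∀ i, α i ≠ 0)
    (hw : ∀ l ∈ posCone n, F l ^ k = ∑ i, w i * ∏ j, (α i * l j + β i))
    {u : E n → ℝ} (hu : SphereContDiff 2 u) (hp : RadiiPos u) :
    detFunctional w α β u - detFunctional w α β 0 = (n + 1) * quermassFun F k u := by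
  have h := detFunctional_sub w β hα (u := 0) (sphereContDiff_const 0) hu
  rw [zero_add] at h
  rw [h, quermassFun]
  congr 1
  have h1 : ∀ t ∈ Ioc (0 : ℝ) 1, (sphereIntegral fun x => u x * detDensity w α β (0 + t • u) x) =
      t ^ k * sphereIntegral fun x => u x * density F k u x := by
    intro t ht
    rw [← sphereIntegral_const_mul]
    refine sphereIntegral_congr fun x hx => ?_
    rw [zero_add, ← density_eq_detDensity hw (hu.const_smul t) (hp.smul hu ht.1) hx,
      density_smul hF hw hu hp hx ht.1]
    ring
  rw [setIntegral_congr_fun measurableSet_Ioc h1, integral_mul_const,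
    ← intervalIntegral.integral_of_le zero_le_one, integral_pow]
  simp

theorem quermassFun_sub (hF : IsCurvatureFunction F) (hα : ∀ i, α i ≠ 0)
    (hw : ∀ l ∈ posCone n, F l ^ k = ∑ i, w i * ∏ j, (α i * l j + β i))
    {u v : E n → ℝ} (hu : SphereContDiff 2 u) (hv : SphereContDiff 2 v) (hp : RadiiPos u)
    (hp' : RadiiPos (u + v)) :
    quermassFun F k (u + v) - quermassFun F k u =
      ∫ t in Ioc (0 : ℝ) 1, sphereIntegral fun x => v x * detDensity w α β (u + t • v) x := by
  have h1 := detFunctional_sub_zero hF hα hw hu hp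
  have h2 := detFunctional_sub_zero hF hα hw (hu.add hv) hp'
  have h3 := detFunctional_sub w β hα hu hv
  have h4 : ((n : ℝ) + 1) ≠ 0 := by positivity
  refine mul_left_cancel₀ h4 ?_
  rw [← h3, mul_sub, ← h1, ← h2]
  ring

end

/-- The functionals to which the variation formula applies. -/
structure IsAdmissible (F : (Fin n → ℝ) → ℝ) (k : ℕ) : Prop where
  isCurvatureFunction : IsCurvatureFunction F
  exists_pow_eq : ∃ (w α β : Fin (n + 1) → ℝ), (∀ i, α i ≠ 0) ∧
      ∀ l ∈ posCone n, F l ^ k = ∑ i, w i * ∏ j, (α i * l j + β i)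

theorem IsCurvatureFunction.isAdmissible {F : (Fin n → ℝ) → ℝ} {k : ℕ}
    (hF : IsCurvatureFunction F) (hdiv : IsDivergenceFree F k) : IsAdmissible F k :=
  ⟨hF, exists_pow_eq_sum_prod hF hdiv⟩

variable {F : (Fin n → ℝ) → ℝ} {k : ℕ}

/-- The radii stay positive along the segment from u to v, so the variation formula integrates the
nonnegative function (v - u) F^k. -/
theorem quermassFun_mono (hF : IsAdmissible F k) {u v : E n → ℝ} (hu : SphereContDiff 2 u)
    (hv : SphereContDiff 2 v) (hp : RadiiPos u) (hp' : RadiiPos v)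
    (h : ∀ x, ‖x‖ = 1 → u x ≤ v x) : quermassFun F k u ≤ quermassFun F k v := by
  obtain ⟨w, α, β, hα, hw⟩ := hF.exists_pow_eq
  obtain ⟨d, rfl⟩ : ∃ d, v = u + d := ⟨v - u, by simp⟩
  have hd : SphereContDiff 2 d := by
    have := hv.add_smul hu (-1)
    simpa using this
  rw [← sub_nonneg, quermassFun_sub hF.isCurvatureFunction hα hw hu hd hp hp']
  refine setIntegral_nonneg measurableSet_Ioc fun t ht => sphereIntegral_nonneg fun x hx => ?_
  have hpt := hp.add_smul_of_mem hu hd hp' (Ioc_subset_Icc_self ht)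
  rw [← density_eq_detDensity hw (hu.add_smul hd t) hpt hx]
  exact mul_nonneg (by simpa using h x hx)
    (density_pos hF.isCurvatureFunction (hu.add_smul hd t) hpt hx).le

theorem quermassFun_smul (hF : IsAdmissible F k) {u : E n → ℝ} (hu : SphereContDiff 2 u)
    (hp : RadiiPos u) {t : ℝ} (ht : 0 < t) :
    quermassFun F k (t • u) = t ^ (k + 1) * quermassFun F k u := by
  obtain ⟨w, α, β, hα, hw⟩ := hF.exists_pow_eq
  rw [quermassFun, quermassFun, mul_left_comm,
    ← sphereIntegral_const_mul (t ^ (k + 1))]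
  congr 1
  refine sphereIntegral_congr fun x hx => ?_
  rw [density_smul hF.isCurvatureFunction hw hu hp hx ht, Pi.smul_apply, smul_eq_mul]
  ring

theorem continuous_density (hF : IsAdmissible F k) {u : E n → ℝ} (hu : SphereContDiff 2 u)
    (hp : RadiiPos u) : Continuous fun x : Metric.sphere (0 : E n) 1 => density F k u x := by
  obtain ⟨w, α, β, hα, hw⟩ := hF.exists_pow_eq
  have h := (continuous_detDensity w α β hu hu).comp (by fun_prop :
        Continuous fun x : Metric.sphere (0 : E n) 1 => ((0 : ℝ), x))
  refine h.congr fun x => ?_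
  simp only [Function.comp, zero_smul, add_zero]
  rw [density_eq_detDensity hw hu hp (by simp)]

/-- The first variation of the quermassintegral. -/
theorem tendsto_quermassFun_variation (hF : IsAdmissible F k) {u v : E n → ℝ}
    (hu : SphereContDiff 2 u) (hv : SphereContDiff 2 v) (hp : RadiiPos u) :
    Tendsto (fun ε : ℝ => (quermassFun F k (u + ε • v) - quermassFun F k u) / ε) (𝓝[>] 0)
      (𝓝 (sphereIntegral fun x => v x * density F k u x)) := by
  obtain ⟨w, α, β, hα, hw⟩ := hF.exists_pow_eq
  let H : ℝ → ℝ := fun s => sphereIntegral fun x => v x * detDensity w α β (u + s • v) x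
  have hH : Continuous H := continuous_sphereIntegral
    ((hv.continuous_sphere.comp continuous_snd).mul (continuous_detDensity w α β hu hv))
  -- The difference quotient is the average of H over [0, ε], rescaled to a fixed interval so that
  -- continuity in ε gives the limit.
  have hI : Continuous fun ε : ℝ => ∫ t in Icc (0 : ℝ) 1, H (t * ε) :=
    continuous_parametric_integral_of_continuous (f := fun ε t => H (t * ε))
      (hH.comp (continuous_snd.mul continuous_fst)) isCompact_Icc
  have h0 : ∫ t in Icc (0 : ℝ) 1, H (t * 0) = sphereIntegral fun x => v x * density F k u x := by
    simp only [mul_zero]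
    rw [setIntegral_const]
    simp only [Real.volume_real_Icc, sub_zero, zero_le_one, sup_of_le_left, one_smul]
    refine sphereIntegral_congr fun x hx => ?_
    rw [zero_smul, add_zero, density_eq_detDensity hw hu hp hx]
  rw [← h0]
  refine ((hI.tendsto 0).mono_left nhdsWithin_le_nhds).congr' ?_
  filter_upwards [self_mem_nhdsWithin,
    nhdsWithin_le_nhds (hp.eventually_add_smul hu hv)] with ε hε hpε
  have hε' : (0 : ℝ) < ε := hε
  rw [quermassFun_sub hF.isCurvatureFunction hα hw hu (hv.const_smul ε) hp hpε,
    integral_Icc_eq_integral_Ioc, eq_div_iff hε'.ne', ← integral_mul_const]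
  congr 1
  ext t
  simp only [H]
  rw [mul_comm, ← sphereIntegral_const_mul]
  refine sphereIntegral_congr fun x _ => ?_
  rw [smul_smul, Pi.smul_apply, smul_eq_mul, mul_assoc]

end

/-! ### Convex bodies and the extension of the quermassintegral. -/

section

variable {n : ℕ}

/-! ### Support functions -/

theorem bddAbove_inner (K : ConvexBody (E n)) (x : E n) :
    BddAbove ((fun y => ⟪x, y⟫) '' (K : Set (E n))) :=
  (K.isCompact.image (by fun_prop)).bddAbove

theorem inner_le_supp {K : ConvexBody (E n)} {y : E n} (hy : y ∈ K) (x : E n) :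
    ⟪x, y⟫ ≤ supp K x :=
  le_csSup (bddAbove_inner K x) ⟨y, hy, rfl⟩

theorem supp_le {K : ConvexBody (E n)} {x : E n} {c : ℝ} (h : ∀ y ∈ K, ⟪x, y⟫ ≤ c) :
    supp K x ≤ c :=
  csSup_le (K.nonempty.image _) (by rintro _ ⟨y, hy, rfl⟩; exact h y hy)

theorem exists_inner_eq_supp (K : ConvexBody (E n)) (x : E n) : ∃ y ∈ K, ⟪x, y⟫ = supp K x := by
  obtain ⟨y, hy, h⟩ := (K.isCompact.image
    (by fun_prop : Continuous fun y : E n => ⟪x, y⟫)).sSup_mem (K.nonempty.image _)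
  exact ⟨y, hy, h⟩

theorem supp_smul (K : ConvexBody (E n)) {t : ℝ} (ht : 0 < t) (x : E n) :
    supp K (t • x) = t * supp K x := by
  apply le_antisymm
  · refine supp_le fun y hy => ?_
    rw [real_inner_smul_left]
    exact mul_le_mul_of_nonneg_left (inner_le_supp hy x) ht.le
  · obtain ⟨y, hy, h⟩ := exists_inner_eq_supp K x
    rw [← h, ← real_inner_smul_left]
    exact inner_le_supp hy _

theorem supp_add_le (K : ConvexBody (E n)) (x y : E n) : supp K (x + y) ≤ supp K x + supp K y :=
  supp_le fun z hz => by
    rw [inner_add_left]; exact add_le_add (inner_le_supp hz x) (inner_le_supp hz y)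

theorem supp_nonneg {K : ConvexBody (E n)} (h : (0 : E n) ∈ K) (x : E n) : 0 ≤ supp K x := by
  simpa using inner_le_supp h x

theorem exists_norm_le (K : ConvexBody (E n)) : ∃ R, 0 < R ∧ ∀ y ∈ K, ‖y‖ ≤ R := by
  obtain ⟨R, hR⟩ := K.isBounded.exists_norm_le
  exact ⟨max R 1, by positivity, fun y hy => (hR y hy).trans (le_max_left _ _)⟩

theorem supp_sub_le {K : ConvexBody (E n)} {R : ℝ} (hR : ∀ y ∈ K, ‖y‖ ≤ R) (x z : E n) :
    supp K x - supp K z ≤ R * ‖x - z‖ := by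
  rw [sub_le_iff_le_add]
  refine supp_le fun y hy => ?_
  have h1 : ⟪x, y⟫ = ⟪x - z, y⟫ + ⟪z, y⟫ := by rw [inner_sub_left]; ring
  rw [h1]
  refine add_le_add ((real_inner_le_norm _ _).trans ?_) (inner_le_supp hy z)
  rw [mul_comm]
  exact mul_le_mul_of_nonneg_right (hR y hy) (norm_nonneg _)

theorem continuous_supp (K : ConvexBody (E n)) : Continuous (supp K) := by
  obtain ⟨R, hR0, hR⟩ := exists_norm_le K
  refine (LipschitzWith.of_dist_le_mul (K := R.toNNReal) fun x z => ?_).continuous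
  rw [Real.dist_eq, dist_eq_norm, Real.coe_toNNReal R hR0.le]
  refine abs_sub_le_iff.2 ⟨supp_sub_le hR x z, ?_⟩
  rw [norm_sub_rev]
  exact supp_sub_le hR z x

/-! ### Support functions and the Hausdorff distance -/

theorem supp_sub_le_dist (K M : ConvexBody (E n)) {x : E n} (hx : ‖x‖ = 1) :
    supp K x - supp M x ≤ dist K M := by
  refine le_of_forall_pos_le_add fun ε hε => ?_
  rw [sub_le_iff_le_add]
  refine supp_le fun y hy => ?_
  obtain ⟨z, hz, hyz⟩ := Metric.exists_dist_lt_of_hausdorffDist_lt hy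
    (r := dist K M + ε) (by rw [ConvexBody.hausdorffDist_coe]; linarith)
    ConvexBody.hausdorffEDist_ne_top
  have h1 : ⟪x, y⟫ = ⟪x, y - z⟫ + ⟪x, z⟫ := by rw [inner_sub_right]; ring
  have h2 : ⟪x, y - z⟫ ≤ dist y z := by
    have := real_inner_le_norm x (y - z)
    rwa [hx, one_mul, ← dist_eq_norm] at this
  rw [h1]
  exact add_le_add (h2.trans hyz.le) (inner_le_supp hz x)

/-- Take the point z of M nearest to y. The direction of y - z is normal to a supporting hyperplane
of M at z, so ‖y - z‖ is bounded by the gap of the support functions in this direction. -/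
theorem exists_mem_dist_le {K M : ConvexBody (E n)} {r : ℝ}
    (h : ∀ x, ‖x‖ = 1 → supp K x ≤ supp M x + r) {y : E n} (hy : y ∈ K) (hr : 0 ≤ r) :
    ∃ z ∈ (M : Set (E n)), dist y z ≤ r := by
  obtain ⟨z, hz, hmin⟩ := exists_norm_eq_iInf_of_complete_convex M.nonempty
    M.isCompact.isComplete M.convex y
  rw [norm_eq_iInf_iff_real_inner_le_zero M.convex hz] at hmin
  refine ⟨z, hz, ?_⟩
  by_cases h0 : y - z = 0
  · rw [dist_eq_norm, h0, norm_zero]; exact hr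
  have hn : 0 < ‖y - z‖ := norm_pos_iff.2 h0
  set x := ‖y - z‖⁻¹ • (y - z) with hxd
  have hx : ‖x‖ = 1 := by simp [x, norm_smul, h0]
  have h1 : supp M x ≤ ⟪x, z⟫ := supp_le fun w hw => by
    have := hmin w hw
    rw [inner_sub_right] at this
    rw [hxd, real_inner_smul_left, real_inner_smul_left]
    exact mul_le_mul_of_nonneg_left (by linarith) (by positivity)
  have h2 := inner_le_supp hy x
  have h3 : ⟪x, y⟫ - ⟪x, z⟫ = ‖y - z‖ := by
    rw [← inner_sub_right, hxd, real_inner_smul_left, real_inner_self_eq_norm_sq]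
    field_simp
  rw [dist_eq_norm, ← h3]
  linarith [h x hx]

theorem dist_le_of_supp {K M : ConvexBody (E n)} {r : ℝ} (hr : 0 ≤ r)
    (h : ∀ x, ‖x‖ = 1 → |supp K x - supp M x| ≤ r) : dist K M ≤ r := by
  rw [← ConvexBody.hausdorffDist_coe]
  refine Metric.hausdorffDist_le_of_mem_dist hr (fun y hy => exists_mem_dist_le (fun x hx => ?_) hy hr)
    fun y hy => exists_mem_dist_le (fun x hx => ?_) hy hr
  · linarith [(abs_le.1 (h x hx)).2]
  · linarith [(abs_le.1 (h x hx)).1]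

/-! ### Sublinear functions are support functions -/

/-- Hahn–Banach: the functional c z ↦ c U(z) extends to one dominated by U, and its Riesz vector is
a point of M at which the support value U(z) is attained. -/
theorem supp_eq_of_sublinear {M : ConvexBody (E n)} {U : E n → ℝ}
    (hM : ∀ y, y ∈ M ↔ ∀ x, ⟪x, y⟫ ≤ U x)
    (hom : ∀ t : ℝ, 0 < t → ∀ x, U (t • x) = t * U x) (hadd : ∀ x y, U (x + y) ≤ U x + U y) :
    supp M = U := by
  ext z
  refine le_antisymm (supp_le fun y hy => (hM y).1 hy z) ?_
  have h0 : U 0 = 0 := by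
    have := hom 2 (by norm_num) 0
    rw [smul_zero] at this; linarith
  by_cases hz : z = 0
  · subst hz
    rw [h0]
    obtain ⟨y, hy, h⟩ := exists_inner_eq_supp M 0
    rw [← h]; simp
  have hH : ∀ c : ℝ, c • z = 0 → (RingHom.id ℝ) c • U z = 0 := fun c hc => by
    rcases smul_eq_zero.1 hc with h | h
    · simp [h]
    · exact absurd h hz
  -- Negative multiples are controlled by 0 = U(0) ≤ U(cz) + U(-cz).
  have hle : ∀ c : ℝ, c * U z ≤ U (c • z) := by
    intro c
    rcases lt_trichotomy c 0 with hc | hc | hc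
    · have h1 := hadd (c • z) ((-c) • z)
      rw [← add_smul, add_neg_cancel, zero_smul, h0, hom (-c) (by linarith)] at h1
      linarith
    · simp [hc, h0]
    · rw [hom c hc]
  obtain ⟨g, hg1, hg2⟩ := exists_extension_of_le_sublinear
    (LinearPMap.mkSpanSingleton' z (U z) hH) U hom hadd (by
      rintro ⟨x, hx⟩
      obtain ⟨c, rfl⟩ := Submodule.mem_span_singleton.1 hx
      rw [LinearPMap.mkSpanSingleton'_apply]
      exact hle c)
  have hgz : g z = U z := by
    exact (hg1 ⟨z, Submodule.mem_span_singleton_self z⟩).trans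
      (LinearPMap.mkSpanSingleton'_apply_self z (U z) hH _)
  let y : E n := (InnerProductSpace.toDual ℝ (E n)).symm (LinearMap.toContinuousLinearMap g)
  have hy : ∀ x, ⟪x, y⟫ = g x := fun x => by
    rw [real_inner_comm]
    simp [y]
  have hyM : y ∈ M := (hM y).2 fun x => by rw [hy]; exact hg2 x
  rw [← hgz, ← hy]
  exact inner_le_supp hyM z

/-- The convex body with a given nonnegative sublinear support function. -/
def bodyOf (U : E n → ℝ) (hU : ∀ x, 0 ≤ U x) : ConvexBody (E n) where
  carrier := {y | ∀ x, ⟪x, y⟫ ≤ U x}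
  convex' := by
    intro y hy z hz a b ha hb hab x
    have h1 := mul_le_mul_of_nonneg_left (hy x) ha
    have h2 := mul_le_mul_of_nonneg_left (hz x) hb
    rw [inner_add_right, inner_smul_right, inner_smul_right]
    calc _ ≤ _ := add_le_add h1 h2
      _ = _ := by rw [← add_mul, hab, one_mul]
  isCompact' := by
    refine Metric.isCompact_of_isClosed_isBounded ?_ ?_
    · rw [Set.ofPred_forall]
      exact isClosed_iInter fun x =>
        isClosed_le (continuous_const.inner continuous_id) continuous_const
    · refine (isBounded_iff_forall_norm_le).2
        ⟨√(∑ i, (U (stdVec i) + U (-stdVec i)) ^ 2), fun y hy => ?_⟩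
      rw [EuclideanSpace.norm_eq]
      refine Real.sqrt_le_sqrt (Finset.sum_le_sum fun i _ => ?_)
      have h1 := hy (stdVec i)
      have h2 := hy (-stdVec i)
      have h3 := hU (stdVec i)
      have h4 := hU (-stdVec i)
      rw [inner_neg_left] at h2
      rw [EuclideanSpace.inner_single_left] at h1 h2
      simp only [map_one, one_mul] at h1 h2
      rw [Real.norm_eq_abs, sq_abs]
      exact sq_le_sq' (by linarith) (by linarith)
  nonempty' := ⟨0, fun x => by rw [inner_zero_right]; exact hU x⟩

theorem supp_bodyOf {U : E n → ℝ} (hU : ∀ x, 0 ≤ U x)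
    (hom : ∀ t : ℝ, 0 < t → ∀ x, U (t • x) = t * U x) (hadd : ∀ x y, U (x + y) ≤ U x + U y) :
    supp (bodyOf U hU) = U :=
  supp_eq_of_sublinear (fun _ => Iff.rfl) hom hadd

/-! ### Sublinear functions of class `C²` -/

theorem homExt_eq_self {U : E n → ℝ} (hom : ∀ t : ℝ, 0 < t → ∀ x, U (t • x) = t * U x) :
    homExt U = U := by
  ext y
  by_cases hy : y = 0
  · have := hom 2 (by norm_num) 0
    rw [smul_zero] at this
    subst hy
    simp only [homExt, norm_zero, zero_mul]; linarith
  · have h0 : 0 < ‖y‖ := norm_pos_iff.2 hy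
    rw [homExt, radialExt, hom _ (inv_pos.2 h0), mul_inv_cancel_left₀ h0.ne']

theorem fderiv_le_of_sublinear {U : E n → ℝ}
    (hom : ∀ t : ℝ, 0 < t → ∀ x, U (t • x) = t * U x) (hadd : ∀ x y, U (x + y) ≤ U x + U y)
    {z : E n} (hz : DifferentiableAt ℝ U z) (x : E n) : fderiv ℝ U z x ≤ U x := by
  have h1 : HasDerivAt (fun t : ℝ => U (z + t • x)) (fderiv ℝ U z x) 0 := by
    have hl : HasDerivAt (fun t : ℝ => z + t • x) x 0 := by
      simpa using ((hasDerivAt_id (0 : ℝ)).smul_const x).const_add z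
    exact HasFDerivAt.comp_hasDerivAt_of_eq 0 hz.hasFDerivAt hl (by simp)
  refine le_of_tendsto h1.tendsto_slope_zero_right ?_
  filter_upwards [self_mem_nhdsWithin] with t ht
  have ht' : (0 : ℝ) < t := ht
  have h2 := hadd z (t • x)
  rw [hom t ht'] at h2
  simp only [zero_add, zero_smul, add_zero, smul_eq_mul]
  rw [inv_mul_le_iff₀ ht']
  linarith

/-- Monotonicity of the gradient: compare ∇U(z)·y ≤ U(y) = ∇U(y)·y for the points x and x + tv in
both orders, add, and divide by t². -/
theorem fderiv_fderiv_nonneg_of_sublinear {U : E n → ℝ}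
    (hom : ∀ t : ℝ, 0 < t → ∀ x, U (t • x) = t * U x) (hadd : ∀ x y, U (x + y) ≤ U x + U y)
    {x : E n} (hx : ContDiffAt ℝ 2 U x) (v : E n) : 0 ≤ fderiv ℝ (fderiv ℝ U) x v v := by
  have hd1 : DifferentiableAt ℝ (fderiv ℝ U) x :=
    (hx.fderiv_right (m := 1) (by norm_num)).differentiableAt (by simp)
  have hl : HasDerivAt (fun t : ℝ => x + t • v) v 0 := by
    simpa using ((hasDerivAt_id (0 : ℝ)).smul_const v).const_add x
  have h1 : HasDerivAt (fun t : ℝ => fderiv ℝ U (x + t • v)) (fderiv ℝ (fderiv ℝ U) x v) 0 :=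
    HasFDerivAt.comp_hasDerivAt_of_eq 0 hd1.hasFDerivAt hl (by simp)
  have h2 : HasDerivAt (fun t : ℝ => fderiv ℝ U (x + t • v) v) (fderiv ℝ (fderiv ℝ U) x v v) 0 := by
    simpa using h1.clm_apply (hasDerivAt_const (0 : ℝ) v)
  have hev : ∀ᶠ t : ℝ in 𝓝[>] 0, DifferentiableAt ℝ U (x + t • v) := by
    have h3 : ∀ᶠ z in 𝓝 x, DifferentiableAt ℝ U z :=
      (hx.eventually (by simp)).mono fun z hz => hz.differentiableAt (by simp)
    have h4 : Tendsto (fun t : ℝ => x + t • v) (𝓝 0) (𝓝 x) := by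
      simpa using hl.continuousAt.tendsto
    exact nhdsWithin_le_nhds (h4.eventually h3)
  refine ge_of_tendsto h2.tendsto_slope_zero_right ?_
  filter_upwards [self_mem_nhdsWithin, hev] with t ht hdt
  have ht' : (0 : ℝ) < t := ht
  have hdx : DifferentiableAt ℝ U x := hx.differentiableAt (by simp)
  have e1 := fderiv_le_of_sublinear hom hadd hdx (x + t • v)
  have e2 := fderiv_le_of_sublinear hom hadd hdt x
  have e3 := fderiv_apply_self_of_homogeneous hom hdx
  have e4 := fderiv_apply_self_of_homogeneous hom hdt
  rw [map_add, map_smul, smul_eq_mul] at e1 e4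
  simp only [zero_add, zero_smul, add_zero, smul_eq_mul]
  refine mul_nonneg (by positivity) ?_
  have : 0 ≤ t * (fderiv ℝ U (x + t • v) v - fderiv ℝ U x v) := by linarith
  exact nonneg_of_mul_nonneg_right this ht'

theorem radialExt_congr {u v : E n → ℝ} (h : ∀ x, ‖x‖ = 1 → u x = v x) {y : E n} (hy : y ≠ 0) :
    radialExt u y = radialExt v y :=
  h _ (by simp [norm_smul, hy])

theorem SphereContDiff.congr {r : WithTop ℕ∞} {u v : E n → ℝ} (hu : SphereContDiff r u)
    (h : ∀ x, ‖x‖ = 1 → u x = v x) : SphereContDiff r v :=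
  ContDiffOn.congr hu fun _ hy => (radialExt_congr h hy).symm

theorem radiiForm_congr {u v : E n → ℝ} (h : ∀ x, ‖x‖ = 1 → u x = v x) {x : E n} (hx : ‖x‖ = 1) :
    radiiForm u x = radiiForm v x := by
  have hev : radialExt u =ᶠ[𝓝 x] radialExt v := by
    filter_upwards [isOpen_ne.mem_nhds (ne_zero_of_norm_eq_one hx)] with y hy
      using radialExt_congr h hy
  ext a b
  rw [radiiForm, radiiForm, sphereHess, sphereHess, hev.fderiv.fderiv_eq, h x hx]

/-- Adding a multiple of the norm to a `C²` sublinear function gives positive radii. -/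
theorem radiiPos_add_norm {U : E n → ℝ}
    (hom : ∀ t : ℝ, 0 < t → ∀ x, U (t • x) = t * U x) (hadd : ∀ x y, U (x + y) ≤ U x + U y)
    (hU : ContDiffOn ℝ 2 U {0}ᶜ) {δ : ℝ} (hδ : 0 < δ) :
    SphereContDiff 2 (fun x => U x + δ * ‖x‖) ∧ RadiiPos fun x => U x + δ * ‖x‖ := by
  have hUs : SphereContDiff 2 U := sphereContDiff_of_contDiffOn hU
  have heq : ∀ x : E n, ‖x‖ = 1 → (U + fun _ => δ : E n → ℝ) x = U x + δ * ‖x‖ := fun x hx => by simp [hx]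
  refine ⟨(hUs.add (sphereContDiff_const δ)).congr heq, fun x hx v hv hv0 => ?_⟩
  rw [← radiiForm_congr heq hx, ← radiiBilin_apply, radiiBilin_add hUs (sphereContDiff_const δ) hx,
    radiiBilin_const]
  simp only [add_apply, smul_apply, innerBilin_apply, smul_eq_mul]
  rw [radiiBilin_eq_homExt hUs hx hv hv, homExt_eq_self hom, real_inner_self_eq_norm_sq]
  have h1 := fderiv_fderiv_nonneg_of_sublinear hom hadd
    (hU.contDiffAt (isOpen_ne.mem_nhds (ne_zero_of_norm_eq_one hx))) v
  have h2 : 0 < ‖v‖ := norm_pos_iff.2 hv0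
  positivity

end

section

variable {n : ℕ}

/-! ### Approximation by regular bodies -/

theorem hasDerivAt_posPart_pow (m : ℕ) (t : ℝ) :
    HasDerivAt (fun t : ℝ => max t 0 ^ (m + 2)) (((m + 2 : ℕ) : ℝ) * max t 0 ^ (m + 1)) t := by
  rcases lt_trichotomy t 0 with ht | ht | ht
  · have h : (fun t : ℝ => max t 0 ^ (m + 2)) =ᶠ[𝓝 t] fun _ => 0 := by
      filter_upwards [gt_mem_nhds ht] with s hs
      rw [max_eq_right (le_of_lt hs), zero_pow (by omega)]
    rw [max_eq_right ht.le, zero_pow (by omega), mul_zero]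
    exact (hasDerivAt_const t (0 : ℝ)).congr_of_eventuallyEq h
  · subst ht
    rw [max_self, zero_pow (by omega), mul_zero, hasDerivAt_iff_tendsto_slope_zero]
    have h : Tendsto (fun t : ℝ => max t 0 ^ (m + 1)) (𝓝[≠] 0) (𝓝 0) := by
      have : Continuous fun t : ℝ => max t 0 ^ (m + 1) := by fun_prop
      simpa using (this.tendsto 0).mono_left nhdsWithin_le_nhds
    refine h.congr' ?_
    filter_upwards [self_mem_nhdsWithin] with t ht
    have ht0 : t ≠ 0 := ht
    simp only [zero_add, max_self, smul_eq_mul, ne_eq, Nat.add_eq_zero_iff, OfNat.ofNat_ne_zero,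
      and_false, not_false_eq_true, zero_pow, sub_zero]
    rcases le_total t 0 with h | h
    · simp [max_eq_right h]
    · rw [max_eq_left h, pow_succ t (m + 1)]
      field_simp
  · have h : (fun t : ℝ => max t 0 ^ (m + 2)) =ᶠ[𝓝 t] fun t => t ^ (m + 2) := by
      filter_upwards [lt_mem_nhds ht] with s hs
      rw [max_eq_left (le_of_lt hs)]
    rw [max_eq_left ht.le]
    exact (hasDerivAt_pow (m + 2) t).congr_of_eventuallyEq h

theorem contDiff_posPart_pow (m r : ℕ) : ContDiff ℝ r fun t : ℝ => max t 0 ^ (m + r + 1) := by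
  induction r with
  | zero => exact contDiff_zero.2 (by fun_prop)
  | succ r ih =>
    have hd := hasDerivAt_posPart_pow (m + r)
    rw [Nat.cast_succ, contDiff_succ_iff_deriv]
    refine ⟨fun t => (hd t).differentiableAt, by simp, ?_⟩
    have : deriv (fun t : ℝ => max t 0 ^ (m + (r + 1) + 1)) =
        fun t => ((m + r + 2 : ℕ) : ℝ) * max t 0 ^ (m + r + 1) := by
      ext t; exact (hd t).deriv
    rw [this]
    exact contDiff_const.mul ih

/-- The support function of the `L^p` hull of a finite set of points. -/
def lpSupp (s : Finset (E n)) (p : ℕ) (x : E n) : ℝ :=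
  (∑ y ∈ s, max ⟪x, y⟫ 0 ^ p) ^ (1 / (p : ℝ))

theorem lpSupp_nonneg (s : Finset (E n)) (p : ℕ) (x : E n) : 0 ≤ lpSupp s p x := by
  unfold lpSupp; positivity

theorem lpSupp_smul (s : Finset (E n)) {p : ℕ} (hp : p ≠ 0) {t : ℝ} (ht : 0 < t) (x : E n) :
    lpSupp s p (t • x) = t * lpSupp s p x := by
  have h : ∀ y, max ⟪t • x, y⟫ 0 ^ p = t ^ p * max ⟪x, y⟫ 0 ^ p := fun y => by
    rw [real_inner_smul_left, ← mul_pow, mul_max_of_nonneg _ _ ht.le, mul_zero]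
  simp only [lpSupp, h]
  rw [← Finset.mul_sum, Real.mul_rpow (by positivity) (by positivity), one_div,
    Real.pow_rpow_inv_natCast ht.le hp]

theorem lpSupp_add_le (s : Finset (E n)) {p : ℕ} (hp : p ≠ 0) (x z : E n) :
    lpSupp s p (x + z) ≤ lpSupp s p x + lpSupp s p z := by
  have h1 : (1 : ℝ) ≤ p := by exact_mod_cast Nat.one_le_iff_ne_zero.2 hp
  have h := Real.Lp_add_le_of_nonneg s (f := fun y => max ⟪x, y⟫ 0) (g := fun y => max ⟪z, y⟫ 0) h1
    (fun y _ => le_max_right _ _) fun y _ => le_max_right _ _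
  simp only [Real.rpow_natCast] at h
  refine le_trans ?_ h
  unfold lpSupp
  refine Real.rpow_le_rpow (by positivity) (Finset.sum_le_sum fun y _ => ?_) (by positivity)
  refine pow_le_pow_left₀ (le_max_right _ _) (max_le ?_ (by positivity)) p
  rw [inner_add_left]
  exact add_le_add (le_max_left _ _) (le_max_left _ _)

theorem inner_le_lpSupp {s : Finset (E n)} {p : ℕ} (hp : p ≠ 0) {y : E n} (hy : y ∈ s) (x : E n) :
    ⟪x, y⟫ ≤ lpSupp s p x := by
  have h1 : max ⟪x, y⟫ 0 = (max ⟪x, y⟫ 0 ^ p) ^ (1 / (p : ℝ)) := by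
    rw [one_div, Real.pow_rpow_inv_natCast (le_max_right _ _) hp]
  refine (le_max_left _ 0).trans (h1.le.trans ?_)
  refine Real.rpow_le_rpow (by positivity) ?_ (by positivity)
  exact Finset.single_le_sum (f := fun y => max ⟪x, y⟫ 0 ^ p) (fun _ _ => by positivity) hy

theorem lpSupp_le {s : Finset (E n)} {p : ℕ} (hp : p ≠ 0) {x : E n} {h : ℝ} (h0 : 0 ≤ h)
    (hs : ∀ y ∈ s, ⟪x, y⟫ ≤ h) : lpSupp s p x ≤ (s.card : ℝ) ^ (1 / (p : ℝ)) * h := by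
  have h1 : ∑ y ∈ s, max ⟪x, y⟫ 0 ^ p ≤ s.card * h ^ p := by
    rw [← nsmul_eq_mul]
    exact Finset.sum_le_card_nsmul _ _ _ fun y hy =>
      pow_le_pow_left₀ (le_max_right _ _) (max_le (hs y hy) h0) p
  refine (Real.rpow_le_rpow (by positivity) h1 (by positivity)).trans ?_
  rw [Real.mul_rpow (by positivity) (by positivity), one_div, Real.pow_rpow_inv_natCast h0 hp]

/-- Positive parts to a power at least 3 are C², and the hypothesis on s keeps the sum away from 0,
where the root is not smooth. -/
theorem contDiffOn_lpSupp {s : Finset (E n)} (m : ℕ)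
    (hs : ∀ x, x ≠ 0 → ∃ y ∈ s, 0 < ⟪x, y⟫) : ContDiffOn ℝ 2 (lpSupp s (m + 3)) {0}ᶜ := by
  have hsum : ContDiff ℝ 2 fun x : E n => ∑ y ∈ s, max ⟪x, y⟫ 0 ^ (m + 3) :=
    ContDiff.sum fun y _ => (contDiff_posPart_pow m 2).comp (contDiff_id.inner ℝ contDiff_const)
  intro x hx
  refine (hsum.contDiffAt.rpow_const_of_ne ?_).contDiffWithinAt
  obtain ⟨y, hy, hpos⟩ := hs x hx
  refine ne_of_gt (Finset.sum_pos' (fun _ _ => by positivity) ⟨y, hy, ?_⟩)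
  rw [max_eq_left hpos.le]
  positivity

/-- The ℓ^p hull of a finite η-net of M, for p large, has a C² support function close to that of M,
and adding a ball of radius η makes the radii positive. -/
theorem exists_regular_dist_lt (M : ConvexBody (E n)) {m : ℝ} (hm : 0 < m)
    (hM : ∀ x, ‖x‖ = 1 → m ≤ supp M x) {ε : ℝ} (hε : 0 < ε) :
    ∃ N : ConvexBody (E n), IsRegular 2 N ∧ dist N M < ε := by
  obtain ⟨R, hR0, hR⟩ := exists_norm_le M
  have hsuppR : ∀ x : E n, ‖x‖ = 1 → supp M x ≤ R := fun x hx => supp_le fun y hy => by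
    have := real_inner_le_norm x y
    rw [hx, one_mul] at this
    exact this.trans (hR y hy)
  -- The total error will be 2η, while η < m makes some point of the net lie strictly on the
  -- positive side of every direction.
  obtain ⟨η, hη, hηε, hηm⟩ : ∃ η : ℝ, 0 < η ∧ 2 * η < ε ∧ η < m :=
    ⟨min (ε / 4) (m / 2), by positivity, by linarith [min_le_left (ε / 4) (m / 2)],
      by linarith [min_le_right (ε / 4) (m / 2)]⟩
  obtain ⟨t, htM, htf, hcov⟩ := M.isCompact.finite_cover_balls hη
  let s := htf.toFinset
  have hs : ∀ x : E n, ‖x‖ = 1 → ∃ y ∈ s, supp M x - η ≤ ⟪x, y⟫ := by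
    intro x hx
    obtain ⟨z, hz, hzx⟩ := exists_inner_eq_supp M x
    obtain ⟨y, hy, hzy⟩ := Set.mem_iUnion₂.1 (hcov hz)
    refine ⟨y, htf.mem_toFinset.2 hy, ?_⟩
    have h1 : ⟪x, z⟫ = ⟪x, z - y⟫ + ⟪x, y⟫ := by rw [inner_sub_right]; ring
    have h2 := real_inner_le_norm x (z - y)
    rw [hx, one_mul, ← dist_eq_norm] at h2
    have h3 : dist z y < η := hzy
    rw [← hzx, h1]; linarith
  have hsM : ∀ y ∈ s, y ∈ M := fun y hy => htM (htf.mem_toFinset.1 hy)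
  have hs0 : ∀ x : E n, x ≠ 0 → ∃ y ∈ s, 0 < ⟪x, y⟫ := by
    intro x hx
    have hx0 : 0 < ‖x‖ := norm_pos_iff.2 hx
    have hx1 : ‖‖x‖⁻¹ • x‖ = 1 := by simp [norm_smul, hx]
    obtain ⟨y, hy, h⟩ := hs _ hx1
    refine ⟨y, hy, ?_⟩
    have h1 := hM _ hx1
    rw [real_inner_smul_left] at h
    exact pos_of_mul_pos_right (by linarith : 0 < ‖x‖⁻¹ * ⟪x, y⟫) (by positivity)
  have hcard : s.card ≠ 0 := by
    have hx1 : ‖(stdVec 0 : E n)‖ = 1 := by simp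
    obtain ⟨y, hy, -⟩ := hs _ hx1
    exact Finset.card_ne_zero_of_mem hy
  have hlim : Tendsto (fun p : ℕ => (s.card : ℝ) ^ (1 / (p : ℝ))) atTop (𝓝 1) := by
    have h1 := tendsto_const_div_atTop_nhds_zero_nat (1 : ℝ)
    have h2 : ContinuousAt (fun q : ℝ => (s.card : ℝ) ^ q) 0 :=
      Real.continuousAt_const_rpow (by exact_mod_cast hcard)
    have h3 := h2.tendsto.comp h1
    simpa [Function.comp_def] using h3
  -- The ℓ^p norm exceeds the maximum by at most the factor card^(1/p), here below 1 + η/R; p ≥ 3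
  -- gives class C².
  obtain ⟨p, hp3, hp⟩ := ((eventually_ge_atTop 3).and
    (hlim.eventually_lt_const (show 1 < 1 + η / R by
      have : 0 < η / R := by positivity
      linarith))).exists
  obtain ⟨q, rfl⟩ := Nat.exists_eq_add_of_le' hp3
  have hq : q + 3 ≠ 0 := by omega
  let U := lpSupp s (q + 3)
  have hom : ∀ t : ℝ, 0 < t → ∀ x, U (t • x) = t * U x := fun t ht x => lpSupp_smul s hq ht x
  have hadd : ∀ x y, U (x + y) ≤ U x + U y := lpSupp_add_le s hq
  have hreg := radiiPos_add_norm hom hadd (contDiffOn_lpSupp q hs0) hη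
  have hV0 : ∀ x, 0 ≤ U x + η * ‖x‖ := fun x => by
    have := lpSupp_nonneg s (q + 3) x
    positivity
  have hsupp : supp (bodyOf (fun x => U x + η * ‖x‖) hV0) = fun x => U x + η * ‖x‖ := by
    refine supp_bodyOf hV0 (fun t ht x => ?_) fun x y => ?_
    · rw [hom t ht, norm_smul, Real.norm_eq_abs, abs_of_pos ht]; ring
    · have h1 := hadd x y
      have h2 := mul_le_mul_of_nonneg_left (norm_add_le x y) hη.le
      linarith
  refine ⟨bodyOf (fun x => U x + η * ‖x‖) hV0, ?_, ?_⟩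
  · rw [IsRegular, hsupp]; exact hreg
  · refine (dist_le_of_supp (by positivity : 0 ≤ 2 * η) fun x hx => ?_).trans_lt hηε
    rw [hsupp]
    dsimp only
    rw [hx, mul_one]
    obtain ⟨y, hy, hxy⟩ := hs x hx
    have h1 : ⟪x, y⟫ ≤ U x := inner_le_lpSupp hq hy x
    have hsx : 0 ≤ supp M x := hm.le.trans (hM x hx)
    have h2 : U x ≤ _ := lpSupp_le hq hsx fun y hy => inner_le_supp (hsM y hy) x
    have h3 : ((s.card : ℝ) ^ (1 / ((q + 3 : ℕ) : ℝ))) * supp M x ≤ (1 + η / R) * supp M x :=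
      mul_le_mul_of_nonneg_right hp.le hsx
    have h4 : η / R * supp M x ≤ η := by
      rw [div_mul_eq_mul_div, div_le_iff₀ hR0]
      exact mul_le_mul_of_nonneg_left (hsuppR x hx) hη.le
    rw [abs_le]
    constructor <;> linarith

/-! ### The quermassintegral of bodies with the origin in the interior -/

variable {F : (Fin n → ℝ) → ℝ} {k : ℕ}

theorem quermass_of_isRegular {M : ConvexBody (E n)} (hM : IsRegular 2 M) :
    quermass F k M = quermassFun F k (supp M) := by
  rw [quermass, if_pos hM]
  rfl

/-- The lower bound m on the support function converts Hausdorff closeness into closeness up to a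
factor, the form in which homogeneity of W can be used. -/
theorem eventually_mul_supp_le (M : ConvexBody (E n)) {m : ℝ} (hm : 0 < m)
    (hM : ∀ x, ‖x‖ = 1 → m ≤ supp M x) {s : ℝ} (hs0 : 0 < s) (hs1 : s < 1) :
    ∀ᶠ N in 𝓝 M, ∀ x, ‖x‖ = 1 → s * supp M x ≤ supp N x ∧ s * supp N x ≤ supp M x := by
  have hpos : 0 < (1 - s) * m := mul_pos (by linarith) hm
  filter_upwards [Metric.ball_mem_nhds M hpos] with N hN x hx
  have hd : dist N M < (1 - s) * m := hN
  have h1 := supp_sub_le_dist N M hx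
  have h2 := supp_sub_le_dist M N hx
  rw [dist_comm] at h2
  have h3 : (1 - s) * m ≤ (1 - s) * supp M x :=
    mul_le_mul_of_nonneg_left (hM x hx) (by linarith)
  constructor
  · linarith
  · have h4 : s * (supp N x - supp M x) ≤ s * ((1 - s) * supp M x) :=
      mul_le_mul_of_nonneg_left (by linarith) hs0.le
    have h5 : 0 ≤ (1 - s) * ((1 - s) * supp M x) :=
      mul_nonneg (by linarith) (by linarith)
    nlinarith

/-- The quermassintegral is monotone with respect to comparison with regular functions. -/
theorem quermass_sandwich (hF : IsAdmissible F k) (M : ConvexBody (E n)) {m : ℝ} (hm : 0 < m)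
    (hM : ∀ x, ‖x‖ = 1 → m ≤ supp M x) {u v : E n → ℝ} (hu : SphereContDiff 2 u)
    (hv : SphereContDiff 2 v) (hpu : RadiiPos u) (hpv : RadiiPos v)
    (h1 : ∀ x, ‖x‖ = 1 → u x ≤ supp M x) (h2 : ∀ x, ‖x‖ = 1 → supp M x ≤ v x) :
    quermassFun F k u ≤ quermass F k M ∧ quermass F k M ≤ quermassFun F k v := by
  by_cases hreg : IsRegular 2 M
  · rw [quermass_of_isRegular hreg]
    exact ⟨quermassFun_mono hF hu hreg.1 hpu hreg.2 h1, quermassFun_mono hF hreg.1 hv hreg.2 hpv h2⟩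
  -- The value of `extendFrom` is determined only at points of the closure of the regular bodies
  -- where the limit exists.
  have hcl : M ∈ closure {N : ConvexBody (E n) | IsRegular 2 N} := by
    refine Metric.mem_closure_iff.2 fun ε hε => ?_
    obtain ⟨N, hN, hd⟩ := exists_regular_dist_lt M hm hM hε
    exact ⟨N, hN, by rwa [dist_comm]⟩
  -- The limit is identified as the supremum of W over the regular functions below the support
  -- function of M.
  let T : Set ℝ := {q | ∃ u : E n → ℝ, SphereContDiff 2 u ∧ RadiiPos u ∧
    (∀ x, ‖x‖ = 1 → u x ≤ supp M x) ∧ q = quermassFun F k u}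
  have hTne : T.Nonempty := ⟨_, u, hu, hpu, h1, rfl⟩
  have hTle : ∀ q ∈ T, q ≤ quermassFun F k v := by
    rintro _ ⟨u', hu', hpu', hle, rfl⟩
    exact quermassFun_mono hF hu' hv hpu' hpv fun x hx => (hle x hx).trans (h2 x hx)
  have hTb : BddAbove T := ⟨_, hTle⟩
  -- For regular N near M, s times any competitor in T lies below u_N, and s u_N is itself a
  -- competitor; W scales by s^(k+1).
  have hs : ∀ s : ℝ, 0 < s → s < 1 → ∀ᶠ N in 𝓝[{N : ConvexBody (E n) | IsRegular 2 N}] M,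
      s ^ (k + 1) * sSup T ≤ quermassRegular F k N ∧
      s ^ (k + 1) * quermassRegular F k N ≤ sSup T := by
    intro s hs0 hs1
    filter_upwards [self_mem_nhdsWithin,
      nhdsWithin_le_nhds (eventually_mul_supp_le M hm hM hs0 hs1)] with N hN hNs
    have hw : quermassRegular F k N = quermassFun F k (supp N) := rfl
    have hN' : IsRegular 2 N := hN
    have hsk : 0 < s ^ (k + 1) := by positivity
    rw [hw]
    constructor
    · rw [mul_comm, ← le_div_iff₀ hsk]
      refine csSup_le hTne ?_
      rintro _ ⟨u', hu', hpu', hle, rfl⟩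
      rw [le_div_iff₀ hsk, mul_comm, ← quermassFun_smul hF hu' hpu' hs0]
      refine quermassFun_mono hF (hu'.const_smul s) hN'.1 (hpu'.smul hu' hs0) hN'.2 fun x hx => ?_
      exact (mul_le_mul_of_nonneg_left (hle x hx) hs0.le).trans (hNs x hx).1
    · rw [← quermassFun_smul hF hN'.1 hN'.2 hs0]
      exact le_csSup hTb ⟨_, hN'.1.const_smul s, hN'.2.smul hN'.1 hs0, fun x hx => (hNs x hx).2, rfl⟩
  have hpow : ∀ a : ℝ, Tendsto (fun s : ℝ => s ^ (k + 1) * a) (𝓝[<] 1) (𝓝 a) := fun a => by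
    have : Continuous fun s : ℝ => s ^ (k + 1) * a := by fun_prop
    simpa using (this.tendsto 1).mono_left nhdsWithin_le_nhds
  have hs01 : ∀ᶠ s : ℝ in 𝓝[<] 1, 0 < s ∧ s < 1 := by
    filter_upwards [self_mem_nhdsWithin,
      nhdsWithin_le_nhds (lt_mem_nhds (zero_lt_one (α := ℝ)))] with s h1 h2 using ⟨h2, h1⟩
  have hlim : Tendsto (quermassRegular F k) (𝓝[{N : ConvexBody (E n) | IsRegular 2 N}] M)
      (𝓝 (sSup T)) := by
    refine tendsto_order.2 ⟨fun a ha => ?_, fun a ha => ?_⟩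
    · obtain ⟨s, hsa, hs0, hs1⟩ :=
        (((hpow (sSup T)).eventually_const_lt ha).and hs01).exists
      filter_upwards [hs s hs0 hs1] with N hN using hsa.trans_le hN.1
    · obtain ⟨s, hsa, hs0, hs1⟩ :=
        (((hpow a).eventually_const_lt ha).and hs01).exists
      filter_upwards [hs s hs0 hs1] with N hN
      exact lt_of_mul_lt_mul_left (hN.2.trans_lt hsa) (by positivity)
  have hq : quermass F k M = sSup T := by
    rw [quermass, if_neg hreg]
    exact extendFrom_eq hcl hlim
  rw [hq]
  exact ⟨le_csSup hTb ⟨u, hu, hpu, h1, rfl⟩, csSup_le hTne hTle⟩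

end

/-! ### Orlicz perturbations and the variational formula. -/

section

variable {n : ℕ}

/-! ### Orlicz functions -/

section

variable {φ φ₁ φ₂ : ℝ → ℝ}

theorem IsOrlicz.mono (h : IsOrlicz φ) {s t : ℝ} (hs : 0 ≤ s) (hst : s ≤ t) : φ s ≤ φ t :=
  h.strictMonoOn.monotoneOn hs (hs.trans hst : 0 ≤ t) hst

theorem IsOrlicz.nonneg (h : IsOrlicz φ) {t : ℝ} (ht : 0 ≤ t) : 0 ≤ φ t := by
  rw [← h.map_zero]; exact h.mono le_rfl ht

theorem IsOrlicz.le_self (h : IsOrlicz φ) {t : ℝ} (ht : 0 ≤ t) (ht1 : t ≤ 1) : φ t ≤ t := by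
  have := h.convexOn.2 (x := 0) (y := 1) (le_refl (0 : ℝ)) (zero_le_one : (0 : ℝ) ≤ 1)
    (sub_nonneg.2 ht1) ht (by ring)
  simpa [h.map_zero, h.map_one] using this

/-- By convexity the slope on [s, t] is at most the slope on [t, T + 1], an interval of length at
least 1 on which φ rises by at most φ(T + 1). -/
theorem IsOrlicz.sub_le (h : IsOrlicz φ) {T s t : ℝ} (hs : 0 ≤ s) (hst : s ≤ t) (ht : t ≤ T) :
    φ t - φ s ≤ φ (T + 1) * (t - s) := by
  rcases hst.eq_or_lt with rfl | hst
  · simp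
  have hT : (0 : ℝ) ≤ T + 1 := by linarith
  have h1 := h.convexOn.slope_mono_adjacent (x := s) (y := t) (z := T + 1) hs hT hst (by linarith)
  rw [div_le_iff₀ (by linarith)] at h1
  refine h1.trans (mul_le_mul_of_nonneg_right ?_ (by linarith))
  rw [div_le_iff₀ (by linarith)]
  have h2 := h.nonneg (hs.trans hst.le)
  have h3 := h.nonneg hT
  nlinarith

theorem IsOrlicz.continuousOn (h : IsOrlicz φ) (T : ℝ) : ContinuousOn φ (Icc 0 T) := by
  refine (LipschitzOnWith.of_dist_le_mul (K := (φ (T + 1)).toNNReal) fun s hs t ht => ?_).continuousOn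
  have hT : 0 ≤ φ (T + 1) := h.nonneg (by linarith [hs.1, hs.2])
  rw [Real.coe_toNNReal _ hT, Real.dist_eq, Real.dist_eq]
  rcases le_total s t with hst | hst
  · rw [abs_sub_comm, abs_sub_comm s, abs_of_nonneg (sub_nonneg.2 (h.mono hs.1 hst)),
      abs_of_nonneg (sub_nonneg.2 hst)]
    exact h.sub_le hs.1 hst ht.2
  · rw [abs_of_nonneg (sub_nonneg.2 (h.mono ht.1 hst)), abs_of_nonneg (sub_nonneg.2 hst)]
    exact h.sub_le ht.1 hst hs.2

theorem IsOrlicz.slope_le (h : IsOrlicz φ) {t : ℝ} (ht : 0 ≤ t) (ht1 : t < 1) :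
    1 - φ t ≤ leftDeriv φ 1 * (1 - t) := by
  have h1 := h.convexOn.slope_le_leftDeriv_of_mem_interior (x := t) (y := 1) ht (by simp) ht1
  rw [slope_def_field, h.map_one, div_le_iff₀ (by linarith)] at h1
  exact h1

theorem IsOrlicz.leftDeriv_pos (h : IsOrlicz φ) : 0 < leftDeriv φ 1 := by
  have := h.slope_le le_rfl zero_lt_one
  rw [h.map_zero] at this
  linarith

theorem IsOrlicz.exists_le_sub (h : IsOrlicz φ) {η : ℝ} (hη : 0 < η) :
    ∃ t₀ < 1, ∀ t ∈ Ioo t₀ 1, φ t ≤ 1 - (leftDeriv φ 1 - η) * (1 - t) := by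
  have h1 : HasDerivWithinAt φ (leftDeriv φ 1) (Iio 1) 1 :=
    h.convexOn.hasDerivWithinAt_leftDeriv_of_mem_interior (by simp)
  rw [hasDerivWithinAt_iff_tendsto_slope' (by simp)] at h1
  have h2 := h1.eventually_const_lt (show leftDeriv φ 1 - η < leftDeriv φ 1 by linarith)
  obtain ⟨t₀, ht₀, hsub⟩ := (mem_nhdsLT_iff_exists_Ioo_subset).1 h2
  refine ⟨t₀, ht₀, fun t ht => ?_⟩
  have h3 : leftDeriv φ 1 - η < slope φ 1 t := hsub ht
  rw [slope_comm, slope_def_field, h.map_one, lt_div_iff₀ (by linarith [ht.2])] at h3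
  linarith

/-- The set whose infimum is the value of the Orlicz combination. -/
def orliczSet (φ₁ φ₂ : ℝ → ℝ) (ε a b : ℝ) : Set ℝ :=
  {l | 0 < l ∧ 1 * φ₁ (a / l) + ε * φ₂ (b / l) ≤ 1}

theorem orliczSet_nonempty (h₁ : IsOrlicz φ₁) (h₂ : IsOrlicz φ₂) {ε a b : ℝ} (hε : 0 ≤ ε)
    (ha : 0 ≤ a) (hb : 0 ≤ b) : (orliczSet φ₁ φ₂ ε a b).Nonempty := by
  have hεb : 0 ≤ ε * b := mul_nonneg hε hb
  have hl : 0 < a + b + ε * b + 1 := by linarith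
  -- This l makes both quotients at most 1, where φ(t) ≤ t, and their weighted sum at most 1.
  refine ⟨a + b + ε * b + 1, hl, ?_⟩
  have e1 := h₁.le_self (div_nonneg ha hl.le) ((div_le_one hl).2 (by linarith))
  have e2 := mul_le_mul_of_nonneg_left
    (h₂.le_self (div_nonneg hb hl.le) ((div_le_one hl).2 (by linarith))) hε
  have e3 : a / (a + b + ε * b + 1) + ε * (b / (a + b + ε * b + 1)) ≤ 1 := by
    rw [← mul_div_assoc, ← add_div, div_le_one hl]
    linarith
  linarith

theorem bddBelow_orliczSet (φ₁ φ₂ : ℝ → ℝ) (ε a b : ℝ) : BddBelow (orliczSet φ₁ φ₂ ε a b) :=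
  ⟨0, fun _ h => h.1.le⟩

/-- Subadditivity of the perspective l φ(a/l) of a convex function, divided by l₁ + l₂. It is the
source of the sublinearity of the Orlicz combination. -/
theorem IsOrlicz.map_div_add_le (h : IsOrlicz φ) {a a₁ a₂ l₁ l₂ : ℝ} (ha : 0 ≤ a) (ha₁ : 0 ≤ a₁)
    (ha₂ : 0 ≤ a₂) (hl₁ : 0 < l₁) (hl₂ : 0 < l₂) (hle : a ≤ a₁ + a₂) :
    φ (a / (l₁ + l₂)) ≤
      l₁ / (l₁ + l₂) * φ (a₁ / l₁) + l₂ / (l₁ + l₂) * φ (a₂ / l₂) := by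
  have hl : 0 < l₁ + l₂ := by positivity
  have h1 := h.convexOn.2 (show a₁ / l₁ ∈ Ici (0 : ℝ) from div_nonneg ha₁ hl₁.le)
    (show a₂ / l₂ ∈ Ici (0 : ℝ) from div_nonneg ha₂ hl₂.le)
    (show 0 ≤ l₁ / (l₁ + l₂) by positivity) (show 0 ≤ l₂ / (l₁ + l₂) by positivity) (by field_simp)
  refine le_trans (h.mono (div_nonneg ha hl.le) ?_) h1
  simp only [smul_eq_mul]
  have e : l₁ / (l₁ + l₂) * (a₁ / l₁) + l₂ / (l₁ + l₂) * (a₂ / l₂) = (a₁ + a₂) / (l₁ + l₂) := by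
    field_simp
  rw [e]
  gcongr

theorem add_mem_orliczSet (h₁ : IsOrlicz φ₁) (h₂ : IsOrlicz φ₂) {ε a a₁ a₂ b b₁ b₂ l₁ l₂ : ℝ}
    (hε : 0 ≤ ε) (ha : 0 ≤ a) (ha₁ : 0 ≤ a₁) (ha₂ : 0 ≤ a₂) (hb : 0 ≤ b) (hb₁ : 0 ≤ b₁)
    (hb₂ : 0 ≤ b₂) (hale : a ≤ a₁ + a₂) (hble : b ≤ b₁ + b₂)
    (hl₁ : l₁ ∈ orliczSet φ₁ φ₂ ε a₁ b₁) (hl₂ : l₂ ∈ orliczSet φ₁ φ₂ ε a₂ b₂) :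
    l₁ + l₂ ∈ orliczSet φ₁ φ₂ ε a b := by
  obtain ⟨hp₁, hq₁⟩ := hl₁
  obtain ⟨hp₂, hq₂⟩ := hl₂
  have hl : 0 < l₁ + l₂ := by positivity
  refine ⟨hl, ?_⟩
  have e1 := h₁.map_div_add_le ha ha₁ ha₂ hp₁ hp₂ hale
  have e2 := mul_le_mul_of_nonneg_left (h₂.map_div_add_le hb hb₁ hb₂ hp₁ hp₂ hble) hε
  have e3 := mul_le_mul_of_nonneg_left hq₁ (by positivity : 0 ≤ l₁ / (l₁ + l₂))
  have e4 := mul_le_mul_of_nonneg_left hq₂ (by positivity : 0 ≤ l₂ / (l₁ + l₂))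
  have e5 : l₁ / (l₁ + l₂) + l₂ / (l₁ + l₂) = 1 := by field_simp
  linarith

/-- The first order expansion of the Orlicz combination, uniformly on compact sets. -/
theorem orlicz_expansion (h₁ : IsOrlicz φ₁) (h₂ : IsOrlicz φ₂) {m R δ : ℝ} (hm : 0 < m)
    (hmR : m ≤ R) (hδ : 0 < δ) : ∀ᶠ ε : ℝ in 𝓝[>] 0, ∀ a ∈ Icc m R, ∀ b ∈ Icc 0 R,
      a + ε * (a / leftDeriv φ₁ 1 * φ₂ (b / a) - δ) ≤ sInf (orliczSet φ₁ φ₂ ε a b) ∧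
      sInf (orliczSet φ₁ φ₂ ε a b) ≤ a + ε * (a / leftDeriv φ₁ 1 * φ₂ (b / a) + δ) := by
  have hR : 0 < R := hm.trans_le hmR
  set d := leftDeriv φ₁ 1 with hd
  have hd0 : 0 < d := h₁.leftDeriv_pos
  set G := R / d * φ₂ (R / m) with hG
  have hG0 : 0 ≤ G := mul_nonneg (by positivity) (h₂.nonneg (by positivity))
  -- G bounds the first-order term g, so this slope error times g + δ stays below dδ/2, half of the
  -- available margin.
  obtain ⟨t₀, ht₀, hlin⟩ := h₁.exists_le_sub (η := d * δ / (2 * (G + δ))) (by positivity)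
  rw [← hd] at hlin
  set C := φ₂ (R / m + 1) with hC
  have hev1 : ∀ᶠ ε : ℝ in 𝓝 0, ε * (G + δ) < m * (1 - t₀) :=
    (Continuous.tendsto (by fun_prop) 0).eventually_lt_const (by
      rw [zero_mul]; exact mul_pos hm (by linarith))
  have hev2 : ∀ᶠ ε : ℝ in 𝓝 0, ε * (G * (G + δ)) < m * δ / 2 :=
    (Continuous.tendsto (by fun_prop) 0).eventually_lt_const (by rw [zero_mul]; positivity)
  have hev3 : ∀ᶠ ε : ℝ in 𝓝 0, C * (R * (ε * G) / (m * m)) < d * δ / R :=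
    (Continuous.tendsto (by fun_prop) 0).eventually_lt_const (by simp; positivity)
  filter_upwards [self_mem_nhdsWithin, nhdsWithin_le_nhds hev1, nhdsWithin_le_nhds hev2,
    nhdsWithin_le_nhds hev3] with ε hε he1 he2 he3 a ha b hb
  have hε0 : (0 : ℝ) < ε := hε
  have ha0 : 0 < a := hm.trans_le ha.1
  have hba : b / a ≤ R / m := div_le_div₀ hR.le hb.2 hm ha.1
  have hba0 : 0 ≤ b / a := div_nonneg hb.1 ha0.le
  set P := φ₂ (b / a) with hP
  have hP0 : 0 ≤ P := h₂.nonneg hba0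
  set g := a / d * P with hg
  have hg0 : 0 ≤ g := by positivity
  have hgG : g ≤ G := mul_le_mul (div_le_div_of_nonneg_right ha.2 hd0.le) (h₂.mono hba0 hba) hP0
    (by positivity)
  have hdg : d * g = a * P := by rw [hg]; field_simp
  constructor
  -- Lower bound: an admissible l below a + ε(g - δ) forces φ₂(b/l) < φ₂(b/a) - dδ/a by the tangent
  -- bound for φ₁, whereas l - a = O(ε) and the Lipschitz bound for φ₂ keep these values close.
  · refine le_csInf (orliczSet_nonempty h₁ h₂ hε0.le ha0.le hb.1) ?_
    rintro l ⟨hl0, hl⟩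
    by_contra hlt
    rw [not_le] at hlt
    have hφ2 : 0 ≤ φ₂ (b / l) := h₂.nonneg (div_nonneg hb.1 hl0.le)
    have hal : a / l ≤ 1 := by
      have : φ₁ (a / l) ≤ φ₁ 1 := by
        rw [h₁.map_one]; nlinarith [mul_nonneg hε0.le hφ2]
      exact (h₁.strictMonoOn.le_iff_le (div_nonneg ha0.le hl0.le) (zero_le_one : (0 : ℝ) ≤ 1)).1 this
    have hla : a ≤ l := (div_le_one hl0).1 hal
    have hs : 1 - φ₁ (a / l) ≤ d * (1 - a / l) := by
      rcases hal.eq_or_lt with h | h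
      · rw [h, h₁.map_one]; simp
      · exact h₁.slope_le (div_nonneg ha0.le hl0.le) h
    have e1 : 1 - a / l ≤ (l - a) / a := by
      have : 1 - a / l = (l - a) / l := by field_simp
      rw [this]
      exact div_le_div_of_nonneg_left (by linarith) ha0 hla
    have e2 : (l - a) / a < ε * (g - δ) / a := div_lt_div_of_pos_right (by linarith) ha0
    have e3 : ε * φ₂ (b / l) < ε * (P - d * δ / a) := by
      have : d * (ε * (g - δ) / a) = ε * (P - d * δ / a) := by
        have : d * (ε * (g - δ) / a) = ε * (d * g - d * δ) / a := by ring
        rw [this, hdg]; field_simp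
      rw [← this]
      have h5 := mul_lt_mul_of_pos_left (e1.trans_lt e2) hd0
      linarith
    have e4 : φ₂ (b / l) < P - d * δ / a := lt_of_mul_lt_mul_left e3 hε0.le
    have hbl : b / l ≤ b / a := div_le_div_of_nonneg_left hb.1 ha0 hla
    have e5 : P - φ₂ (b / l) ≤ C * (b / a - b / l) :=
      h₂.sub_le (div_nonneg hb.1 hl0.le) hbl hba
    have e6 : b / a - b / l ≤ R * (ε * G) / (m * m) := by
      have : b / a - b / l = b * (l - a) / (a * l) := by field_simp
      rw [this]
      refine div_le_div₀ (by positivity) ?_ (by positivity)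
        (mul_le_mul ha.1 (ha.1.trans hla) hm.le ha0.le)
      refine mul_le_mul hb.2 ?_ (by linarith) hR.le
      have : ε * (g - δ) ≤ ε * G := mul_le_mul_of_nonneg_left (by linarith) hε0.le
      linarith
    have hC0 : 0 ≤ C := h₂.nonneg (by positivity)
    have e7 := mul_le_mul_of_nonneg_left e6 hC0
    have e8 : d * δ / R ≤ d * δ / a := div_le_div_of_nonneg_left (by positivity) ha0 ha.2
    linarith
  -- Upper bound: l = a + ε(g + δ) itself is admissible, because φ₁ drops from 1 almost at the rate
  -- d as its argument moves left from 1.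
  · set l := a + ε * (g + δ) with hl
    have hal : a < l := by
      have : 0 < ε * (g + δ) := by positivity
      linarith
    have hl0 : 0 < l := ha0.trans hal
    refine csInf_le (bddBelow_orliczSet _ _ _ _ _) ⟨hl0, ?_⟩
    have e1 : 1 - a / l = ε * (g + δ) / l := by
      rw [hl]; field_simp; ring
    have e2 : ε * (g + δ) / l < 1 - t₀ := by
      rw [div_lt_iff₀ hl0]
      have h1 : ε * (g + δ) ≤ ε * (G + δ) := mul_le_mul_of_nonneg_left (by linarith) hε0.le
      have h2 : m * (1 - t₀) ≤ (1 - t₀) * l := by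
        rw [mul_comm]
        exact mul_le_mul_of_nonneg_left (ha.1.trans hal.le) (by linarith)
      linarith
    have e3 := hlin (a / l) ⟨by linarith, (div_lt_one hl0).2 hal⟩
    have e4 : φ₂ (b / l) ≤ P :=
      h₂.mono (div_nonneg hb.1 hl0.le) (div_le_div_of_nonneg_left hb.1 ha0 hal.le)
    have e5 : d * δ / (2 * (G + δ)) * (g + δ) ≤ d * δ / 2 := by
      rw [div_mul_eq_mul_div, div_le_div_iff₀ (by positivity) (by norm_num)]
      have : d * δ * (g + δ) ≤ d * δ * (G + δ) :=
        mul_le_mul_of_nonneg_left (by linarith) (by positivity)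
      linarith
    -- After multiplication by a, the relation d g = a P leaves a margin dδa/2 on the right, which
    -- absorbs the second-order term dε g(g + δ).
    have e6 : P * l ≤ (d - d * δ / (2 * (G + δ))) * (g + δ) := by
      refine le_of_mul_le_mul_left ?_ ha0
      have h1 : a * (P * l) = d * g * a + d * (ε * (g * (g + δ))) := by
        rw [← mul_assoc, ← hdg, hl]; ring
      have h2 : ε * (g * (g + δ)) ≤ ε * (G * (G + δ)) := by gcongr
      have h3 : d * (ε * (g * (g + δ))) ≤ d * (m * δ / 2) :=
        mul_le_mul_of_nonneg_left (h2.trans he2.le) hd0.le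
      have h4 : m * (d * δ / 2) ≤ a * (d * δ / 2) :=
        mul_le_mul_of_nonneg_right ha.1 (by positivity)
      have h5 := mul_le_mul_of_nonneg_left e5 ha0.le
      rw [h1]
      linarith
    have e7 : ε * P ≤ (d - d * δ / (2 * (G + δ))) * (ε * (g + δ) / l) := by
      have : (d - d * δ / (2 * (G + δ))) * (ε * (g + δ) / l) =
          ε * ((d - d * δ / (2 * (G + δ))) * (g + δ) / l) := by ring
      rw [this]
      exact mul_le_mul_of_nonneg_left ((le_div_iff₀ hl0).2 e6) hε0.le
    rw [e1] at e3
    have e8 := mul_le_mul_of_nonneg_left e4 hε0.le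
    linarith

end

/-! ### Orlicz combinations of convex bodies -/

theorem exists_le_supp {K : ConvexBody (E n)} (h : (0 : E n) ∈ interior (K : Set (E n))) :
    ∃ m, 0 < m ∧ ∀ x, ‖x‖ = 1 → m ≤ supp K x := by
  obtain ⟨r, hr, hsub⟩ := Metric.isOpen_iff.1 isOpen_interior 0 h
  refine ⟨r / 2, by positivity, fun x hx => ?_⟩
  have hmem : (r / 2) • x ∈ K := by
    refine interior_subset (hsub ?_)
    rw [mem_ball_zero_iff, norm_smul, hx, mul_one, Real.norm_eq_abs, abs_of_pos (by positivity)]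
    linarith
  have := inner_le_supp hmem x
  rwa [real_inner_smul_right, real_inner_self_eq_norm_sq, hx, one_pow, mul_one] at this

theorem orliczSupp_eq (φ₁ φ₂ : ℝ → ℝ) (K L : ConvexBody (E n)) (ε : ℝ) (x : E n) :
    orliczSupp φ₁ φ₂ K L 1 ε x = sInf (orliczSet φ₁ φ₂ ε (supp K x) (supp L x)) := rfl

variable {φ₁ φ₂ : ℝ → ℝ} {K L : ConvexBody (E n)}

/-- The function `orliczSupp` is sublinear: scaling x scales the admissible l, and admissible values
for x and y add up to one for x + y. -/
theorem supp_orliczComb (h₁ : IsOrlicz φ₁) (h₂ : IsOrlicz φ₂) (hK : (0 : E n) ∈ K)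
    (hL : (0 : E n) ∈ L) {ε : ℝ} (hε : 0 ≤ ε) :
    supp (orliczComb φ₁ φ₂ K L 1 ε) = orliczSupp φ₁ φ₂ K L 1 ε := by
  have hne : ∀ x, (orliczSet φ₁ φ₂ ε (supp K x) (supp L x)).Nonempty := fun x =>
    orliczSet_nonempty h₁ h₂ hε (supp_nonneg hK x) (supp_nonneg hL x)
  have hle : ∀ t : ℝ, 0 < t → ∀ x,
      orliczSupp φ₁ φ₂ K L 1 ε (t • x) ≤ t * orliczSupp φ₁ φ₂ K L 1 ε x := by
    intro t ht x
    rw [← inv_mul_le_iff₀ ht, orliczSupp_eq φ₁ φ₂ K L ε x]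
    refine le_csInf (hne x) ?_
    rintro l ⟨hl0, hl⟩
    rw [inv_mul_le_iff₀ ht]
    refine csInf_le (bddBelow_orliczSet φ₁ φ₂ ε (supp K (t • x)) (supp L (t • x)))
      ⟨by positivity, ?_⟩
    rwa [supp_smul K ht, supp_smul L ht, mul_div_mul_left _ _ ht.ne', mul_div_mul_left _ _ ht.ne']
  refine supp_eq_of_sublinear (fun y => Iff.rfl) (fun t ht x => (hle t ht x).antisymm ?_)
    fun x y => ?_
  · have h := hle t⁻¹ (inv_pos.2 ht) (t • x)
    rw [smul_smul, inv_mul_cancel₀ ht.ne', one_smul] at h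
    rwa [← le_inv_mul_iff₀ ht]
  · rw [orliczSupp_eq φ₁ φ₂ K L ε x, ← sub_le_iff_le_add]
    refine le_csInf (hne x) fun l₁ hl₁ => ?_
    rw [sub_le_iff_le_add, ← sub_le_iff_le_add', orliczSupp_eq φ₁ φ₂ K L ε y]
    refine le_csInf (hne y) fun l₂ hl₂ => ?_
    rw [sub_le_iff_le_add']
    exact csInf_le (bddBelow_orliczSet _ _ _ _ _) (add_mem_orliczSet h₁ h₂ hε
      (supp_nonneg hK _) (supp_nonneg hK _) (supp_nonneg hK _) (supp_nonneg hL _)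
      (supp_nonneg hL _) (supp_nonneg hL _) (supp_add_le K x y) (supp_add_le L x y) hl₁ hl₂)

/-- The first order variation of the support function under the Orlicz combination. -/
def orliczVar (φ₁ φ₂ : ℝ → ℝ) (K L : ConvexBody (E n)) (x : E n) : ℝ :=
  supp K x / leftDeriv φ₁ 1 * φ₂ (supp L x / supp K x)

theorem exists_supp_le (K : ConvexBody (E n)) : ∃ R, 0 < R ∧ ∀ x, ‖x‖ = 1 → supp K x ≤ R := by
  obtain ⟨R, hR0, hR⟩ := exists_norm_le K
  refine ⟨R, hR0, fun x hx => supp_le fun y hy => ?_⟩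
  have := real_inner_le_norm x y
  rw [hx, one_mul] at this
  exact this.trans (hR y hy)

theorem supp_orliczComb_expansion (h₁ : IsOrlicz φ₁) (h₂ : IsOrlicz φ₂)
    (hK : (0 : E n) ∈ interior (K : Set (E n))) (hL : (0 : E n) ∈ L) {δ : ℝ} (hδ : 0 < δ) :
    ∀ᶠ ε : ℝ in 𝓝[>] 0, ∀ x, ‖x‖ = 1 →
      supp K x + ε * (orliczVar φ₁ φ₂ K L x - δ) ≤ supp (orliczComb φ₁ φ₂ K L 1 ε) x ∧
      supp (orliczComb φ₁ φ₂ K L 1 ε) x ≤ supp K x + ε * (orliczVar φ₁ φ₂ K L x + δ) := by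
  obtain ⟨m, hm, hKm⟩ := exists_le_supp hK
  obtain ⟨R, hR0, hKR⟩ := exists_supp_le K
  obtain ⟨R', hR0', hLR⟩ := exists_supp_le L
  have hx0 : ‖(stdVec 0 : E n)‖ = 1 := by simp
  have hmR : m ≤ max R R' := ((hKm _ hx0).trans (hKR _ hx0)).trans (le_max_left _ _)
  filter_upwards [self_mem_nhdsWithin, orlicz_expansion h₁ h₂ hm hmR hδ] with ε hε h x hx
  have hε0 : (0 : ℝ) < ε := hε
  rw [supp_orliczComb h₁ h₂ (interior_subset hK) hL hε0.le]
  exact h (supp K x) ⟨hKm x hx, (hKR x hx).trans (le_max_left _ _)⟩ (supp L x)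
    ⟨supp_nonneg hL x, (hLR x hx).trans (le_max_right _ _)⟩

theorem continuous_orliczVar (φ₁ : ℝ → ℝ) (h₂ : IsOrlicz φ₂)
    (hK : (0 : E n) ∈ interior (K : Set (E n))) (hL : (0 : E n) ∈ L) :
    Continuous fun x : Metric.sphere (0 : E n) 1 => orliczVar φ₁ φ₂ K L x := by
  obtain ⟨m, hm, hKm⟩ := exists_le_supp hK
  obtain ⟨R, hR0, hLR⟩ := exists_supp_le L
  have hKc : Continuous fun x : Metric.sphere (0 : E n) 1 => supp K x :=
    (continuous_supp K).comp continuous_subtype_val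
  have hLc : Continuous fun x : Metric.sphere (0 : E n) 1 => supp L x :=
    (continuous_supp L).comp continuous_subtype_val
  have hpos : ∀ x : Metric.sphere (0 : E n) 1, 0 < supp K x := fun x =>
    hm.trans_le (hKm x (by simp))
  refine (hKc.div_const _).mul (ContinuousOn.comp_continuous (h₂.continuousOn (R / m))
    (hLc.div hKc fun x => (hpos x).ne') fun x => ⟨?_, ?_⟩)
  · exact div_nonneg (supp_nonneg hL x) (hpos x).le
  · exact div_le_div₀ hR0.le (hLR x (by simp)) hm (hKm x (by simp))

/-- Tietze extension followed by smooth approximation. It is needed because the first-order term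
depends on L and φ₂ and is only continuous. -/
theorem exists_contDiff_sphere_approx {g : E n → ℝ}
    (hg : Continuous fun x : Metric.sphere (0 : E n) 1 => g x) {δ : ℝ} (hδ : 0 < δ) :
    ∃ ψ : E n → ℝ, SphereContDiff 2 ψ ∧ ∀ x, ‖x‖ = 1 → |ψ x - g x| < δ := by
  obtain ⟨G, hG⟩ := ContinuousMap.exists_restrict_eq (Metric.isClosed_sphere (x := (0 : E n)) (ε := 1))
    ⟨_, hg⟩
  obtain ⟨ψ, hψ, hd, -⟩ := G.continuous.exists_contDiff_approx 2 (continuous_const (y := δ))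
    fun _ => hδ
  refine ⟨ψ, sphereContDiff_of_contDiff hψ, fun x hx => ?_⟩
  have h1 : G x = g x := congrArg (fun f => f ⟨x, by simpa using hx⟩) hG
  have h2 := hd x
  rwa [Real.dist_eq, h1] at h2

/-! ### The variation of the quermassintegral -/

variable {F : (Fin n → ℝ) → ℝ} {k : ℕ}

theorem sphereIntegral_mono {f g : E n → ℝ}
    (hf : Continuous fun x : Metric.sphere (0 : E n) 1 => f x)
    (hg : Continuous fun x : Metric.sphere (0 : E n) 1 => g x) (h : ∀ x, ‖x‖ = 1 → f x ≤ g x) :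
    sphereIntegral f ≤ sphereIntegral g :=
  integral_mono (integrable_sphere hf) (integrable_sphere hg) fun x => h x (by simp)

theorem sphereIntegral_add_const_mul {f g : E n → ℝ}
    (hf : Continuous fun x : Metric.sphere (0 : E n) 1 => f x)
    (hg : Continuous fun x : Metric.sphere (0 : E n) 1 => g x) (c : ℝ) :
    (sphereIntegral fun x => (f x + c) * g x) =
      (sphereIntegral fun x => f x * g x) + c * sphereIntegral g := by
  rw [← sphereIntegral_const_mul]
  simp only [sphereIntegral, add_mul]
  exact integral_add (integrable_sphere (hf.mul hg)) (integrable_sphere (continuous_const.mul hg))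

/-- The combination is enclosed between the C² perturbations u_K + ε(ψ ± 2δ), with ψ within δ of the
first-order term. `quermass_sandwich` transfers this to W_F, and the C² first variation evaluates
both bounds up to 3δJ. -/
theorem tendsto_quermass_orliczComb (hF : IsAdmissible F k) (h₁ : IsOrlicz φ₁) (h₂ : IsOrlicz φ₂)
    (hreg : IsRegular 2 K) (hK : (0 : E n) ∈ interior (K : Set (E n))) (hL : (0 : E n) ∈ L) :
    Tendsto (fun ε : ℝ => (quermass F k (orliczComb φ₁ φ₂ K L 1 ε) - quermass F k K) / ε)
      (𝓝[>] 0) (𝓝 (sphereIntegral fun x => orliczVar φ₁ φ₂ K L x * density F k (supp K) x)) := by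
  obtain ⟨hu, hp⟩ := hreg
  obtain ⟨m, hm, hKm⟩ := exists_le_supp hK
  have hgc := continuous_orliczVar φ₁ h₂ hK hL
  have hfc := continuous_density hF hu hp
  have hf0 : ∀ x, ‖x‖ = 1 → 0 ≤ density F k (supp K) x := fun x hx =>
    (density_pos hF.isCurvatureFunction hu hp hx).le
  set I := sphereIntegral fun x => orliczVar φ₁ φ₂ K L x * density F k (supp K) x with hI
  set J := sphereIntegral (density F k (supp K)) with hJ
  rw [quermass_of_isRegular ⟨hu, hp⟩]
  have hmain : ∀ δ : ℝ, 0 < δ → ∃ v₁ v₂ : E n → ℝ,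
      I - 3 * δ * J ≤ (sphereIntegral fun x => v₁ x * density F k (supp K) x) ∧
      (sphereIntegral fun x => v₂ x * density F k (supp K) x) ≤ I + 3 * δ * J ∧
      SphereContDiff 2 v₁ ∧ SphereContDiff 2 v₂ ∧
      ∀ᶠ ε : ℝ in 𝓝[>] 0,
        quermassFun F k (supp K + ε • v₁) ≤ quermass F k (orliczComb φ₁ φ₂ K L 1 ε) ∧
        quermass F k (orliczComb φ₁ φ₂ K L 1 ε) ≤ quermassFun F k (supp K + ε • v₂) := by
    intro δ hδ
    obtain ⟨ψ, hψ, hψg⟩ := exists_contDiff_sphere_approx hgc hδ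
    have hv : ∀ c : ℝ, SphereContDiff 2 (ψ + fun _ => c) := fun c =>
      hψ.add (sphereContDiff_const c)
    -- One δ pays for the approximation by ψ and one for the remainder of the expansion; hence ψ ±
    -- 2δ lies within 3δ of the first-order term.
    refine ⟨ψ + fun _ => -(2 * δ), ψ + fun _ => 2 * δ, ?_, ?_, hv _, hv _, ?_⟩
    · have h := sphereIntegral_add_const_mul hgc hfc (-(3 * δ))
      have e : I - 3 * δ * J = sphereIntegral fun x =>
          (orliczVar φ₁ φ₂ K L x + -(3 * δ)) * density F k (supp K) x := by rw [h]; ring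
      rw [e]
      refine sphereIntegral_mono ((hgc.add continuous_const).mul hfc)
        ((hv _).continuous_sphere.mul hfc) fun x hx => ?_
      refine mul_le_mul_of_nonneg_right ?_ (hf0 x hx)
      have := (abs_lt.1 (hψg x hx)).1
      simp only [Pi.add_apply]
      linarith
    · have h := sphereIntegral_add_const_mul hgc hfc (3 * δ)
      rw [← h]
      refine sphereIntegral_mono ((hv _).continuous_sphere.mul hfc)
        ((hgc.add continuous_const).mul hfc) fun x hx => ?_
      refine mul_le_mul_of_nonneg_right ?_ (hf0 x hx)
      have := (abs_lt.1 (hψg x hx)).2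
      simp only [Pi.add_apply]
      linarith
    -- Keeps the support function of the combination above m/2, as the sandwich requires.
    · have hsmall : ∀ᶠ ε : ℝ in 𝓝 0, ε * δ < m / 2 :=
        (Continuous.tendsto (by fun_prop) 0).eventually_lt_const (by rw [zero_mul]; positivity)
      filter_upwards [self_mem_nhdsWithin, nhdsWithin_le_nhds hsmall,
        supp_orliczComb_expansion h₁ h₂ hK hL hδ,
        nhdsWithin_le_nhds (hp.eventually_add_smul hu (hv (-(2 * δ)))),
        nhdsWithin_le_nhds (hp.eventually_add_smul hu (hv (2 * δ)))] with ε hε hεδ hexp hp₁ hp₂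
      have hε0 : (0 : ℝ) < ε := hε
      refine quermass_sandwich hF _ (half_pos hm) (fun x hx => ?_) (hu.add_smul (hv _) ε)
        (hu.add_smul (hv _) ε) hp₁ hp₂ (fun x hx => ?_) fun x hx => ?_
      · have h0 : 0 ≤ orliczVar φ₁ φ₂ K L x :=
          mul_nonneg (div_nonneg (hm.le.trans (hKm x hx)) h₁.leftDeriv_pos.le)
            (h₂.nonneg (div_nonneg (supp_nonneg hL x) (hm.le.trans (hKm x hx))))
        have := (hexp x hx).1
        have := hKm x hx
        nlinarith [mul_nonneg hε0.le h0]
      · refine le_trans ?_ (hexp x hx).1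
        have := (abs_lt.1 (hψg x hx)).2
        simp only [Pi.add_apply, Pi.smul_apply, smul_eq_mul]
        have := mul_le_mul_of_nonneg_left
          (show ψ x + -(2 * δ) ≤ orliczVar φ₁ φ₂ K L x - δ by linarith) hε0.le
        linarith
      · refine (hexp x hx).2.trans ?_
        have := (abs_lt.1 (hψg x hx)).1
        simp only [Pi.add_apply, Pi.smul_apply, smul_eq_mul]
        have := mul_le_mul_of_nonneg_left
          (show orliczVar φ₁ φ₂ K L x + δ ≤ ψ x + 2 * δ by linarith) hε0.le
        linarith
  have hJδ : ∀ η : ℝ, 0 < η → ∃ δ : ℝ, 0 < δ ∧ 3 * δ * J < η := by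
    intro η hη
    have h : ∀ᶠ δ : ℝ in 𝓝[>] 0, 3 * δ * J < η :=
      nhdsWithin_le_nhds ((Continuous.tendsto (by fun_prop) (0 : ℝ)).eventually_lt_const
        (by simpa using hη))
    obtain ⟨δ, hlt, hδ⟩ := (h.and self_mem_nhdsWithin).exists
    exact ⟨δ, hδ, hlt⟩
  refine tendsto_order.2 ⟨fun a ha => ?_, fun a ha => ?_⟩
  · obtain ⟨δ, hδ, hlt⟩ := hJδ (I - a) (by linarith)
    obtain ⟨v₁, v₂, hlo, -, hv₁, -, hev⟩ := hmain δ hδ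
    filter_upwards [self_mem_nhdsWithin, hev,
      (tendsto_quermassFun_variation hF hu hv₁ hp).eventually_const_lt
        (show a < _ by linarith)] with ε hε h1 h2
    exact h2.trans_le (div_le_div_of_nonneg_right (by linarith [h1.1]) (le_of_lt hε))
  · obtain ⟨δ, hδ, hlt⟩ := hJδ (a - I) (by linarith)
    obtain ⟨v₁, v₂, -, hhi, -, hv₂, hev⟩ := hmain δ hδ
    filter_upwards [self_mem_nhdsWithin, hev,
      (tendsto_quermassFun_variation hF hu hv₂ hp).eventually_lt_const
        (show _ < a by linarith)] with ε hε h1 h2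
    exact (div_le_div_of_nonneg_right (by linarith [h1.2]) (le_of_lt hε)).trans_lt h2

end

end

end OrliczQuermass
open OrliczQuermass
theorem theorem1p7 (n : ℕ) (hn : 1 ≤ n)
    (F : (Fin n → ℝ) → ℝ) (hF : IsCurvatureFunction F)
    (k : ℕ) (hk : 1 ≤ k) (hdiv : IsDivergenceFree F k)
    (φ₁ φ₂ : ℝ → ℝ) (hφ₁ : IsOrlicz φ₁) (hφ₂ : IsOrlicz φ₂)
    (K L : ConvexBody (E n))
    (hK : IsRegular ∞ K) (hK0 : (0 : E n) ∈ interior (K : Set (E n)))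
    (hL0 : (0 : E n) ∈ L) :
    Tendsto
      (fun ε : ℝ => (quermass F k (orliczComb φ₁ φ₂ K L 1 ε) - quermass F k K) / ε)
      (𝓝[>] 0)
      (𝓝 (sphereIntegral fun x =>
        supp K x / leftDeriv φ₁ 1 * φ₂ (supp L x / supp K x) * F (radii K x) ^ k)) :=
  tendsto_quermass_orliczComb (hF.isAdmissible hdiv) hφ₁ hφ₂
    ⟨ContDiffOn.of_le hK.1 (WithTop.coe_le_coe.2 le_top), hK.2⟩ hK0 hL0
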